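/- Let $B>0$, let $q\ge 1$ be an integer and let $\vartheta\in[0,1)^3$. Put $\mathbf B=Be_3$, $\mathbf A(x)=\frac12\mathbf B\wedge x$, $\Lambda_B=\sqrt{2\pi/B}\,\mathbb Z^3$, and let $Q_B=[0,\sqrt{2\pi/B})^3$ be its unit cell. For $v\in\mathbb R^3$ define the magnetic translation $$(T_{B,q}(v)\Psi)(x)=e^{\mathrm i\frac q2\mathbf B\cdot(v\wedge x)}\,\Psi(x+v).$$ Let $L^{q,2}_{\mathrm{mag}}(Q_B)$ be the Hilbert space, with the inner product of $L^2(Q_B)$, of functions $\Psi\in L^2_{\mathrm{loc}}(\mathbb R^3)$ which are gauge-periodic, i.e. $T_{B,q}(b_j)\Psi=\Psi$ a.e. for the three basis vectors $b_j=\sqrt{2\pi/B}\,e_j$ of $\Lambda_B$. With $\Pi_q=-\mathrm i\nabla+q\mathbf A$ let $H^{q,2}_{\mathrm{mag}}(Q_B)$ be the space of all $\Psi\in L^{q,2}_{\mathrm{mag}}(Q_B)$ such that $\Pi_q^\nu\Psi\in L^{q,2}_{\mathrm{mag}}(Q_B)$ (in the sense of distributions) for all multi-indices $|\nu|\le 2$,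 and consider the fibered periodic Landau Hamiltonian $$\Pi_q(\vartheta)^2,\qquad \Pi_q(\vartheta)=-\mathrm i\nabla+q\mathbf A+\sqrt{2\pi B}\,\vartheta,$$ as an unbounded operator on $L^{q,2}_{\mathrm{mag}}(Q_B)$ with domain $H^{q,2}_{\mathrm{mag}}(Q_B)$. For $k\in\mathbb N_0$, $p\in\mathbb Z$ put $$E(k,p)=E_{q,B,\vartheta}(k,p)=qB(2k+1)+2\pi B(p+\vartheta_3)^2 .$$ Then the following holds. 1. The spectrum of $\Pi_q(\vartheta)^2$ is the set $\{E(k,p):k\in\mathbb N_0,\ p\in\mathbb Z\}$, and each of its points is isolated in the spectrum. 2. The spectrum is pure point, and each label $(k,p)$ has multiplicity exactly $q$: there is an orthonormal basis $(\psi_{k,p,m})_{k\in\mathbb N_0,\,p\in\mathbb Z,\,1\le m\le q}$ of $L^{q,2}_{\mathrm{mag}}(Q_B)$ which consists of functions in $H^{q,2}_{\mathrm{mag}}(Q_B)$ with $\Pi_q(\vartheta)^2\psi_{k,p,m}=E(k,p)\,\psi_{k,p,m}$. 3. For every $(k,p)$ the kernel of $\Pi_q(\vartheta)^2-E(k,p)$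 is finite dimensional, only finitely many labels $(k',p')$ satisfy $E(k',p')=E(k,p)$, and $$\dim\ker\bigl(\Pi_q(\vartheta)^2-E(k,p)\bigr)=q\cdot\#\{(k',p')\in\mathbb N_0\times\mathbb Z:\ E(k',p')=E(k,p)\}.$$ In particular $\dim\ker(\Pi_q(\vartheta)^2-E(k,p))=q$ whenever no other label has the same energy as $(k,p)$. For given $B$ and $q$, the set of all real values of $\vartheta_3$ for which $(k,p)\mapsto E(k,p)$ fails to be injective is countable. -/

import Mathlib

open MeasureTheory Matrix
open scoped ContDiff

noncomputable section

namespace PeriodicLandau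

/-- Physical space `ℝ³` with Lebesgue measure. Only its linear, smooth and measurable structure is
used below, never the norm. -/
abbrev E3 : Type := Fin 3 → ℝ

/-- The constant magnetic field `𝐁 = B e₃`. -/
def field (B : ℝ) : E3 := ![0, 0, B]

/-- The vector potential `𝐀(x) = ½ 𝐁 ∧ x`. -/
def vectorPotential (B : ℝ) (x : E3) : E3 := (1 / 2 : ℝ) • (crossProduct (field B) x)

/-- The lattice constant `√(2π/B)` of the cubic lattice `Λ_B = √(2π/B) ℤ³`. -/
def latticeConst (B : ℝ) : ℝ := Real.sqrt (2 * Real.pi / B)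

/-- The basis vectors `√(2π/B) e_j` of `Λ_B`. -/
def latticeVec (B : ℝ) (j : Fin 3) : E3 := Pi.single j (latticeConst B)

/-- The fundamental cell `Q_B = [0, √(2π/B))³`. -/
def cell (B : ℝ) : Set E3 := Set.univ.pi fun _ => Set.Ico 0 (latticeConst B)

/-- The magnetic translation of charge `q`,
`(T(v)Ψ)(x) = exp(i (q/2) 𝐁 · (v ∧ x)) Ψ(x + v)`. -/
def magTranslation (B : ℝ) (q : ℕ) (v : E3) (Ψ : E3 → ℂ) (x : E3) : ℂ :=
  Complex.exp (Complex.I * ((q / 2 * (field B ⬝ᵥ crossProduct v x) : ℝ) : ℂ)) * Ψ (x + v)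

/-- Gauge-periodicity: almost everywhere invariance under the magnetic translations by the three
basis vectors of the lattice `Λ_B`, hence under the (abelian) group which they generate. (One has
`T(v+w) = exp(i (q/2) 𝐁·(v ∧ w)) T(v) T(w)`, where the factor is `1` on `Λ_B` if `q` is even
and `±1` if `q` is odd.) -/
def IsGaugePeriodic (B : ℝ) (q : ℕ) (Ψ : E3 → ℂ) : Prop :=
  ∀ j : Fin 3, magTranslation B q (latticeVec B j) Ψ =ᵐ[volume] Ψ

lemma ae_translate {p : E3 → Prop} (h : ∀ᵐ x, p x) (v : E3) : ∀ᵐ x, p (x + v) :=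
  (measurePreserving_add_right (volume : Measure E3) v).quasiMeasurePreserving.ae h

/-- The space of gauge-periodic `L²_loc(ℝ³)`-functions (modulo equality almost everywhere). -/
def MagL2 (B : ℝ) (q : ℕ) : Submodule ℂ (E3 →ₘ[volume] ℂ) where
  carrier := {Ψ | (∀ K : Set E3, IsCompact K → MemLp Ψ 2 (volume.restrict K)) ∧
    IsGaugePeriodic B q Ψ}
  zero_mem' := by
    refine ⟨fun K _ => ?_, fun j => ?_⟩
    · exact (MemLp.zero (ε := ℂ)).ae_eq (ae_restrict_of_ae (AEEqFun.coeFn_zero.symm))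
    · filter_upwards [AEEqFun.coeFn_zero (α := E3) (β := ℂ) (μ := volume),
        ae_translate (AEEqFun.coeFn_zero (α := E3) (β := ℂ) (μ := volume)) (latticeVec B j)]
        with x h1 h2
      simp [magTranslation, h1, h2]
  add_mem' := by
    rintro f g ⟨hf, hf'⟩ ⟨hg, hg'⟩
    refine ⟨fun K hK => ?_, fun j => ?_⟩
    · exact ((hf K hK).add (hg K hK)).ae_eq (ae_restrict_of_ae (AEEqFun.coeFn_add f g).symm)
    · filter_upwards [AEEqFun.coeFn_add f g, ae_translate (AEEqFun.coeFn_add f g) (latticeVec B j),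
        hf' j, hg' j] with x h1 h2 h3 h4
      simp only [magTranslation, Pi.add_apply] at *
      rw [h1, h2, mul_add, h3, h4]
  smul_mem' := by
    rintro c f ⟨hf, hf'⟩
    refine ⟨fun K hK => ?_, fun j => ?_⟩
    · exact ((hf K hK).const_smul c).ae_eq (ae_restrict_of_ae (AEEqFun.coeFn_smul c f).symm)
    · filter_upwards [AEEqFun.coeFn_smul c f, ae_translate (AEEqFun.coeFn_smul c f) (latticeVec B j),
        hf' j] with x h1 h2 h3
      simp only [magTranslation, Pi.smul_apply, smul_eq_mul] at *
      rw [h1, h2, mul_left_comm, h3]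

section HilbertSpace

variable {B : ℝ} {q : ℕ}

lemma cell_subset (B : ℝ) : cell B ⊆ Set.Icc 0 (fun _ => latticeConst B) := fun _ hx =>
  ⟨fun j => (hx j trivial).1, fun j => (hx j trivial).2.le⟩

lemma MagL2.memLp_cell (Ψ : MagL2 B q) : MemLp (Ψ : E3 →ₘ[volume] ℂ) 2 (volume.restrict (cell B)) :=
  (Ψ.2.1 _ isCompact_Icc).mono_measure (Measure.restrict_mono (cell_subset B) le_rfl)

/-- Restriction of a gauge-periodic function to the fundamental cell. -/
def MagL2.restrict (B : ℝ) (q : ℕ) : MagL2 B q →ₗ[ℂ] Lp ℂ 2 ((volume : Measure E3).restrict (cell B)) where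
  toFun Ψ := (MagL2.memLp_cell Ψ).toLp _
  map_add' f g := by
    rw [← MemLp.toLp_add, MemLp.toLp_eq_toLp_iff]
    exact ae_restrict_of_ae (AEEqFun.coeFn_add _ _)
  map_smul' c f := by
    rw [RingHom.id_apply, ← MemLp.toLp_const_smul, MemLp.toLp_eq_toLp_iff]
    exact ae_restrict_of_ae (AEEqFun.coeFn_smul _ _)

/-- The translations that leave `|f|` invariant almost everywhere. -/
def absPeriods (f : E3 → ℂ) : AddSubgroup E3 where
  carrier := {v | ∀ᵐ x, ‖f (x + v)‖ = ‖f x‖}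
  zero_mem' := by simp
  add_mem' := by
    intro v w hv hw
    filter_upwards [hv, ae_translate hw v] with x h1 h2
    rw [← add_assoc, h2, h1]
  neg_mem' := by
    intro v hv
    filter_upwards [ae_translate hv (-v)] with x h1
    simpa using h1.symm

lemma IsGaugePeriodic.absPeriod {f : E3 → ℂ} (hf : IsGaugePeriodic B q f) (n : Fin 3 → ℤ) :
    ∀ᵐ x, ‖f (x + fun j => n j * latticeConst B)‖ = ‖f x‖ := by
  have h1 : ∀ j, latticeVec B j ∈ absPeriods f := fun j => by
    filter_upwards [hf j] with x hx
    rw [← hx, magTranslation, norm_mul, mul_comm Complex.I, Complex.norm_exp_ofReal_mul_I, one_mul]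
  have h2 : (fun j => n j * latticeConst B : E3) = ∑ j, n j • latticeVec B j := by
    ext i
    simp [latticeVec, Finset.sum_apply, Pi.single_apply]
  rw [h2]
  exact (absPeriods f).sum_mem fun j _ => (absPeriods f).zsmul_mem (h1 j) (n j)

lemma latticeConst_pos [hB : Fact (0 < B)] : 0 < latticeConst B :=
  Real.sqrt_pos.2 (div_pos (by positivity) hB.out)

lemma IsGaugePeriodic.eq_zero [Fact (0 < B)] {f : E3 → ℂ} (hf : IsGaugePeriodic B q f)
    (h0 : ∀ᵐ x, x ∈ cell B → f x = 0) : ∀ᵐ x, f x = 0 := by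
  have hl := latticeConst_pos (B := B)
  have h1 : ∀ n : Fin 3 → ℤ, ∀ᵐ x, x - (fun j => n j * latticeConst B : E3) ∈ cell B → f x = 0 := by
    intro n
    have := ae_translate (h0.and (hf.absPeriod n)) (-(fun j => n j * latticeConst B : E3))
    filter_upwards [this] with x hx hxc
    have h2 := hx.1 (by simpa [sub_eq_add_neg] using hxc)
    have h3 := hx.2
    rw [h2] at h3
    simpa using h3
  filter_upwards [ae_all_iff.2 h1] with x hx
  refine hx (fun j => ⌊x j / latticeConst B⌋) fun j _ => ?_
  have a := Int.floor_le (x j / latticeConst B)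
  have b := Int.lt_floor_add_one (x j / latticeConst B)
  rw [le_div_iff₀ hl] at a
  rw [div_lt_iff₀ hl] at b
  simp only [Pi.sub_apply, Set.mem_Ico]
  constructor <;> linarith

lemma MagL2.restrict_injective (B : ℝ) (q : ℕ) [Fact (0 < B)] :
    Function.Injective (MagL2.restrict B q) := by
  rw [injective_iff_map_eq_zero]
  intro Ψ h
  have hm : MeasurableSet (cell B) := MeasurableSet.univ_pi fun _ => measurableSet_Ico
  have h1 : (Ψ : E3 → ℂ) =ᵐ[volume.restrict (cell B)] 0 := by
    have e : (MagL2.memLp_cell Ψ).toLp _ = 0 := h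
    filter_upwards [(MagL2.memLp_cell Ψ).coeFn_toLp, Lp.coeFn_zero ℂ 2 (volume.restrict (cell B))]
      with x hx hx'
    rw [← hx, e, hx']
  have h2 := Ψ.2.2.eq_zero ((ae_restrict_iff' hm).1 h1)
  apply Subtype.ext
  apply AEEqFun.ext
  filter_upwards [h2, AEEqFun.coeFn_zero (α := E3) (β := ℂ) (μ := volume)] with x hx hx'
  rw [hx]
  exact hx'.symm

/-- The `L²(Q_B)`-norm. -/
instance [Fact (0 < B)] : NormedAddCommGroup (MagL2 B q) :=
  NormedAddCommGroup.induced _ _ (MagL2.restrict B q) (MagL2.restrict_injective B q)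

lemma MagL2.inner_restrict (f g : MagL2 B q) :
    inner ℂ (MagL2.restrict B q f) (MagL2.restrict B q g) =
      ∫ x in cell B, inner ℂ ((f : E3 →ₘ[volume] ℂ) x) ((g : E3 →ₘ[volume] ℂ) x) := by
  rw [L2.inner_def]
  apply integral_congr_ae
  filter_upwards [(MagL2.memLp_cell f).coeFn_toLp, (MagL2.memLp_cell g).coeFn_toLp] with x h1 h2
  change inner ℂ ((MagL2.memLp_cell f).toLp _ x) ((MagL2.memLp_cell g).toLp _ x) = _
  rw [h1, h2]

/-- The `L²(Q_B)`-inner product `⟨Ψ, Φ⟩ = ∫_{Q_B} conj(Ψ) Φ`, antilinear in the first slot. -/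
instance [Fact (0 < B)] : InnerProductSpace ℂ (MagL2 B q) where
  norm_smul_le c f := by
    change ‖MagL2.restrict B q (c • f)‖ ≤ ‖c‖ * ‖MagL2.restrict B q f‖
    rw [map_smul, norm_smul]
  inner f g := ∫ x in cell B, inner ℂ ((f : E3 →ₘ[volume] ℂ) x) ((g : E3 →ₘ[volume] ℂ) x)
  norm_sq_eq_re_inner f := by
    rw [← MagL2.inner_restrict]
    exact norm_sq_eq_re_inner (𝕜 := ℂ) (MagL2.restrict B q f)
  conj_inner_symm f g := by
    rw [← MagL2.inner_restrict, ← MagL2.inner_restrict, inner_conj_symm]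
  add_left f g h := by
    rw [← MagL2.inner_restrict, ← MagL2.inner_restrict, ← MagL2.inner_restrict, map_add,
      inner_add_left]
  smul_left f g c := by
    rw [← MagL2.inner_restrict, ← MagL2.inner_restrict, map_smul, inner_smul_left]

end HilbertSpace

/-! Momentum operators act in the sense of distributions, that is, by their transposes on test
functions. -/

/-- Complex-valued test functions `C_c^∞(ℝ³)`. -/
def IsTest (φ : E3 → ℂ) : Prop := ContDiff ℝ ∞ φ ∧ HasCompactSupport φ

/-- The transpose `i ∂_j + q 𝐀_j + √(2πB) ϑ_j` of the `j`-th component of the momentum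
`Π_q(ϑ) = -i∇ + q𝐀 + √(2πB) ϑ`. -/
def momentumT (B : ℝ) (q : ℕ) (ϑ : E3) (j : Fin 3) (φ : E3 → ℂ) (x : E3) : ℂ :=
  Complex.I * fderiv ℝ φ x (Pi.single j 1) +
    ((q * vectorPotential B x j + Real.sqrt (2 * Real.pi * B) * ϑ j : ℝ) : ℂ) * φ x

/-- The transpose of `Π_q^ν = (Π_q^{(1)})^{ν₁} (Π_q^{(2)})^{ν₂} (Π_q^{(3)})^{ν₃}`, where
`Π_q = -i∇ + q𝐀`. -/
def momentumPowT (B : ℝ) (q : ℕ) (ν : Fin 3 → ℕ) (φ : E3 → ℂ) : E3 → ℂ :=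
  (momentumT B q 0 2)^[ν 2] ((momentumT B q 0 1)^[ν 1] ((momentumT B q 0 0)^[ν 0] φ))

/-- The transpose of `Π_q(ϑ)² = ∑_j (Π_q(ϑ)^{(j)})²`. -/
def momentumSqT (B : ℝ) (q : ℕ) (ϑ : E3) (φ : E3 → ℂ) (x : E3) : ℂ :=
  ∑ j, momentumT B q ϑ j (momentumT B q ϑ j φ) x

/-- `Φ = P Ψ` in the sense of distributions, where `PT` is the transpose of the differential
operator `P`. -/
def IsWeakImage (PT : (E3 → ℂ) → E3 → ℂ) (Ψ Φ : E3 → ℂ) : Prop :=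
  ∀ φ, IsTest φ → ∫ x, Φ x * φ x = ∫ x, Ψ x * PT φ x

section Operator

variable {B : ℝ} {q : ℕ}

lemma IsTest.momentumT {φ : E3 → ℂ} (h : IsTest φ) (ϑ : E3) (j : Fin 3) :
    IsTest (momentumT B q ϑ j φ) := by
  obtain ⟨h1, h2⟩ := h
  have hA : ContDiff ℝ ∞ fun x : E3 => vectorPotential B x j := by
    unfold vectorPotential
    fin_cases j <;> simp [cross_apply] <;> fun_prop
  refine ⟨?_, ?_⟩
  · have h3 : ContDiff ℝ ∞ fun x => fderiv ℝ φ x (Pi.single j 1) :=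
      (h1.fderiv_right (m := ∞) (by simp)).clm_apply contDiff_const
    have h4 : ContDiff ℝ ∞ fun x : E3 =>
        ((q * vectorPotential B x j + Real.sqrt (2 * Real.pi * B) * ϑ j : ℝ) : ℂ) :=
      Complex.ofRealCLM.contDiff.comp ((contDiff_const.mul hA).add contDiff_const)
    exact (contDiff_const.mul h3).add (h4.mul h1)
  · exact (h2.fderiv_apply ℝ (Pi.single j 1)).mul_left.add h2.mul_left

lemma IsTest.momentumPowT {φ : E3 → ℂ} (h : IsTest φ) (ν : Fin 3 → ℕ) :
    IsTest (momentumPowT B q ν φ) := by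
  have key : ∀ (j : Fin 3) (n : ℕ) (χ : E3 → ℂ), IsTest χ →
      IsTest ((PeriodicLandau.momentumT B q 0 j)^[n] χ) := by
    intro j n
    induction n with
    | zero => exact fun χ hχ => hχ
    | succ n ih => exact fun χ hχ => ih _ (hχ.momentumT 0 j)
  exact key _ _ _ (key _ _ _ (key _ _ _ h))

lemma MagL2.locallyIntegrable (Ψ : MagL2 B q) :
    LocallyIntegrable (Ψ : E3 →ₘ[volume] ℂ) volume := by
  rw [locallyIntegrable_iff]
  intro K hK
  have : IsFiniteMeasure ((volume : Measure E3).restrict K) := ⟨by simpa using hK.measure_lt_top⟩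
  exact (Ψ.2.1 K hK).integrable (by norm_num)

lemma MagL2.integrable_mul (Ψ : MagL2 B q) {φ : E3 → ℂ} (h : IsTest φ) :
    Integrable fun x => (Ψ : E3 →ₘ[volume] ℂ) x * φ x :=
  (MagL2.locallyIntegrable Ψ).integrable_smul_right_of_hasCompactSupport h.1.continuous h.2

lemma integral_add_mul (F G : MagL2 B q) {χ : E3 → ℂ} (hχ : IsTest χ) :
    ∫ x, ((F + G : MagL2 B q) : E3 →ₘ[volume] ℂ) x * χ x =
      (∫ x, (F : E3 →ₘ[volume] ℂ) x * χ x) + ∫ x, (G : E3 →ₘ[volume] ℂ) x * χ x := by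
  rw [← integral_add (MagL2.integrable_mul F hχ) (MagL2.integrable_mul G hχ)]
  apply integral_congr_ae
  filter_upwards [AEEqFun.coeFn_add (F : E3 →ₘ[volume] ℂ) G] with x hx
  rw [Submodule.coe_add, hx, Pi.add_apply, add_mul]

lemma integral_smul_mul (c : ℂ) (F : MagL2 B q) (χ : E3 → ℂ) :
    ∫ x, ((c • F : MagL2 B q) : E3 →ₘ[volume] ℂ) x * χ x =
      c * ∫ x, (F : E3 →ₘ[volume] ℂ) x * χ x := by
  rw [← integral_const_mul]
  apply integral_congr_ae
  filter_upwards [AEEqFun.coeFn_smul c (F : E3 →ₘ[volume] ℂ)] with x hx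
  rw [Submodule.coe_smul, hx, Pi.smul_apply, smul_eq_mul, mul_assoc]

lemma isWeakImage_add {PT : (E3 → ℂ) → E3 → ℂ} (hP : ∀ φ, IsTest φ → IsTest (PT φ))
    {Ψ Ψ' Φ Φ' : MagL2 B q} (h : IsWeakImage PT Ψ Φ) (h' : IsWeakImage PT Ψ' Φ') :
    IsWeakImage PT (Ψ + Ψ' : MagL2 B q) (Φ + Φ' : MagL2 B q) := by
  intro φ hφ
  rw [integral_add_mul _ _ hφ, integral_add_mul _ _ (hP φ hφ), h φ hφ, h' φ hφ]

lemma isWeakImage_smul {PT : (E3 → ℂ) → E3 → ℂ} (c : ℂ)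
    {Ψ Φ : MagL2 B q} (h : IsWeakImage PT Ψ Φ) :
    IsWeakImage PT (c • Ψ : MagL2 B q) (c • Φ : MagL2 B q) := by
  intro φ hφ
  rw [integral_smul_mul, integral_smul_mul, h φ hφ]

lemma isWeakImage_unique {PT : (E3 → ℂ) → E3 → ℂ} {Ψ : E3 → ℂ} {Φ Φ' : MagL2 B q}
    (h : IsWeakImage PT Ψ Φ) (h' : IsWeakImage PT Ψ Φ') : Φ = Φ' := by
  apply Subtype.ext
  apply AEEqFun.ext
  apply ae_eq_of_integral_contDiff_smul_eq (MagL2.locallyIntegrable Φ)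
    (MagL2.locallyIntegrable Φ')
  intro g hg hg'
  have ht : IsTest fun x => (g x : ℂ) :=
    ⟨Complex.ofRealCLM.contDiff.comp hg, hg'.comp_left Complex.ofReal_zero⟩
  have := (h _ ht).trans (h' _ ht).symm
  simpa only [Complex.real_smul, mul_comm] using this

end Operator

/-- The magnetic Sobolev space `H_mag^{q,m}(Q_B)`: gauge-periodic `L²_loc`-functions `Ψ` such that
`Π_q^ν Ψ` is again of this type for all multi-indices `|ν| ≤ m`. -/
def magSobolev (B : ℝ) (q m : ℕ) : Submodule ℂ (MagL2 B q) where
  carrier := {Ψ | ∀ ν : Fin 3 → ℕ, ∑ j, ν j ≤ m →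
    ∃ Φ : MagL2 B q, IsWeakImage (momentumPowT B q ν) Ψ Φ}
  zero_mem' := fun ν _ => ⟨0, fun φ _ => by
    have e : ∀ χ : E3 → ℂ, ∫ x, ((0 : MagL2 B q) : E3 →ₘ[volume] ℂ) x * χ x = 0 := fun χ => by
      have h := integral_smul_mul (0 : ℂ) (0 : MagL2 B q) χ
      rwa [zero_smul, zero_mul] at h
    rw [e, e]⟩
  add_mem' := fun hf hg ν hν => by
    obtain ⟨F, hF⟩ := hf ν hν
    obtain ⟨G, hG⟩ := hg ν hν
    exact ⟨F + G, isWeakImage_add (fun φ h => h.momentumPowT ν) hF hG⟩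
  smul_mem' := fun c _ hf ν hν => by
    obtain ⟨F, hF⟩ := hf ν hν
    exact ⟨c • F, isWeakImage_smul c hF⟩

lemma IsTest.momentumSqT {B : ℝ} {q : ℕ} {φ : E3 → ℂ} (h : IsTest φ) (ϑ : E3) :
    IsTest (momentumSqT B q ϑ φ) := by
  have h1 := fun j => (h.momentumT (B := B) (q := q) ϑ j).momentumT (B := B) (q := q) ϑ j
  have e : PeriodicLandau.momentumSqT B q ϑ φ = fun x =>
      PeriodicLandau.momentumT B q ϑ 0 (PeriodicLandau.momentumT B q ϑ 0 φ) x +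
      PeriodicLandau.momentumT B q ϑ 1 (PeriodicLandau.momentumT B q ϑ 1 φ) x +
      PeriodicLandau.momentumT B q ϑ 2 (PeriodicLandau.momentumT B q ϑ 2 φ) x := by
    ext x
    simp [PeriodicLandau.momentumSqT, Fin.sum_univ_three]
  rw [e]
  exact ⟨((h1 0).1.add (h1 1).1).add (h1 2).1, ((h1 0).2.add (h1 1).2).add (h1 2).2⟩

lemma momentumT_sq {B : ℝ} {q : ℕ} (ϑ : E3) (j : Fin 3) {φ : E3 → ℂ} (h : IsTest φ) :
    momentumT B q ϑ j (momentumT B q ϑ j φ) = fun x =>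
      momentumT B q 0 j (momentumT B q 0 j φ) x +
        (2 * (Real.sqrt (2 * Real.pi * B) * ϑ j : ℝ) : ℂ) * momentumT B q 0 j φ x +
        ((Real.sqrt (2 * Real.pi * B) * ϑ j : ℝ) : ℂ) ^ 2 * φ x := by
  have e : ∀ χ : E3 → ℂ, momentumT B q ϑ j χ =
      momentumT B q 0 j χ + ((Real.sqrt (2 * Real.pi * B) * ϑ j : ℝ) : ℂ) • χ := by
    intro χ
    ext x
    simp [momentumT]
    ring
  have h1 := h.momentumT (B := B) (q := q) 0 j
  have d1 : ∀ x, DifferentiableAt ℝ (momentumT B q 0 j φ) x := fun x =>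
    (h1.1.differentiable (by simp)) x
  have d2 : ∀ x, DifferentiableAt ℝ φ x := fun x => (h.1.differentiable (by simp)) x
  rw [e (momentumT B q ϑ j φ), e φ]
  ext x
  have h3 : momentumT B q 0 j (momentumT B q 0 j φ +
      ((Real.sqrt (2 * Real.pi * B) * ϑ j : ℝ) : ℂ) • φ) x =
      momentumT B q 0 j (momentumT B q 0 j φ) x +
        ((Real.sqrt (2 * Real.pi * B) * ϑ j : ℝ) : ℂ) * momentumT B q 0 j φ x := by
    conv_lhs => rw [momentumT]
    rw [fderiv_add (d1 x) ((d2 x).const_smul _), fderiv_const_smul (d2 x)]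
    conv_rhs => rw [momentumT]
    conv_rhs => enter [2, 2]; rw [momentumT]
    simp only [_root_.add_apply, _root_.smul_apply, Pi.add_apply,
      Pi.smul_apply, smul_eq_mul]
    ring
  rw [Pi.add_apply, h3]
  simp only [Pi.add_apply, Pi.smul_apply, smul_eq_mul]
  ring

/-- On `H_mag^{q,2}(Q_B)` the operator `Π_q(ϑ)²` takes values in gauge-periodic
`L²_loc`-functions. -/
lemma exists_momentumSq {B : ℝ} {q : ℕ} (ϑ : E3) (Ψ : magSobolev B q 2) :
    ∃ Φ : MagL2 B q, IsWeakImage (momentumSqT B q ϑ) (Ψ : MagL2 B q) Φ := by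
  have key : ∀ j : Fin 3, ∃ Φ : MagL2 B q,
      IsWeakImage (fun φ => momentumT B q ϑ j (momentumT B q ϑ j φ)) (Ψ : MagL2 B q) Φ := by
    intro j
    obtain ⟨F, hF⟩ := Ψ.2 (Pi.single j 1) (by simp)
    obtain ⟨G, hG⟩ := Ψ.2 (Pi.single j 2) (by simp)
    have pF : ∀ φ, momentumPowT B q (Pi.single j 1) φ = momentumT B q 0 j φ := by
      intro φ
      fin_cases j <;> rfl
    have pG : ∀ φ, momentumPowT B q (Pi.single j 2) φ =
        momentumT B q 0 j (momentumT B q 0 j φ) := by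
      intro φ
      fin_cases j <;> rfl
    refine ⟨G + (2 * (Real.sqrt (2 * Real.pi * B) * ϑ j : ℝ) : ℂ) • F +
      (((Real.sqrt (2 * Real.pi * B) * ϑ j : ℝ) : ℂ) ^ 2) • (Ψ : MagL2 B q), fun φ hφ => ?_⟩
    have t1 := hφ.momentumT (B := B) (q := q) 0 j
    have i0 := MagL2.integrable_mul (Ψ : MagL2 B q) hφ
    have i1 := MagL2.integrable_mul (Ψ : MagL2 B q) t1
    have i2 := MagL2.integrable_mul (Ψ : MagL2 B q) (t1.momentumT (B := B) (q := q) 0 j)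
    rw [integral_add_mul _ _ hφ, integral_add_mul _ _ hφ, integral_smul_mul, integral_smul_mul,
      hF φ hφ, hG φ hφ, pF, pG]
    beta_reduce
    rw [momentumT_sq ϑ j hφ, ← integral_const_mul, ← integral_const_mul,
      ← integral_add i2 (i1.const_mul _)]
    refine (integral_add (i2.add (i1.const_mul _)) (i0.const_mul _)).symm.trans ?_
    congr 1
    ext x
    simp only [Pi.add_apply]
    ring
  choose Φ hΦ using key
  refine ⟨Φ 0 + Φ 1 + Φ 2, fun φ hφ => ?_⟩
  have t := fun j => (hφ.momentumT (B := B) (q := q) ϑ j).momentumT (B := B) (q := q) ϑ j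
  have i := fun j => MagL2.integrable_mul (Ψ : MagL2 B q) (t j)
  rw [integral_add_mul _ _ hφ, integral_add_mul _ _ hφ, hΦ 0 φ hφ, hΦ 1 φ hφ, hΦ 2 φ hφ,
    ← integral_add (i 0) (i 1)]
  refine (integral_add ((i 0).add (i 1)) (i 2)).symm.trans ?_
  congr 1
  ext x
  simp only [Pi.add_apply, momentumSqT, Fin.sum_univ_three, mul_add]

/-- The fibered periodic Landau Hamiltonian `Π_q(ϑ)²`, as an unbounded operator on the space of
gauge-periodic functions with domain `H_mag^{q,2}(Q_B)`. Its value at `Ψ` is the unique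
gauge-periodic `L²_loc`-function that equals `∑_j (Π_q(ϑ)^{(j)})² Ψ` as a distribution. -/
def landauHamiltonian (B : ℝ) (q : ℕ) (ϑ : E3) : MagL2 B q →ₗ.[ℂ] MagL2 B q where
  domain := magSobolev B q 2
  toFun :=
    { toFun := fun Ψ => (exists_momentumSq ϑ Ψ).choose
      map_add' := fun f g => isWeakImage_unique (exists_momentumSq ϑ (f + g)).choose_spec
        (isWeakImage_add (fun _ h => h.momentumSqT ϑ) (exists_momentumSq ϑ f).choose_spec
          (exists_momentumSq ϑ g).choose_spec)
      map_smul' := fun c f => isWeakImage_unique (exists_momentumSq ϑ (c • f)).choose_spec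
        (isWeakImage_smul c (exists_momentumSq ϑ f).choose_spec) }

/-- `z` belongs to the resolvent set of the unbounded operator `A` if `A - z : D(A) → H` is a
bijection with bounded inverse `R`. -/
def resolventSetOf {H : Type*} [NormedAddCommGroup H] [InnerProductSpace ℂ H] (A : H →ₗ.[ℂ] H) :
    Set ℂ :=
  {z | ∃ R : H →L[ℂ] H, (∀ f, ∃ h : R f ∈ A.domain, A ⟨R f, h⟩ - z • R f = f) ∧
    ∀ u : A.domain, R (A u - z • (u : H)) = u}

/-- The spectrum of an unbounded operator. -/
def spectrumOf {H : Type*} [NormedAddCommGroup H] [InnerProductSpace ℂ H] (A : H →ₗ.[ℂ] H) :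
    Set ℂ :=
  (resolventSetOf A)ᶜ

/-- The eigenspace `ker (A - z)` of an unbounded operator. -/
def eigenspaceOf {H : Type*} [NormedAddCommGroup H] [InnerProductSpace ℂ H] (A : H →ₗ.[ℂ] H)
    (z : ℂ) : Submodule ℂ A.domain :=
  LinearMap.ker (A.toFun - z • A.domain.subtype)

/-- `E_{q,B,ϑ}(k,p) = qB(2k+1) + 2πB(p+ϑ₃)²`. -/
def landauEnergy (B : ℝ) (q : ℕ) (ϑ : E3) (k : ℕ) (p : ℤ) : ℝ :=
  q * B * (2 * k + 1) + 2 * Real.pi * B * (p + ϑ 2) ^ 2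

end PeriodicLandau

end

noncomputable section

namespace PeriodicLandau

set_option linter.unusedSectionVars false

open Filter Topology
open scoped ENNReal Polynomial ComplexConjugate

/-! The operator is diagonalized by explicit functions. Write `ω = qB` and `ℓ` for the lattice
constant, and number coordinates from `0` as in the code. A `mode` is a polynomial `P(y)` times the
Gaussian `exp(-ω y²/2)`, where `y` is `x 0` plus an offset depending on `n`, times phases that make
it a plane wave in `x 1` and `x 2` with integer frequencies `n` and `p`. The momenta keep the labels
`n`, `p` and act on `P` only (`fderiv_mode`): the first two as a canonical pair `-i d/dX + iωX`,
`ωX`, the third as the scalar `√(2πB)(p + ϑ 2)`. Hence Hermite polynomials give the energies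
`E(k,p)` (`momentumSq_hermitePoly`).

The origin of the multiplicity is the flux: `ωℓ² = 2πq`. The magnetic translation along the first
axis sends the mode `n` to the mode `n + q`, and the other two fix it. Summing a mode over `n + qℤ`
gives a gauge-periodic function (`bloch`), one for each of the `q` residue classes.

Inner products with `bloch` unfold from the cell to the strip `ℝ × [0,ℓ)²` (`inner_bloch`). Testing
weak derivatives against cut-off modes shows that the momenta are symmetric against Bloch functions
(`inner_bloch_momentum`). This gives orthogonality in `p` and, by ladder operators, in `k`;
orthogonality between residue classes is Fourier orthogonality in `x 1`. Completeness
(`eq_zero_of_inner_bloch`): if `F` is orthogonal to all Bloch functions, then all Gaussian moments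
on the strip vanish, so a Laplace transform vanishes, so all Fourier coefficients of `F` times a
nowhere vanishing factor vanish.

It remains to identify the domain. The commutation relations give `‖Π_i Π_j u‖ ≤ ‖Π² u‖ + 2ω‖u‖` on
finite sums of modes (`norm_momentum_momentum_le`), so limits in the graph norm stay in the magnetic
Sobolev space (`exists_landauHamiltonian_eq`). The Hamiltonian is therefore exactly the maximal
multiplication operator by `E(k,p)` in the basis of Landau states. Since only finitely many labels
lie below any given energy, the spectrum, its isolation and the multiplicities follow from the
abstract statements `spectrumOf_eq`, `exists_ball_inter_eq` and `finrank_eigenspaceOf`. -/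

/-! ### Families of characters that separate integrable functions. -/

/-- An integrable function vanishes if all its pairings with the family `e` vanish. -/
def Separates {X ι : Type*} [MeasurableSpace X] (μ : Measure X) (e : ι → X → ℂ) : Prop :=
  ∀ f : X → ℂ, Integrable f μ → (∀ i, ∫ x, f x * e i x ∂μ = 0) → f =ᵐ[μ] 0

/-- Fubini: for each fixed character in `y`, the partial integral is an integrable function of `x`
killed by the first family. Countability of `κ` lets one null set of `x` serve all characters in `y`
at once. -/
lemma Separates.prod {X Y ι κ : Type*} [MeasurableSpace X] [MeasurableSpace Y] [Countable κ]
    {μ : Measure X} {ν : Measure Y} [SFinite μ] [SFinite ν] {e : ι → X → ℂ} {d : κ → Y → ℂ}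
    (he : Separates μ e) (hd : Separates ν d)
    (me : ∀ i, Measurable (e i)) (be : ∀ i x, ‖e i x‖ ≤ 1)
    (md : ∀ i, Measurable (d i)) (bd : ∀ i x, ‖d i x‖ ≤ 1) :
    Separates (μ.prod ν) (fun (i : ι × κ) z => e i.1 z.1 * d i.2 z.2) := by
  intro f hf h
  have hint : ∀ k, Integrable (fun z : X × Y => f z * d k z.2) (μ.prod ν) := fun k =>
    hf.mul_bdd (c := 1) ((md k).comp measurable_snd).aestronglyMeasurable
      (ae_of_all _ fun z => bd k z.2)
  have h1 : ∀ k, (fun x => ∫ y, f (x, y) * d k y ∂ν) =ᵐ[μ] 0 := by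
    intro k
    refine he _ (hint k).integral_prod_left fun i => ?_
    rw [← h (i, k)]
    have h2 : Integrable (fun z : X × Y => f z * (e i z.1 * d k z.2)) (μ.prod ν) := by
      have := (hint k).mul_bdd (c := 1) ((me i).comp measurable_fst).aestronglyMeasurable
        (ae_of_all _ fun z => be i z.1)
      refine this.congr (ae_of_all _ fun z => ?_)
      simp only [Function.comp]
      ring
    rw [integral_prod _ h2]
    refine integral_congr_ae (ae_of_all _ fun x => ?_)
    simp only
    rw [← integral_mul_const]
    refine integral_congr_ae (ae_of_all _ fun y => ?_)
    simp only
    ring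
  have h3 : ∀ᵐ x ∂μ, ∀ᵐ y ∂ν, f (x, y) = 0 := by
    filter_upwards [ae_all_iff.2 h1, hf.prod_right_ae] with x hx hx'
    exact hd _ hx' hx
  have h4 : ∫ z, ‖f z‖ ∂(μ.prod ν) = 0 := by
    rw [integral_prod _ hf.norm]
    refine integral_eq_zero_of_ae ?_
    filter_upwards [h3] with x hx
    refine integral_eq_zero_of_ae ?_
    filter_upwards [hx] with y hy
    simp [hy]
  rw [integral_eq_zero_iff_of_nonneg (fun z => norm_nonneg _) hf.norm] at h4
  filter_upwards [h4] with z hz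
  simpa using hz

lemma Separates.of_measurePreserving {X Y ι : Type*} [MeasurableSpace X] [MeasurableSpace Y]
    {μ : Measure X} {ν : Measure Y} {e : ι → Y → ℂ} (he : Separates ν e) (Φ : X ≃ᵐ Y)
    (hΦ : MeasurePreserving Φ μ ν) : Separates μ (fun i x => e i (Φ x)) := by
  intro f hf h
  have hs : MeasurePreserving Φ.symm ν μ := hΦ.symm Φ
  have h1 := he (fun y => f (Φ.symm y)) ((hs.integrable_comp_emb Φ.symm.measurableEmbedding).2 hf)
    fun i => by
      rw [← h i, ← hs.integral_comp Φ.symm.measurableEmbedding]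
      simp
  have h2 := hΦ.quasiMeasurePreserving.ae_eq_comp h1
  filter_upwards [h2] with x hx
  simpa using hx

/-- Induction on the dimension, splitting off the first coordinate; in dimension zero the measure is
a point mass. -/
lemma Separates.pi {n : ℕ} (μ : Fin n → Measure ℝ) [∀ i, SigmaFinite (μ i)] {ι : Fin n → Type}
    [∀ i, Countable (ι i)] (e : ∀ i, ι i → ℝ → ℂ) (he : ∀ i, Separates (μ i) (e i))
    (me : ∀ i a, Measurable (e i a)) (be : ∀ i a t, ‖e i a t‖ ≤ 1) :
    Separates (Measure.pi μ) (fun (a : ∀ i, ι i) x => ∏ i, e i (a i) (x i)) := by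
  induction n with
  | zero =>
    intro f hf h
    have h1 := h (fun i => i.elim0)
    rw [Measure.pi_of_empty μ] at h1 ⊢
    simp only [Finset.univ_eq_empty, Finset.prod_empty, mul_one] at h1
    rw [integral_dirac] at h1
    refine ae_of_all _ fun x => ?_
    rw [Subsingleton.elim x]
    exact h1
  | succ n ih =>
    have h1 := ih (fun j => μ j.succ) (fun j => e j.succ) (fun j => he _) (fun j => me _)
      (fun j => be _)
    have h2 := (he 0).prod h1 (me 0) (be 0)
      (fun a => Finset.measurable_prod _ fun j _ => (me j.succ (a j)).comp (measurable_pi_apply j))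
      (fun a x => by
        rw [norm_prod]
        exact Finset.prod_le_one (fun _ _ => norm_nonneg _) fun j _ => be _ _ _)
    have h3 := h2.of_measurePreserving (MeasurableEquiv.piFinSuccAbove (fun _ => ℝ) 0)
      (measurePreserving_piFinSuccAbove μ 0)
    intro f hf h
    refine h3 f hf fun i => ?_
    rw [← h (Fin.cons i.1 i.2)]
    refine integral_congr_ae (ae_of_all _ fun x => ?_)
    simp [Fin.prod_univ_succ, MeasurableEquiv.piFinSuccAbove, Fin.tail]

/-- Injectivity of the Fourier transform on `L¹`. Rational frequencies suffice because the transform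
is continuous; a countable index set is what products of families need. -/
lemma separates_fourier :
    Separates (volume : Measure ℝ) (fun (τ : ℚ) x => Complex.exp (Complex.I * (τ * x : ℝ))) := by
  intro f hf h
  have hc : Continuous fun τ : ℝ => ∫ x, f x * Complex.exp (Complex.I * (τ * x : ℝ)) := by
    refine continuous_of_dominated (bound := fun x => ‖f x‖) (fun τ => ?_) (fun τ => ?_) hf.norm ?_
    · exact hf.1.mul (Continuous.aestronglyMeasurable (by fun_prop))
    · refine ae_of_all _ fun x => ?_
      rw [norm_mul, mul_comm Complex.I, Complex.norm_exp_ofReal_mul_I, mul_one]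
    · refine ae_of_all _ fun x => by fun_prop
  have h0 : ∀ τ : ℝ, ∫ x, f x * Complex.exp (Complex.I * (τ * x : ℝ)) = 0 := by
    have := Rat.isDenseEmbedding_coe_real.dense.equalizer continuous_const hc
      (funext fun τ => (h τ).symm : (fun _ : ℝ => (0 : ℂ)) ∘ ((↑) : ℚ → ℝ) = _)
    exact fun τ => (congrFun this τ).symm
  refine ae_eq_zero_of_integral_contDiff_smul_eq_zero hf.locallyIntegrable fun g hg hg' => ?_
  have hgc : ContDiff ℝ ∞ fun x => (g x : ℂ) := Complex.ofRealCLM.contDiff.comp hg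
  have hgs : HasCompactSupport fun x => (g x : ℂ) := hg'.comp_left Complex.ofReal_zero
  -- The test function `g` is the Fourier transform of a Schwartz function `H`, so the
  -- multiplication formula gives `∫ f g = ∫ f̂ H = 0`.
  set G : SchwartzMap ℝ ℂ := hgs.toSchwartzMap hgc with hG
  have e1 : G = FourierTransform.fourier (FourierTransformInv.fourierInv G) :=
    (FourierTransform.fourier_fourierInv_eq G).symm
  set H : SchwartzMap ℝ ℂ := FourierTransformInv.fourierInv G
  have e2 : ∀ x, FourierTransform.fourier f x = 0 := by
    intro x
    rw [Real.fourier_real_eq_integral_exp_smul, ← h0 (-2 * Real.pi * x)]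
    refine integral_congr_ae (ae_of_all _ fun y => ?_)
    simp only [smul_eq_mul]
    rw [mul_comm]
    congr 2
    push_cast
    ring
  have e3 := VectorFourier.integral_fourierIntegral_smul_eq_flip (L := innerₗ ℝ)
      Real.continuous_fourierChar continuous_inner hf H.integrable (μ := volume) (ν := volume)
  have e4 : ∀ x, (G x : ℂ) = g x := fun x => rfl
  have e5 : ∀ x, G x = VectorFourier.fourierIntegral Real.fourierChar volume
      (innerₗ ℝ).flip (⇑H) x := by
    intro x
    rw [e1, SchwartzMap.fourier_coe]
    simp [Real.fourier_eq, VectorFourier.fourierIntegral]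
  have e6 : ∀ x, VectorFourier.fourierIntegral Real.fourierChar volume (innerₗ ℝ) f x = 0 := e2
  simp only [e6, zero_smul, integral_zero, ← e5, e4] at e3
  rw [e3]
  refine integral_congr_ae (ae_of_all _ fun x => ?_)
  simp [mul_comm]

/-- Integration against `f` is a continuous functional on `C(ℝ/Tℤ)` that vanishes on the monomials,
hence vanishes by their density. Testing it against smooth functions supported in the open interval
is enough, since the endpoint is null. -/
lemma separates_circle {T : ℝ} (hT : 0 < T) :
    Separates ((volume : Measure ℝ).restrict (Set.Ico 0 T))
      (fun (n : ℤ) x => Complex.exp (Complex.I * (2 * Real.pi / T * n * x : ℝ))) := by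
  intro f hf h
  have : Fact (0 < T) := ⟨hT⟩
  have hb : ∀ g : C(AddCircle T, ℂ), Integrable (fun x : ℝ => f x * g (x : AddCircle T))
      (volume.restrict (Set.Ico 0 T)) := fun g =>
    hf.mul_bdd (c := ‖g‖) (by
      exact (g.continuous.comp (AddCircle.continuous_mk' T)).aestronglyMeasurable)
      (ae_of_all _ fun x => g.norm_coe_le_norm _)
  let Λ : C(AddCircle T, ℂ) →ₗ[ℂ] ℂ :=
    { toFun := fun g => ∫ x in Set.Ico 0 T, f x * g (x : AddCircle T)
      map_add' := fun g g' => by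
        rw [← integral_add (hb g) (hb g')]
        simp [mul_add]
      map_smul' := fun c g => by
        rw [RingHom.id_apply, smul_eq_mul, ← integral_const_mul]
        simp [mul_left_comm] }
  let Λ' : C(AddCircle T, ℂ) →L[ℂ] ℂ := Λ.mkContinuous (∫ x in Set.Ico 0 T, ‖f x‖) fun g => by
    refine (norm_integral_le_integral_norm _).trans ?_
    rw [← integral_mul_const]
    refine integral_mono_ae (hb g).norm (hf.norm.mul_const _) (ae_of_all _ fun x => ?_)
    simp only [norm_mul]
    exact mul_le_mul_of_nonneg_left (g.norm_coe_le_norm _) (norm_nonneg _)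
  have h1 : Λ' = 0 := by
    refine ContinuousLinearMap.ext_on (s := Set.range (@fourier T)) ?_ ?_
    · rw [Submodule.dense_iff_topologicalClosure_eq_top]
      exact span_fourier_closure_eq_top
    · rintro _ ⟨n, rfl⟩
      change ∫ x in Set.Ico 0 T, f x * fourier n (x : AddCircle T) = 0
      rw [← h n]
      refine integral_congr_ae (ae_of_all _ fun x => ?_)
      simp only [fourier_coe_apply]
      congr 2
      push_cast
      ring
  have h2 : ∀ᵐ x, x ∈ Set.Ioo 0 T → f x = 0 := by
    refine isOpen_Ioo.ae_eq_zero_of_integral_contDiff_smul_eq_zero ?_ fun g hg hg' hgs => ?_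
    · exact (IntegrableOn.mono_set hf Set.Ioo_subset_Ico_self).locallyIntegrableOn
    have hg0 : ∀ x, x ∉ Set.Ioo 0 T → g x = 0 := fun x hx =>
      image_eq_zero_of_notMem_tsupport fun h => hx (hgs h)
    -- A function supported inside the open interval vanishes at both ends, so it descends to a
    -- continuous function on the circle.
    have hcont := AddCircle.liftIco_zero_continuous (p := T) (f := fun x => (g x : ℂ))
      (by rw [hg0 0 (by simp), hg0 T (by simp)])
      (Complex.continuous_ofReal.comp hg.continuous).continuousOn
    have h3 : ∫ x in Set.Ico 0 T, f x * AddCircle.liftIco T 0 (fun x => (g x : ℂ)) x = 0 :=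
      DFunLike.congr_fun h1 (⟨_, hcont⟩ : C(AddCircle T, ℂ))
    rw [← h3, ← integral_indicator measurableSet_Ico]
    refine integral_congr_ae (ae_of_all _ fun x => ?_)
    by_cases hx : x ∈ Set.Ico 0 T
    · simp only [Set.indicator_of_mem hx]
      rw [AddCircle.liftIco_zero_coe_apply hx, Complex.real_smul, mul_comm]
    · simp only [Set.indicator_of_notMem hx]
      rw [hg0 x fun h => hx (Set.Ioo_subset_Ico_self h), zero_smul]
  rw [← restrict_Ioo_eq_restrict_Ico]
  exact (ae_restrict_iff' measurableSet_Ioo).2 h2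

/-! ### Decomposition into slabs, and decaying weights. -/

/-- The lattice translation by `k` cells in direction `j`. -/
def shift (B : ℝ) (j : Fin 3) (k : ℤ) : E3 := Pi.single j (k * latticeConst B)

lemma shift_one (B : ℝ) (j : Fin 3) : shift B j 1 = latticeVec B j := by
  simp [shift, latticeVec]

lemma add_shift_self (B : ℝ) (j : Fin 3) (k : ℤ) (x : E3) :
    (x + shift B j k) j = x j + k * latticeConst B := by
  simp [shift]

lemma add_shift_of_ne (B : ℝ) {i j : Fin 3} (h : i ≠ j) (k : ℤ) (x : E3) :
    (x + shift B j k) i = x i := by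
  simp [shift, h]

/-- The slab `0 ≤ x_j < √(2π/B)`. -/
def slab (B : ℝ) (j : Fin 3) : Set E3 := {x | x j ∈ Set.Ico 0 (latticeConst B)}

lemma measurableSet_slab (B : ℝ) (j : Fin 3) : MeasurableSet (slab B j) :=
  (measurable_pi_apply j) measurableSet_Ico

lemma measurableSet_cell (B : ℝ) : MeasurableSet (cell B) :=
  MeasurableSet.univ_pi fun _ => measurableSet_Ico

lemma cell_eq_slabs (B : ℝ) : cell B = slab B 0 ∩ slab B 1 ∩ slab B 2 := by
  ext x
  simp [cell, slab, Set.mem_pi, Fin.forall_fin_succ, and_assoc]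

section Slabs

variable {B : ℝ}

/-- The slabs `kℓ ≤ x_j < (k+1)ℓ`. -/
def slabs (B : ℝ) (j : Fin 3) (k : ℤ) : Set E3 := {x | ⌊x j / latticeConst B⌋ = k}

lemma measurableSet_slabs (j : Fin 3) (k : ℤ) : MeasurableSet (slabs B j k) := by
  have : Measurable fun x : E3 => ⌊x j / latticeConst B⌋ :=
    Int.measurable_floor.comp ((measurable_pi_apply j).div_const _)
  exact this (measurableSet_singleton k)

lemma iUnion_slabs (j : Fin 3) : ⋃ k, slabs B j k = Set.univ := by
  ext x
  simp [slabs]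

lemma disjoint_slabs (j : Fin 3) : Pairwise (Function.onFun Disjoint (slabs B j)) := by
  intro k k' h
  refine Set.disjoint_left.2 fun x hx hx' => h ?_
  rw [← show ⌊x j / latticeConst B⌋ = k from hx, ← show ⌊x j / latticeConst B⌋ = k' from hx']

variable [Fact (0 < B)]

lemma add_shift_mem_slabs (j : Fin 3) (k : ℤ) (x : E3) :
    x + shift B j k ∈ slabs B j k ↔ x ∈ slab B j := by
  have hl := latticeConst_pos (B := B)
  simp only [slabs, slab, Set.mem_ofPred_eq, add_shift_self, Int.floor_eq_iff, Set.mem_Ico]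
  rw [le_div_iff₀ hl, div_lt_iff₀ hl]
  constructor
  · rintro ⟨h1, h2⟩
    constructor <;> linarith
  · rintro ⟨h1, h2⟩
    constructor <;> linarith

lemma lintegral_eq_tsum_slab (j : Fin 3) (f : E3 → ℝ≥0∞) :
    ∫⁻ x, f x = ∑' k : ℤ, ∫⁻ x in slab B j, f (x + shift B j k) := by
  rw [← setLIntegral_univ f, ← iUnion_slabs (B := B) j,
    lintegral_iUnion (measurableSet_slabs j) (disjoint_slabs j)]
  congr 1
  ext k
  rw [← lintegral_indicator (measurableSet_slabs j k), ← lintegral_indicator (measurableSet_slab B j),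
    ← lintegral_add_right_eq_self _ (shift B j k)]
  congr 1
  ext x
  by_cases hx : x ∈ slab B j
  · rw [Set.indicator_of_mem hx, Set.indicator_of_mem ((add_shift_mem_slabs j k x).2 hx)]
  · rw [Set.indicator_of_notMem hx,
      Set.indicator_of_notMem (mt (add_shift_mem_slabs j k x).1 hx)]

lemma hasSum_integral_slab (j : Fin 3) {f : E3 → ℂ} (hf : Integrable f) :
    HasSum (fun k : ℤ => ∫ x in slab B j, f (x + shift B j k)) (∫ x, f x) := by
  have h := hasSum_integral_iUnion (measurableSet_slabs (B := B) j) (disjoint_slabs j)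
    (hf.integrableOn)
  rw [iUnion_slabs, setIntegral_univ] at h
  have e : ∀ k : ℤ, ∫ x in slab B j, f (x + shift B j k) = ∫ x in slabs B j k, f x := by
    intro k
    rw [← integral_indicator (measurableSet_slabs j k),
      ← integral_indicator (measurableSet_slab B j),
      ← integral_add_right_eq_self ((slabs B j k).indicator f) (shift B j k)]
    congr 1
    ext x
    by_cases hx : x ∈ slab B j
    · rw [Set.indicator_of_mem hx, Set.indicator_of_mem ((add_shift_mem_slabs j k x).2 hx)]
    · rw [Set.indicator_of_notMem hx,
        Set.indicator_of_notMem (mt (add_shift_mem_slabs j k x).1 hx)]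
  simpa only [e] using h

/-- A Peetre type inequality. -/
lemma inv_one_add_sq_le (s a : ℝ) : (1 + (s + a) ^ 2)⁻¹ ≤ 2 * (1 + s ^ 2) * (1 + a ^ 2)⁻¹ := by
  rw [inv_eq_one_div, div_le_iff₀ (by positivity), mul_assoc, mul_comm (1 + a ^ 2)⁻¹, ← mul_assoc,
    ← div_eq_mul_inv, le_div_iff₀ (by positivity)]
  -- The difference of the two sides is `1 + (a + 2s)² + 2s²(s + a)²`.
  nlinarith [sq_nonneg (a + 2 * s), sq_nonneg (s * (s + a))]

lemma summable_inv_one_add_sq {l : ℝ} (hl : l ≠ 0) :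
    Summable fun k : ℤ => (1 + ((k : ℝ) * l) ^ 2)⁻¹ := by
  have h1 : Summable fun k : ℤ => (1 / (k : ℝ) ^ 2) * (l ^ 2)⁻¹ :=
    (Real.summable_one_div_int_pow.2 one_lt_two).mul_right _
  -- The comparison term `1/k²` takes the value `0` at `k = 0`, so a separate `1` is added there.
  refine (h1.add (summable_of_hasFiniteSupport (f := fun k : ℤ => if k = 0 then (1 : ℝ) else 0)
    ((Set.finite_singleton 0).subset fun k hk => by simpa using hk))).of_nonneg_of_le
    (fun k => by positivity) fun k => ?_
  by_cases hk : k = 0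
  · subst hk; simp
  · have : (0 : ℝ) < (k : ℝ) ^ 2 * l ^ 2 := by positivity
    simp only [hk, if_false, add_zero]
    rw [one_div, ← mul_inv, mul_pow]
    exact inv_anti₀ this (by linarith)

/-- The constant in `lintegral_mul_decay_le`. -/
def decayConst (B : ℝ) : ℝ≥0∞ := ∑' k : ℤ,
  ENNReal.ofReal (2 * (1 + latticeConst B ^ 2) * (1 + ((k : ℝ) * latticeConst B) ^ 2)⁻¹)

lemma decayConst_ne_top : decayConst B ≠ ⊤ :=
  ((summable_inv_one_add_sq latticeConst_pos.ne').mul_left _).tsum_ofReal_ne_top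

/-- Each slab contributes the same integral of `g`, weighted by at most a constant times `(1 +
(kℓ)²)⁻¹`, which is summable in `k`. -/
lemma lintegral_mul_decay_le (j : Fin 3) {g : E3 → ℝ≥0∞}
    (hg : ∀ k, ∀ᵐ x, g (x + shift B j k) = g x) :
    ∫⁻ x, g x * ENNReal.ofReal (1 + x j ^ 2)⁻¹ ≤ decayConst B * ∫⁻ x in slab B j, g x := by
  rw [lintegral_eq_tsum_slab (B := B) j, decayConst, ← ENNReal.tsum_mul_right]
  refine ENNReal.tsum_le_tsum fun k => ?_
  rw [← lintegral_const_mul' _ _ ENNReal.ofReal_ne_top]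
  refine lintegral_mono_ae ?_
  filter_upwards [ae_restrict_of_ae (hg k), ae_restrict_mem (measurableSet_slab B j)] with x hx hx'
  rw [hx, mul_comm]
  refine mul_le_mul_left ?_ _
  refine ENNReal.ofReal_le_ofReal ?_
  rw [add_shift_self]
  refine (inv_one_add_sq_le _ _).trans ?_
  obtain ⟨h1, h2⟩ := hx'
  gcongr

/-- The weight `∏ (1 + x_j²)⁻¹`. -/
def decay (x : E3) : ℝ := ∏ j, (1 + x j ^ 2)⁻¹

lemma decay_pos (x : E3) : 0 < decay x := Finset.prod_pos fun _ _ => by positivity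

/-- The one-directional estimate is applied once per axis. Restrictions to slabs already obtained
are carried as indicators, which are invariant under shifts along the remaining axes. -/
lemma lintegral_mul_decay_le_cell {f : E3 → ℝ≥0∞}
    (hf : ∀ j k, ∀ᵐ x, f (x + shift B j k) = f x) :
    ∫⁻ x, f x * ENNReal.ofReal (decay x) ≤ decayConst B ^ 3 * ∫⁻ x in cell B, f x := by
  let r : Fin 3 → E3 → ℝ≥0∞ := fun j x => ENNReal.ofReal (1 + x j ^ 2)⁻¹
  have hr : ∀ {i j : Fin 3} (h : i ≠ j) k x, r i (x + shift B j k) = r i x := by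
    intro i j h k x
    simp only [r, add_shift_of_ne B h]
  have hs : ∀ {i j : Fin 3} (h : i ≠ j) k x (u : E3 → ℝ≥0∞), u (x + shift B j k) = u x →
      (slab B i).indicator u (x + shift B j k) = (slab B i).indicator u x := by
    intro i j h k x u hu
    have hm : x + shift B j k ∈ slab B i ↔ x ∈ slab B i := by
      simp only [slab, Set.mem_ofPred_eq, add_shift_of_ne B h]
    by_cases hx : x ∈ slab B i
    · rw [Set.indicator_of_mem hx, Set.indicator_of_mem (hm.2 hx), hu]
    · rw [Set.indicator_of_notMem hx, Set.indicator_of_notMem (mt hm.1 hx)]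
  have e : ∀ x, f x * ENNReal.ofReal (decay x) = f x * r 1 x * r 2 x * r 0 x := by
    intro x
    simp only [decay, r]
    rw [ENNReal.ofReal_prod_of_nonneg fun _ _ => by positivity, Fin.prod_univ_three]
    ring
  have s0 : ∫⁻ x, f x * r 1 x * r 2 x * r 0 x ≤
      decayConst B * ∫⁻ x in slab B 0, f x * r 1 x * r 2 x := by
    refine lintegral_mul_decay_le 0 fun k => ?_
    filter_upwards [hf 0 k] with x hx
    rw [hx, hr (by decide), hr (by decide)]
  have s1 : ∫⁻ x, (slab B 0).indicator (fun x => f x * r 2 x) x * r 1 x ≤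
      decayConst B * ∫⁻ x in slab B 1, (slab B 0).indicator (fun x => f x * r 2 x) x := by
    refine lintegral_mul_decay_le 1 fun k => ?_
    filter_upwards [hf 1 k] with x hx
    refine hs (by decide) k x _ ?_
    rw [hx, hr (by decide)]
  have s2 : ∫⁻ x, (slab B 1).indicator ((slab B 0).indicator f) x * r 2 x ≤
      decayConst B * ∫⁻ x in slab B 2, (slab B 1).indicator ((slab B 0).indicator f) x := by
    refine lintegral_mul_decay_le 2 fun k => ?_
    filter_upwards [hf 2 k] with x hx
    exact hs (by decide) k x _ (hs (by decide) k x _ hx)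
  have e0 : ∫⁻ x in slab B 0, f x * r 1 x * r 2 x =
      ∫⁻ x, (slab B 0).indicator (fun x => f x * r 2 x) x * r 1 x := by
    rw [← lintegral_indicator (measurableSet_slab B 0)]
    congr 1
    ext x
    by_cases hx : x ∈ slab B 0 <;> simp [hx, mul_right_comm]
  have e1 : ∫⁻ x in slab B 1, (slab B 0).indicator (fun x => f x * r 2 x) x =
      ∫⁻ x, (slab B 1).indicator ((slab B 0).indicator f) x * r 2 x := by
    rw [← lintegral_indicator (measurableSet_slab B 1)]
    congr 1
    ext x
    by_cases hx : x ∈ slab B 0 <;> by_cases hx' : x ∈ slab B 1 <;> simp [hx, hx']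
  have e2 : ∫⁻ x in slab B 2, (slab B 1).indicator ((slab B 0).indicator f) x =
      ∫⁻ x in cell B, f x := by
    rw [lintegral_indicator (measurableSet_slab B 1), lintegral_indicator (measurableSet_slab B 0),
      Measure.restrict_restrict (measurableSet_slab B 1),
      Measure.restrict_restrict (measurableSet_slab B 0), cell_eq_slabs, Set.inter_assoc]
  simp only [e]
  rw [e2] at s2
  rw [e1] at s1
  rw [e0] at s0
  calc _ ≤ _ := s0
    _ ≤ decayConst B * (decayConst B * (decayConst B * ∫⁻ x in cell B, f x)) := by
      gcongr
      exact s1.trans (by gcongr)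
    _ = _ := by ring

end Slabs

/-! ### Pairing gauge-periodic functions with functions on the whole space. -/

section Periodic

variable {B : ℝ} {q : ℕ}

lemma IsGaugePeriodic.norm_shift {f : E3 → ℂ} (hf : IsGaugePeriodic B q f) (j : Fin 3) (k : ℤ) :
    ∀ᵐ x, ‖f (x + shift B j k)‖ = ‖f x‖ := by
  have h := hf.absPeriod (Pi.single j k)
  have e : (fun i => ((Pi.single j k : Fin 3 → ℤ) i : ℝ) * latticeConst B) = shift B j k := by
    ext i
    by_cases hi : i = j
    · subst hi; simp [shift]
    · simp [shift, hi]
  rwa [e] at h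

/-- Differences of translates integrate to zero against periodic functions. -/
lemma integral_mul_sub_translate {j : Fin 3} {G : E3 → ℂ}
    (hG : ∀ᵐ x, G (x + latticeVec B j) = G x) {θ : ℝ → ℂ} (h : Integrable fun x => G x * θ (x j)) :
    Integrable (fun x => G x * θ (x j - latticeConst B)) ∧
    ∫ x, G x * (θ (x j) - θ (x j - latticeConst B)) = 0 := by
  have e : (fun x => G (x + latticeVec B j) * θ ((x + latticeVec B j) j - latticeConst B)) =ᵐ[volume]
      fun x => G x * θ (x j) := by
    filter_upwards [hG] with x hx
    rw [hx]
    simp [latticeVec]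
  have h1 : Integrable (fun x => G x * θ (x j - latticeConst B)) := by
    have h2 := (h.congr e.symm).comp_sub_right (latticeVec B j)
    simpa using h2
  refine ⟨h1, ?_⟩
  simp only [mul_sub]
  rw [integral_sub h h1, ← integral_congr_ae e,
    integral_add_right_eq_self (fun x => G x * θ (x j - latticeConst B)), sub_self]

variable [Fact (0 < B)]

lemma volume_cell_lt_top (B : ℝ) : volume (cell B) < ⊤ :=
  (measure_mono (cell_subset B)).trans_lt isCompact_Icc.measure_lt_top

instance : IsFiniteMeasure ((volume : Measure E3).restrict (cell B)) :=
  ⟨by simpa using volume_cell_lt_top B⟩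

lemma MagL2.norm_eq (F : MagL2 B q) :
    ‖F‖ = (eLpNorm (F : E3 →ₘ[volume] ℂ) 2 (volume.restrict (cell B))).toReal :=
  Lp.norm_toLp _ (MagL2.memLp_cell F)

lemma MagL2.lintegral_cell_le (F : MagL2 B q) :
    ∫⁻ x in cell B, ‖(F : E3 →ₘ[volume] ℂ) x‖ₑ ≤
      ENNReal.ofReal ‖F‖ * volume (cell B) ^ (1 / 2 : ℝ) := by
  have h := eLpNorm_le_eLpNorm_mul_rpow_measure_univ (p := 1) (q := 2) (by norm_num)
    (MagL2.memLp_cell F).1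
  rw [eLpNorm_one_eq_lintegral_enorm] at h
  rw [MagL2.norm_eq, ENNReal.ofReal_toReal (MagL2.memLp_cell F).2.ne]
  convert h using 3
  · simp
  · norm_num

/-- The constant in `MagL2.integrable_mul_of_decay`. -/
def pairingConst (B : ℝ) : ℝ := (decayConst B ^ 3 * volume (cell B) ^ (1 / 2 : ℝ)).toReal

/-- The modulus of `F` is truly periodic, so the weighted integral is controlled by the `L¹` norm on
the cell, hence by the Hilbert norm through Cauchy–Schwarz. -/
lemma MagL2.lintegral_mul_decay_le (F : MagL2 B q) :
    ∫⁻ x, ‖(F : E3 →ₘ[volume] ℂ) x‖ₑ * ENNReal.ofReal (decay x) ≤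
      ENNReal.ofReal (pairingConst B * ‖F‖) := by
  refine (lintegral_mul_decay_le_cell (B := B) fun j k => ?_).trans ?_
  · filter_upwards [F.2.2.norm_shift j k] with x hx
    rw [← ofReal_norm, hx, ofReal_norm]
  · have hne : decayConst B ^ 3 * volume (cell B) ^ (1 / 2 : ℝ) ≠ ⊤ :=
      ENNReal.mul_ne_top (ENNReal.pow_ne_top decayConst_ne_top)
        (ENNReal.rpow_ne_top_of_nonneg (by norm_num) (volume_cell_lt_top B).ne)
    rw [pairingConst, ENNReal.ofReal_mul ENNReal.toReal_nonneg, ENNReal.ofReal_toReal hne, mul_assoc]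
    refine mul_le_mul_right ((MagL2.lintegral_cell_le F).trans_eq (mul_comm _ _)) _

/-- Makes integration against any function dominated by `decay` a bounded functional on the Hilbert
space. -/
lemma MagL2.integrable_mul_of_decay (F : MagL2 B q) {v : E3 → ℂ} (hv : AEStronglyMeasurable v)
    {C : ℝ} (hC : ∀ x, ‖v x‖ ≤ C * decay x) :
    Integrable (fun x => (F : E3 →ₘ[volume] ℂ) x * v x) ∧
      ‖∫ x, (F : E3 →ₘ[volume] ℂ) x * v x‖ ≤ C * (pairingConst B * ‖F‖) := by
  have hC0 : 0 ≤ C := by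
    have := (norm_nonneg _).trans (hC 0)
    exact nonneg_of_mul_nonneg_left this (decay_pos 0)
  have h1 : ∫⁻ x, ‖(F : E3 →ₘ[volume] ℂ) x * v x‖ₑ ≤
      ENNReal.ofReal (C * (pairingConst B * ‖F‖)) := by
    rw [ENNReal.ofReal_mul hC0]
    refine le_trans ?_ (mul_le_mul_right (MagL2.lintegral_mul_decay_le F) _)
    rw [← lintegral_const_mul' _ _ ENNReal.ofReal_ne_top]
    refine lintegral_mono fun x => ?_
    rw [enorm_mul, mul_left_comm]
    refine mul_le_mul_right ?_ _
    rw [← ENNReal.ofReal_mul hC0, ← ofReal_norm]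
    exact ENNReal.ofReal_le_ofReal (hC x)
  refine ⟨⟨(F : E3 →ₘ[volume] ℂ).aestronglyMeasurable.mul hv,
    h1.trans_lt ENNReal.ofReal_lt_top⟩, ?_⟩
  have h2 := (enorm_integral_le_lintegral_enorm _).trans h1
  rw [← ofReal_norm] at h2
  exact (ENNReal.ofReal_le_ofReal_iff (mul_nonneg hC0 (mul_nonneg ENNReal.toReal_nonneg
    (norm_nonneg _)))).1 h2

end Periodic

/-! ### Modes: parameters, and the action of the momenta on polynomials. -/

/-- The cyclotron frequency `qB`. -/
def freq (B : ℝ) (q : ℕ) : ℝ := q * B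

/-- The generator `2π/ℓ = Bℓ = √(2πB)` of the dual lattice. -/
def wave (B : ℝ) : ℝ := B * latticeConst B

/-- The relative coordinate of the `n`-th oscillator. -/
def oscPos (B : ℝ) (q : ℕ) (ϑ : E3) (n : ℤ) (x : E3) : ℝ :=
  x 0 + (n * latticeConst B / q + wave B * ϑ 1 / freq B q)

/-- The phase of the `(n,p)`-th mode. -/
def modePhase (B : ℝ) (q : ℕ) (ϑ : E3) (n p : ℤ) (x : E3) : ℝ :=
  -(wave B * ϑ 0 * oscPos B q ϑ n x) + freq B q * x 0 * x 1 / 2 + wave B * n * x 1 +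
    wave B * p * x 2

/-- A polynomial times a Gaussian in the direction `x₁`, times plane waves in the directions
`x₂`, `x₃`. -/
def mode (B : ℝ) (q : ℕ) (ϑ : E3) (n p : ℤ) (P : ℂ[X]) (x : E3) : ℂ :=
  P.eval (oscPos B q ϑ n x : ℂ) * Complex.exp ((-(freq B q / 2 * oscPos B q ϑ n x ^ 2) : ℝ) +
    Complex.I * (modePhase B q ϑ n p x : ℝ))

/-- The action of the components of `Π_q(ϑ)` on the polynomial factor of a mode. -/
def modeMomentum (B : ℝ) (q : ℕ) (ϑ : E3) (p : ℤ) (j : Fin 3) : ℂ[X] →ₗ[ℂ] ℂ[X] :=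
  ![(-Complex.I) • Polynomial.derivative +
      (Complex.I * (freq B q : ℝ)) • LinearMap.mulLeft ℂ (Polynomial.X : ℂ[X]),
    ((freq B q : ℝ) : ℂ) • LinearMap.mulLeft ℂ (Polynomial.X : ℂ[X]),
    ((wave B * (p + ϑ 2) : ℝ) : ℂ) • LinearMap.id] j

section Constants

variable {B : ℝ} [hB : Fact (0 < B)]

/-- This is `Bℓ² = 2π`, the flux quantization behind every periodicity statement below. -/
lemma wave_mul_latticeConst : wave B * latticeConst B = 2 * Real.pi := by
  have := hB.out
  rw [wave, mul_assoc, latticeConst, Real.mul_self_sqrt (by positivity)]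
  field_simp

lemma sqrt_eq_wave : Real.sqrt (2 * Real.pi * B) = wave B := by
  have hb := hB.out
  rw [wave, latticeConst, show 2 * Real.pi * B = B ^ 2 * (2 * Real.pi / B) by field_simp,
    Real.sqrt_mul (by positivity), Real.sqrt_sq hb.le]

lemma wave_sq : wave B ^ 2 = 2 * Real.pi * B := by
  have hb := hB.out
  rw [← sqrt_eq_wave, Real.sq_sqrt (by positivity)]

lemma wave_pos : 0 < wave B := mul_pos hB.out latticeConst_pos

lemma freq_pos {q : ℕ} [NeZero q] : 0 < freq B q :=
  mul_pos (Nat.cast_pos.2 (NeZero.pos q)) hB.out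

omit hB in
lemma wave_mul_natCast (q : ℕ) : freq B q * latticeConst B = wave B * q := by
  rw [freq, wave]
  ring

end Constants

/-! ### Translation behaviour, decay and derivatives of the modes. -/

section Modes

variable {B : ℝ} [hB : Fact (0 < B)] {q : ℕ} [NeZero q] {ϑ : E3}

lemma oscPos_shift_zero (n : ℤ) (x : E3) :
    oscPos B q ϑ n (x + latticeVec B 0) = oscPos B q ϑ (n + q) x := by
  have : (q : ℝ) ≠ 0 := Nat.cast_ne_zero.2 (NeZero.ne q)
  simp [oscPos, latticeVec]
  field_simp
  ring

lemma oscPos_add_mul (n j : ℤ) (x : E3) :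
    oscPos B q ϑ (n + j * q) x = oscPos B q ϑ n x + j * latticeConst B := by
  have : (q : ℝ) ≠ 0 := Nat.cast_ne_zero.2 (NeZero.ne q)
  simp [oscPos]
  field_simp
  ring

lemma exp_congr_of_eq_add_int {a b : ℝ} (r : ℝ) (m : ℤ) (h : a = b + m * (2 * Real.pi)) :
    Complex.exp ((r : ℂ) + Complex.I * (a : ℂ)) = Complex.exp ((r : ℂ) + Complex.I * (b : ℂ)) := by
  rw [Complex.exp_eq_exp_iff_exists_int]
  refine ⟨m, ?_⟩
  rw [h]
  push_cast
  ring

/-- Shifting `x 0` by `ℓ` changes the offset `nℓ/q` into `(n + q)ℓ/q`, and the gauge factor supplies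
the missing frequency `ωℓ = q · wave B` in `x 1`. -/
lemma magTranslation_zero_mode (n p : ℤ) (P : ℂ[X]) (x : E3) :
    magTranslation B q (latticeVec B 0) (mode B q ϑ n p P) x = mode B q ϑ (n + q) p P x := by
  have hw := wave_mul_natCast (B := B) q
  have hf : freq B q = q * B := rfl
  rw [magTranslation, mode, mode, oscPos_shift_zero, mul_left_comm, ← Complex.exp_add]
  congr 2
  have e : (q / 2 * (field B ⬝ᵥ crossProduct (latticeVec B 0) x) : ℝ) +
      modePhase B q ϑ n p (x + latticeVec B 0) = modePhase B q ϑ (n + q) p x := by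
    rw [modePhase, oscPos_shift_zero, modePhase]
    simp [field, latticeVec, cross_apply, dotProduct, Fin.sum_univ_three]
    linear_combination (x 1) * hw - (x 1 * latticeConst B / 2) * hf
  rw [← e]
  push_cast
  ring

/-- The gauge factor cancels the change of `ω x 0 x 1 / 2`; what is left is the phase `2πn`. -/
lemma magTranslation_one_mode (n p : ℤ) (P : ℂ[X]) (x : E3) :
    magTranslation B q (latticeVec B 1) (mode B q ϑ n p P) x = mode B q ϑ n p P x := by
  have hw := wave_mul_latticeConst (B := B)
  have hf : freq B q = q * B := rfl
  have e0 : oscPos B q ϑ n (x + latticeVec B 1) = oscPos B q ϑ n x := by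
    simp [oscPos, latticeVec]
  rw [magTranslation, mode, mode, e0, mul_left_comm, ← Complex.exp_add]
  congr 1
  have e : (q / 2 * (field B ⬝ᵥ crossProduct (latticeVec B 1) x) : ℝ) +
      modePhase B q ϑ n p (x + latticeVec B 1) = modePhase B q ϑ n p x + n * (2 * Real.pi) := by
    rw [modePhase, e0, modePhase]
    simp [field, latticeVec, cross_apply, dotProduct, Fin.sum_univ_three]
    linear_combination (n : ℝ) * hw + (x 0 * latticeConst B / 2) * hf
  rw [← exp_congr_of_eq_add_int _ _ e]
  congr 1
  push_cast
  ring

lemma magTranslation_two_mode (n p : ℤ) (P : ℂ[X]) (x : E3) :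
    magTranslation B q (latticeVec B 2) (mode B q ϑ n p P) x = mode B q ϑ n p P x := by
  have hw := wave_mul_latticeConst (B := B)
  have e0 : oscPos B q ϑ n (x + latticeVec B 2) = oscPos B q ϑ n x := by
    simp [oscPos, latticeVec]
  rw [magTranslation, mode, mode, e0, mul_left_comm, ← Complex.exp_add]
  congr 1
  have e : (q / 2 * (field B ⬝ᵥ crossProduct (latticeVec B 2) x) : ℝ) +
      modePhase B q ϑ n p (x + latticeVec B 2) = modePhase B q ϑ n p x + p * (2 * Real.pi) := by
    rw [modePhase, e0, modePhase]
    simp [field, latticeVec, cross_apply, dotProduct, Fin.sum_univ_three]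
    linear_combination (p : ℝ) * hw
  rw [← exp_congr_of_eq_add_int _ _ e]
  congr 1
  push_cast
  ring

lemma norm_mode (n p : ℤ) (P : ℂ[X]) (x : E3) : ‖mode B q ϑ n p P x‖ =
    ‖P.eval (oscPos B q ϑ n x : ℂ)‖ * Real.exp (-(freq B q / 2 * oscPos B q ϑ n x ^ 2)) := by
  rw [mode, norm_mul, Complex.exp_add, norm_mul, mul_comm Complex.I, Complex.norm_exp_ofReal_mul_I,
    mul_one, ← Complex.ofReal_exp, Complex.norm_real, Real.norm_of_nonneg (Real.exp_pos _).le]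

lemma exists_norm_eval_mul_exp_le (P : ℂ[X]) {a : ℝ} (ha : 0 < a) :
    ∃ C, ∀ t : ℝ, ‖P.eval (t : ℂ)‖ * Real.exp (-(a * t ^ 2)) ≤ C := by
  induction P using Polynomial.induction_on' with
  | add p r hp hr =>
    obtain ⟨C, hC⟩ := hp
    obtain ⟨D, hD⟩ := hr
    refine ⟨C + D, fun t => ?_⟩
    rw [Polynomial.eval_add]
    refine le_trans ?_ (add_le_add (hC t) (hD t))
    rw [← add_mul]
    gcongr
    exact norm_add_le _ _
  | monomial n c =>
    refine ⟨‖c‖ * (n.factorial * Real.exp (1 / (4 * a))), fun t => ?_⟩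
    rw [Polynomial.eval_monomial, norm_mul, norm_pow, Complex.norm_real, Real.norm_eq_abs, mul_assoc]
    refine mul_le_mul_of_nonneg_left ?_ (norm_nonneg _)
    have h1 : |t| ^ n ≤ n.factorial * Real.exp |t| := by
      have := Real.pow_div_factorial_le_exp |t| (abs_nonneg t) n
      rwa [div_le_iff₀ (by positivity), mul_comm] at this
    calc |t| ^ n * Real.exp (-(a * t ^ 2)) ≤ n.factorial * Real.exp |t| * Real.exp (-(a * t ^ 2)) := by
          gcongr
      _ = n.factorial * Real.exp (|t| - a * t ^ 2) := by
          rw [mul_assoc, ← Real.exp_add, sub_eq_add_neg]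
      _ ≤ _ := by
          refine mul_le_mul_of_nonneg_left (Real.exp_le_exp.2 ?_) (Nat.cast_nonneg _)
          rw [le_div_iff₀ (by positivity), ← sq_abs t]
          -- Completing the square: `1/(4a) - |t| + a t² = (2a|t| - 1)²/(4a)`.
          nlinarith [sq_nonneg (2 * a * |t| - 1)]

/-- The weight is absorbed by replacing `P` with `P (1 + X²)^(m+1)`. -/
lemma exists_norm_eval_mul_exp_le_inv (P : ℂ[X]) {a : ℝ} (ha : 0 < a) (m : ℕ) :
    ∃ C, 0 ≤ C ∧ ∀ t : ℝ, (1 + t ^ 2) ^ m * (‖P.eval (t : ℂ)‖ * Real.exp (-(a * t ^ 2))) ≤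
      C * (1 + t ^ 2)⁻¹ := by
  obtain ⟨C, hC⟩ := exists_norm_eval_mul_exp_le (P * (1 + Polynomial.X ^ 2) ^ (m + 1)) ha
  have hC0 : 0 ≤ C := le_trans (by positivity) (hC 0)
  refine ⟨C, hC0, fun t => ?_⟩
  rw [← div_eq_mul_inv, le_div_iff₀ (by positivity)]
  refine le_trans (le_of_eq ?_) (hC t)
  have e : ‖(1 + (t : ℂ) ^ 2)‖ = 1 + t ^ 2 := by
    rw [show (1 + (t : ℂ) ^ 2) = ((1 + t ^ 2 : ℝ) : ℂ) by push_cast; rfl, Complex.norm_real,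
      Real.norm_of_nonneg (by positivity)]
  simp only [Polynomial.eval_mul, Polynomial.eval_pow, Polynomial.eval_add, Polynomial.eval_one,
    Polynomial.eval_X, norm_mul, norm_pow, e]
  ring

/-- Quantitative decay of the modes. -/
lemma exists_norm_mode_le (P : ℂ[X]) (m : ℕ) : ∃ C, 0 ≤ C ∧ ∀ (n p : ℤ) (x : E3),
    (1 + oscPos B q ϑ n x ^ 2) ^ m * ‖mode B q ϑ n p P x‖ ≤ C * (1 + oscPos B q ϑ n x ^ 2)⁻¹ := by
  obtain ⟨C, hC0, hC⟩ := exists_norm_eval_mul_exp_le_inv P (half_pos (freq_pos (B := B) (q := q))) m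
  refine ⟨C, hC0, fun n p x => ?_⟩
  rw [norm_mode]
  exact hC _

/-- Raising `n` by `jq` shifts the oscillator coordinate by `jℓ`; the Peetre inequality then
separates `j` from `x`, giving a bound summable in `j`. -/
lemma exists_norm_mode_add_mul_le (P : ℂ[X]) : ∃ C, 0 ≤ C ∧ ∀ (n p j : ℤ) (x : E3),
    ‖mode B q ϑ (n + j * q) p P x‖ ≤
      C * (1 + oscPos B q ϑ n x ^ 2) * (1 + ((j : ℝ) * latticeConst B) ^ 2)⁻¹ := by
  obtain ⟨C, hC0, hC⟩ := exists_norm_mode_le (B := B) (q := q) (ϑ := ϑ) P 0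
  refine ⟨C * 2, by positivity, fun n p j x => ?_⟩
  have h := hC (n + j * q) p x
  rw [pow_zero, one_mul, oscPos_add_mul] at h
  refine h.trans ?_
  rw [mul_assoc C, mul_assoc C]
  exact mul_le_mul_of_nonneg_left (inv_one_add_sq_le _ _) hC0

lemma summable_mode (n p : ℤ) (P : ℂ[X]) (x : E3) :
    Summable fun j : ℤ => mode B q ϑ (n + j * q) p P x := by
  obtain ⟨C, hC0, hC⟩ := exists_norm_mode_add_mul_le (B := B) (q := q) (ϑ := ϑ) P
  exact Summable.of_norm_bounded ((summable_inv_one_add_sq latticeConst_pos.ne').mul_left _)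
    fun j => hC n p j x

lemma contDiff_mode (n p : ℤ) (P : ℂ[X]) : ContDiff ℝ ∞ (mode B q ϑ n p P) := by
  have h1 : ContDiff ℝ ∞ fun x : E3 => oscPos B q ϑ n x := by
    unfold oscPos
    fun_prop
  have h2 : ContDiff ℝ ∞ fun x : E3 => modePhase B q ϑ n p x := by
    unfold modePhase
    fun_prop
  have h3 : ContDiff ℝ ∞ fun z : ℂ => P.eval z := by
    simpa using ((P.contDiff_aeval (𝕜 := ℂ) ∞).restrict_scalars ℝ)
  have h4 : ContDiff ℝ ∞ fun x : E3 => (oscPos B q ϑ n x : ℂ) := Complex.ofRealCLM.contDiff.comp h1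
  have h5 : ContDiff ℝ ∞ fun x : E3 => (modePhase B q ϑ n p x : ℂ) :=
    Complex.ofRealCLM.contDiff.comp h2
  have h6 : ContDiff ℝ ∞ fun x : E3 => ((-(freq B q / 2 * oscPos B q ϑ n x ^ 2) : ℝ) : ℂ) :=
    
    Complex.ofRealCLM.contDiff.comp (contDiff_const.mul (h1.pow 2)).neg
  exact (h3.comp h4).mul (h6.add (contDiff_const.mul h5)).cexp

/-- The derivative of a mode along a line on which the phase is affine. -/
lemma hasDerivAt_mode_aux (P : ℂ[X]) (w t α ph β : ℝ) :
    HasDerivAt (fun s : ℝ => P.eval ((t + s * α : ℝ) : ℂ) *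
      Complex.exp ((-(w / 2 * (t + s * α) ^ 2) : ℝ) + Complex.I * (ph + s * β : ℝ)))
      ((α * P.derivative.eval (t : ℂ) + (-(w * t * α) + Complex.I * β) * P.eval (t : ℂ)) *
        Complex.exp ((-(w / 2 * t ^ 2) : ℝ) + Complex.I * (ph : ℝ))) 0 := by
  have h1 : HasDerivAt (fun s : ℝ => ((t + s * α : ℝ) : ℂ)) (α : ℂ) 0 := by
    simpa using (((hasDerivAt_id (0 : ℝ)).mul_const α).const_add t).ofReal_comp
  have h2 : HasDerivAt (fun s : ℝ => P.eval ((t + s * α : ℝ) : ℂ))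
      (P.derivative.eval (t : ℂ) * α) 0 := by
    refine ((P.hasDerivAt ((t + 0 * α : ℝ) : ℂ)).comp (h := fun s : ℝ => ((t + s * α : ℝ) : ℂ))
      (0 : ℝ) h1).congr_deriv ?_
    simp
  have h3 : HasDerivAt (fun s : ℝ => ((-(w / 2 * (t + s * α) ^ 2) : ℝ) : ℂ) +
      Complex.I * (ph + s * β : ℝ)) (-(w * t * α) + Complex.I * β) 0 := by
    have a1 : HasDerivAt (fun s : ℝ => (ph + s * β : ℝ)) β 0 := by
      simpa using ((hasDerivAt_id (0 : ℝ)).mul_const β).const_add ph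
    have a0 : HasDerivAt (fun s : ℝ => (t + s * α : ℝ)) α 0 := by
      simpa using ((hasDerivAt_id (0 : ℝ)).mul_const α).const_add t
    have a2 : HasDerivAt (fun s : ℝ => -(w / 2 * (t + s * α) ^ 2)) (-(w * t * α)) 0 := by
      refine ((a0.pow 2).const_mul (w / 2)).neg.congr_deriv ?_
      norm_num
      ring
    refine (a2.ofReal_comp.add (a1.ofReal_comp.const_mul Complex.I)).congr_deriv ?_
    push_cast
    ring
  refine (h2.mul h3.cexp).congr_deriv ?_
  simp only [zero_mul, add_zero]
  ring

/-- The phase was chosen for this. Its `x 0`-derivative cancels the vector potential and `ϑ 0`; its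
`x 1`-derivative completes them to `ω` times the oscillator coordinate; its `x 2`-derivative adds
`p` to `ϑ 2`. A momentum thus acts on the polynomial factor only. -/
lemma fderiv_mode (n p : ℤ) (P : ℂ[X]) (x : E3) (j : Fin 3) :
    -Complex.I * fderiv ℝ (mode B q ϑ n p P) x (Pi.single j 1) +
      ((q * vectorPotential B x j + Real.sqrt (2 * Real.pi * B) * ϑ j : ℝ) : ℂ) *
        mode B q ϑ n p P x = mode B q ϑ n p (modeMomentum B q ϑ p j P) x := by
  have hfr := freq_pos (B := B) (q := q)
  have hq : (q : ℝ) ≠ 0 := Nat.cast_ne_zero.2 (NeZero.ne q)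
  have hd : DifferentiableAt ℝ (mode B q ϑ n p P) x :=
    ((contDiff_mode n p P).differentiable (by simp)) x
  have key : ∀ α β : ℝ, (∀ s : ℝ, oscPos B q ϑ n (x + s • Pi.single j 1) = oscPos B q ϑ n x + s * α) →
      (∀ s : ℝ, modePhase B q ϑ n p (x + s • Pi.single j 1) = modePhase B q ϑ n p x + s * β) →
      fderiv ℝ (mode B q ϑ n p P) x (Pi.single j 1) =
      ((α * P.derivative.eval (oscPos B q ϑ n x : ℂ) + (-(freq B q * oscPos B q ϑ n x * α) +
        Complex.I * β) * P.eval (oscPos B q ϑ n x : ℂ)) *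
        Complex.exp ((-(freq B q / 2 * oscPos B q ϑ n x ^ 2) : ℝ) +
          Complex.I * (modePhase B q ϑ n p x : ℝ))) := by
    intro α β hα hβ
    rw [← hd.lineDeriv_eq_fderiv, lineDeriv]
    have := hasDerivAt_mode_aux P (freq B q) (oscPos B q ϑ n x) α (modePhase B q ϑ n p x) β
    simp only [← hα, ← hβ] at this
    exact this.deriv
  rw [sqrt_eq_wave]
  have hI := Complex.I_mul_I
  have hfc : ((freq B q : ℝ) : ℂ) = q * B := by simp [freq]
  fin_cases j
  · have h := key 1 (-(wave B * ϑ 0) + freq B q * x 1 / 2) (fun s => by simp [oscPos]; ring)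
      (fun s => by simp [modePhase, oscPos]; ring)
    simp only [Fin.zero_eta] at h ⊢
    rw [h, mode, mode]
    simp [modeMomentum, vectorPotential, field, cross_apply]
    generalize Complex.exp (-((freq B q : ℂ) / 2 * (oscPos B q ϑ n x : ℂ) ^ 2) +
      Complex.I * (modePhase B q ϑ n p x : ℂ)) = Ex
    generalize (P.eval (oscPos B q ϑ n x : ℂ)) = Pt
    linear_combination (-(-(wave B * ϑ 0) + freq B q * x 1 / 2 : ℂ) * Pt * Ex) * hI +
      (x 1 / 2 * Pt * Ex) * hfc
  · have h := key 0 (freq B q * x 0 / 2 + wave B * n) (fun s => by simp [oscPos])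
      (fun s => by simp [modePhase, oscPos]; ring)
    simp only [Fin.mk_one] at h ⊢
    have e : freq B q * oscPos B q ϑ n x = freq B q * x 0 + wave B * n + wave B * ϑ 1 := by
      rw [oscPos, mul_add, mul_add, mul_div_cancel₀ _ hfr.ne', ← mul_div_assoc, mul_left_comm,
        wave_mul_natCast]
      field_simp
      ring
    have e' : ((freq B q : ℝ) : ℂ) * (oscPos B q ϑ n x : ℂ) =
      freq B q * x 0 + wave B * n + wave B * ϑ 1 := by exact_mod_cast congrArg Complex.ofReal e
    rw [h, mode, mode]
    simp [modeMomentum, vectorPotential, field, cross_apply]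
    generalize Complex.exp (-((freq B q : ℂ) / 2 * (oscPos B q ϑ n x : ℂ) ^ 2) +
      Complex.I * (modePhase B q ϑ n p x : ℂ)) = Ex
    generalize (P.eval (oscPos B q ϑ n x : ℂ)) = Pt
    linear_combination (-(freq B q * x 0 / 2 + wave B * n : ℂ) * Pt * Ex) * hI - Pt * Ex * e' -
      (x 0 / 2 * Pt * Ex) * hfc
  · have h := key 0 (wave B * p) (fun s => by simp [oscPos])
      (fun s => by simp [modePhase, oscPos]; ring)
    simp only [Fin.reduceFinMk] at h ⊢
    rw [h, mode, mode]
    simp [modeMomentum, vectorPotential, field, cross_apply]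
    generalize Complex.exp (-((freq B q : ℂ) / 2 * (oscPos B q ϑ n x : ℂ) ^ 2) +
      Complex.I * (modePhase B q ϑ n p x : ℂ)) = Ex
    generalize (P.eval (oscPos B q ϑ n x : ℂ)) = Pt
    linear_combination (-(wave B * p : ℂ) * Pt * Ex) * hI

end Modes

/-! ### Bloch sums of modes and their weak momenta. -/

section Bloch

variable {B : ℝ} {q : ℕ} {ϑ : E3}

lemma IsGaugePeriodic.congr {f g : E3 → ℂ} (hf : IsGaugePeriodic B q f) (h : f =ᵐ[volume] g) :
    IsGaugePeriodic B q g := by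
  intro j
  filter_upwards [hf j, h, ae_translate h (latticeVec B j)] with x h1 h2 h3
  rw [magTranslation] at h1 ⊢
  rw [← h2, ← h3, h1]

/-- A gauge-periodic function as an element of the Hilbert space. -/
def MagL2.ofFun (f : E3 → ℂ) (hf : AEStronglyMeasurable f volume)
    (hK : ∀ K : Set E3, IsCompact K → MemLp f 2 (volume.restrict K)) (hg : IsGaugePeriodic B q f) :
    MagL2 B q :=
  ⟨AEEqFun.mk f hf, fun K hK' => (hK K hK').ae_eq (ae_restrict_of_ae (AEEqFun.coeFn_mk f hf).symm),
    hg.congr (AEEqFun.coeFn_mk f hf).symm⟩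

lemma MagL2.coeFn_ofFun (f : E3 → ℂ) (hf : AEStronglyMeasurable f volume)
    (hK : ∀ K : Set E3, IsCompact K → MemLp f 2 (volume.restrict K)) (hg : IsGaugePeriodic B q f) :
    ((MagL2.ofFun f hf hK hg : MagL2 B q) : E3 →ₘ[volume] ℂ) =ᵐ[volume] f :=
  AEEqFun.coeFn_mk f hf

/-- The gauge-periodic sum of translates of a mode. -/
def blochFun (B : ℝ) (q : ℕ) (ϑ : E3) (n p : ℤ) (P : ℂ[X]) (x : E3) : ℂ :=
  ∑' j : ℤ, mode B q ϑ (n + j * q) p P x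

variable [hB : Fact (0 < B)] [NeZero q]

lemma aestronglyMeasurable_blochFun (n p : ℤ) (P : ℂ[X]) (μ : Measure E3) :
    AEStronglyMeasurable (blochFun B q ϑ n p P) μ := by
  refine aestronglyMeasurable_of_tendsto_ae (atTop : Filter (Finset ℤ))
    (f := fun s x => ∑ j ∈ s, mode B q ϑ (n + j * q) p P x) (fun s => ?_)
    (ae_of_all _ fun x => (summable_mode n p P x).hasSum)
  exact (continuous_finsetSum s fun j _ => (contDiff_mode _ _ _).continuous).aestronglyMeasurable

omit hB [NeZero q] in
lemma continuous_oscPos (n : ℤ) : Continuous fun x => oscPos B q ϑ n x := by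
  unfold oscPos
  fun_prop

/-- The growth in `x` is harmless: the bound is only used on compact sets. -/
lemma exists_norm_blochFun_le (P : ℂ[X]) : ∃ C, ∀ (n p : ℤ) (x : E3),
    ‖blochFun B q ϑ n p P x‖ ≤ C * (1 + oscPos B q ϑ n x ^ 2) := by
  obtain ⟨C, hC0, hC⟩ := exists_norm_mode_add_mul_le (B := B) (q := q) (ϑ := ϑ) P
  have hs := summable_inv_one_add_sq (latticeConst_pos (B := B)).ne'
  refine ⟨C * ∑' j : ℤ, (1 + ((j : ℝ) * latticeConst B) ^ 2)⁻¹, fun n p x => ?_⟩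
  rw [mul_right_comm]
  exact tsum_of_norm_bounded (hs.hasSum.mul_left _) fun j => hC n p j x

lemma memLp_blochFun (n p : ℤ) (P : ℂ[X]) {K : Set E3} (hK : IsCompact K) :
    MemLp (blochFun B q ϑ n p P) 2 (volume.restrict K) := by
  obtain ⟨C, hC⟩ := exists_norm_blochFun_le (B := B) (q := q) (ϑ := ϑ) P
  have : IsFiniteMeasure ((volume : Measure E3).restrict K) := ⟨by simpa using hK.measure_lt_top⟩
  have hc : Continuous fun x => C * (1 + oscPos B q ϑ n x ^ 2) :=
    continuous_const.mul (continuous_const.add ((continuous_oscPos n).pow 2))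
  obtain ⟨M, hM⟩ := hK.exists_bound_of_continuousOn hc.continuousOn
  refine MemLp.of_bound (aestronglyMeasurable_blochFun n p P _) M ?_
  filter_upwards [ae_restrict_mem hK.measurableSet] with x hx
  exact (hC n p x).trans ((le_abs_self _).trans (hM x hx))

omit hB in
lemma blochFun_add_charge (n p : ℤ) (P : ℂ[X]) (x : E3) :
    blochFun B q ϑ (n + q) p P x = blochFun B q ϑ n p P x := by
  rw [blochFun, blochFun,
    ← (Equiv.addRight (1 : ℤ)).tsum_eq fun j => mode B q ϑ (n + j * q) p P x]
  refine tsum_congr fun j => ?_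
  rw [Equiv.coe_addRight]
  congr 1
  ring

lemma magTranslation_blochFun (n p : ℤ) (P : ℂ[X]) (j : Fin 3) (x : E3) :
    magTranslation B q (latticeVec B j) (blochFun B q ϑ n p P) x = blochFun B q ϑ n p P x := by
  have e : magTranslation B q (latticeVec B j) (blochFun B q ϑ n p P) x =
      ∑' i : ℤ, magTranslation B q (latticeVec B j) (mode B q ϑ (n + i * q) p P) x := by
    simp only [magTranslation, blochFun, tsum_mul_left]
  rw [e]
  fin_cases j
  · rw [← blochFun_add_charge, blochFun]
    refine tsum_congr fun i => (magTranslation_zero_mode _ _ _ _).trans ?_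
    congr 1
    ring
  · exact tsum_congr fun i => magTranslation_one_mode _ _ _ _
  · exact tsum_congr fun i => magTranslation_two_mode _ _ _ _

omit hB [NeZero q] in
lemma mode_add (n p : ℤ) (P Q : ℂ[X]) (x : E3) :
    mode B q ϑ n p (P + Q) x = mode B q ϑ n p P x + mode B q ϑ n p Q x := by
  simp [mode, add_mul]

omit hB [NeZero q] in
lemma mode_smul (n p : ℤ) (c : ℂ) (P : ℂ[X]) (x : E3) :
    mode B q ϑ n p (c • P) x = c * mode B q ϑ n p P x := by
  simp [mode, mul_assoc]

/-- The Bloch function of a polynomial as an element of the Hilbert space. -/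
def bloch (B : ℝ) (q : ℕ) (ϑ : E3) [Fact (0 < B)] [NeZero q] (n p : ℤ) : ℂ[X] →ₗ[ℂ] MagL2 B q where
  toFun P := MagL2.ofFun (blochFun B q ϑ n p P) (aestronglyMeasurable_blochFun n p P _)
    (fun _ hK => memLp_blochFun n p P hK) fun j => ae_of_all _ (magTranslation_blochFun n p P j)
  map_add' P Q := by
    apply Subtype.ext
    apply AEEqFun.ext
    refine (MagL2.coeFn_ofFun _ _ _ _).trans ?_
    refine EventuallyEq.trans ?_ (AEEqFun.coeFn_add _ _).symm
    filter_upwards [MagL2.coeFn_ofFun (B := B) (q := q) (blochFun B q ϑ n p P)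
      (aestronglyMeasurable_blochFun n p P _) (fun _ hK => memLp_blochFun n p P hK)
      fun j => ae_of_all _ (magTranslation_blochFun n p P j),
      MagL2.coeFn_ofFun (B := B) (q := q) (blochFun B q ϑ n p Q)
      (aestronglyMeasurable_blochFun n p Q _) (fun _ hK => memLp_blochFun n p Q hK)
      fun j => ae_of_all _ (magTranslation_blochFun n p Q j)] with x h1 h2
    rw [Pi.add_apply, h1, h2, blochFun, blochFun, blochFun,
      ← (summable_mode n p P x).tsum_add (summable_mode n p Q x)]
    exact tsum_congr fun j => mode_add _ _ _ _ _
  map_smul' c P := by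
    apply Subtype.ext
    apply AEEqFun.ext
    refine (MagL2.coeFn_ofFun _ _ _ _).trans ?_
    refine EventuallyEq.trans ?_ (AEEqFun.coeFn_smul _ _).symm
    filter_upwards [MagL2.coeFn_ofFun (B := B) (q := q) (blochFun B q ϑ n p P)
      (aestronglyMeasurable_blochFun n p P _) (fun _ hK => memLp_blochFun n p P hK)
      fun j => ae_of_all _ (magTranslation_blochFun n p P j)] with x h1
    rw [RingHom.id_apply, Pi.smul_apply, h1, blochFun, blochFun, smul_eq_mul, ← tsum_mul_left]
    exact tsum_congr fun j => mode_smul _ _ _ _ _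

lemma coeFn_bloch (n p : ℤ) (P : ℂ[X]) :
    ((bloch B q ϑ n p P : MagL2 B q) : E3 →ₘ[volume] ℂ) =ᵐ[volume] blochFun B q ϑ n p P :=
  MagL2.coeFn_ofFun _ (aestronglyMeasurable_blochFun n p P _)
    (fun _ hK => memLp_blochFun n p P hK) fun j => ae_of_all _ (magTranslation_blochFun n p P j)

lemma bloch_add_charge (n p : ℤ) (P : ℂ[X]) :
    bloch B q ϑ (n + q) p P = bloch B q ϑ n p P := by
  apply Subtype.ext
  apply AEEqFun.ext
  filter_upwards [coeFn_bloch (B := B) (q := q) (ϑ := ϑ) (n + q) p P,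
    coeFn_bloch (B := B) (q := q) (ϑ := ϑ) n p P] with x h1 h2
  rw [h1, h2, blochFun_add_charge]

/-- Only the residue class of `n` modulo `q` matters; this leaves `q` states per pair `(k,p)`. -/
lemma bloch_emod (n p : ℤ) (P : ℂ[X]) :
    bloch B q ϑ (n % q) p P = bloch B q ϑ n p P := by
  have h : ∀ (k m : ℤ), bloch B q ϑ (m + k * q) p P = bloch B q ϑ m p P := by
    intro k
    induction k using Int.induction_on with
    | zero => simp
    | succ i ih => intro m; rw [add_mul, one_mul, ← add_assoc, bloch_add_charge, ih]
    | pred i ih =>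
      intro m
      rw [← bloch_add_charge, ← ih m]
      congr 2
      ring
  conv_rhs => rw [← Int.emod_add_mul_ediv n q, mul_comm (q : ℤ), h]

/-- Termwise integration of the Bloch sums. -/
lemma hasSum_integral_mode_mul (n p : ℤ) (P : ℂ[X]) {μ : Measure E3} {g : E3 → ℂ}
    (hg' : AEStronglyMeasurable g μ)
    (hg : Integrable (fun x => (1 + oscPos B q ϑ n x ^ 2) * ‖g x‖) μ) :
    HasSum (fun j : ℤ => ∫ x, mode B q ϑ (n + j * q) p P x * g x ∂μ)
      (∫ x, blochFun B q ϑ n p P x * g x ∂μ) := by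
  obtain ⟨C, hC0, hC⟩ := exists_norm_mode_add_mul_le (B := B) (q := q) (ϑ := ϑ) P
  have hs := summable_inv_one_add_sq (latticeConst_pos (B := B)).ne'
  have hb : ∀ (j : ℤ) x, ‖mode B q ϑ (n + j * q) p P x * g x‖ ≤
      C * (1 + ((j : ℝ) * latticeConst B) ^ 2)⁻¹ * ((1 + oscPos B q ϑ n x ^ 2) * ‖g x‖) := by
    intro j x
    rw [norm_mul]
    refine (mul_le_mul_of_nonneg_right (hC n p j x) (norm_nonneg _)).trans_eq ?_
    ring
  have hi : ∀ j : ℤ, Integrable (fun x => mode B q ϑ (n + j * q) p P x * g x) μ := fun j =>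
    (hg.const_mul _).mono' ((contDiff_mode _ _ _).continuous.aestronglyMeasurable.mul hg')
      (ae_of_all _ (hb j))
  have := hasSum_integral_of_summable_integral_norm hi (by
    refine Summable.of_nonneg_of_le (fun j => integral_nonneg fun x => norm_nonneg _) (fun j => ?_)
      ((hs.mul_left C).mul_right (∫ x, (1 + oscPos B q ϑ n x ^ 2) * ‖g x‖ ∂μ))
    rw [← integral_const_mul]
    exact integral_mono (hi j).norm (hg.const_mul _) (hb j))
  simpa only [blochFun, tsum_mul_right] using this

/-- Integration by parts, without boundary terms because `φ` has compact support. -/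
lemma integral_mode_mul_momentumT (n p : ℤ) (P : ℂ[X]) (j : Fin 3) {φ : E3 → ℂ} (hφ : IsTest φ) :
    ∫ x, mode B q ϑ n p (modeMomentum B q ϑ p j P) x * φ x =
      ∫ x, mode B q ϑ n p P x * momentumT B q ϑ j φ x := by
  have hm := contDiff_mode (B := B) (q := q) (ϑ := ϑ) n p P
  have hd : Continuous fun x => fderiv ℝ φ x (Pi.single j 1) :=
    ((hφ.1.fderiv_right (m := ∞) (by simp)).clm_apply contDiff_const).continuous
  have hd' : Continuous fun x => fderiv ℝ (mode B q ϑ n p P) x (Pi.single j 1) :=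
    ((hm.fderiv_right (m := ∞) (by simp)).clm_apply contDiff_const).continuous
  have hA : Continuous fun x : E3 => ((q * vectorPotential B x j +
      Real.sqrt (2 * Real.pi * B) * ϑ j : ℝ) : ℂ) := by
    have : Continuous fun x : E3 => vectorPotential B x j := by
      unfold vectorPotential
      fin_cases j <;> simp [cross_apply] <;> fun_prop
    fun_prop
  have i1 : Integrable fun x => fderiv ℝ (mode B q ϑ n p P) x (Pi.single j 1) * φ x :=
    (hd'.mul hφ.1.continuous).integrable_of_hasCompactSupport hφ.2.mul_left
  have i2 : Integrable fun x => mode B q ϑ n p P x * fderiv ℝ φ x (Pi.single j 1) :=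
    (hm.continuous.mul hd).integrable_of_hasCompactSupport
      (hφ.2.fderiv_apply ℝ (Pi.single j 1)).mul_left
  have i3 : Integrable fun x => mode B q ϑ n p P x * φ x :=
    (hm.continuous.mul hφ.1.continuous).integrable_of_hasCompactSupport hφ.2.mul_left
  have i4 : Integrable fun x => ((q * vectorPotential B x j +
      Real.sqrt (2 * Real.pi * B) * ϑ j : ℝ) : ℂ) * (mode B q ϑ n p P x * φ x) :=
    (hA.mul (hm.continuous.mul hφ.1.continuous)).integrable_of_hasCompactSupport
      hφ.2.mul_left.mul_left
  have h := integral_mul_fderiv_eq_neg_fderiv_mul_of_integrable (μ := volume) i1 i2 i3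
    (fun x _ => (hm.differentiable (by simp)) x) (fun x _ => (hφ.1.differentiable (by simp)) x)
  have e1 : ∀ x, mode B q ϑ n p (modeMomentum B q ϑ p j P) x * φ x =
      -Complex.I * (fderiv ℝ (mode B q ϑ n p P) x (Pi.single j 1) * φ x) +
      ((q * vectorPotential B x j + Real.sqrt (2 * Real.pi * B) * ϑ j : ℝ) : ℂ) *
        (mode B q ϑ n p P x * φ x) := by
    intro x
    rw [← fderiv_mode]
    ring
  have e2 : ∀ x, mode B q ϑ n p P x * momentumT B q ϑ j φ x =
      Complex.I * (mode B q ϑ n p P x * fderiv ℝ φ x (Pi.single j 1)) +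
      ((q * vectorPotential B x j + Real.sqrt (2 * Real.pi * B) * ϑ j : ℝ) : ℂ) *
        (mode B q ϑ n p P x * φ x) := by
    intro x
    rw [momentumT]
    ring
  simp only [e1, e2]
  rw [integral_add (i1.const_mul _) i4, integral_add (i2.const_mul _) i4, integral_const_mul,
    integral_const_mul, h]
  ring

lemma IsTest.integrable_weight {φ : E3 → ℂ} (hφ : IsTest φ) (n : ℤ) :
    Integrable fun x => (1 + oscPos B q ϑ n x ^ 2) * ‖φ x‖ :=
  ((continuous_const.add ((continuous_oscPos n).pow 2)).mul
    hφ.1.continuous.norm).integrable_of_hasCompactSupport hφ.2.norm.mul_left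

/-- The Bloch sum is never differentiated: the series is integrated termwise against the test
function, and each mode is integrated by parts. -/
lemma isWeakImage_bloch (n p : ℤ) (P : ℂ[X]) (j : Fin 3) :
    IsWeakImage (momentumT B q ϑ j) (bloch B q ϑ n p P : MagL2 B q)
      (bloch B q ϑ n p (modeMomentum B q ϑ p j P) : MagL2 B q) := by
  intro φ hφ
  have e : ∀ (P : ℂ[X]) (χ : E3 → ℂ),
      ∫ x, ((bloch B q ϑ n p P : MagL2 B q) : E3 →ₘ[volume] ℂ) x * χ x =
      ∫ x, blochFun B q ϑ n p P x * χ x := by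
    intro P χ
    refine integral_congr_ae ?_
    filter_upwards [coeFn_bloch (B := B) (q := q) (ϑ := ϑ) n p P] with x hx
    rw [hx]
  have hφ' := hφ.momentumT (B := B) (q := q) ϑ j
  rw [e, e]
  have h1 := hasSum_integral_mode_mul (B := B) (q := q) (ϑ := ϑ) n p (modeMomentum B q ϑ p j P)
    hφ.1.continuous.aestronglyMeasurable (hφ.integrable_weight n)
  have h2 := hasSum_integral_mode_mul (B := B) (q := q) (ϑ := ϑ) n p P
    hφ'.1.continuous.aestronglyMeasurable (hφ'.integrable_weight n)
  refine h1.unique ?_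
  simpa only [integral_mode_mul_momentumT _ _ _ _ hφ] using h2

end Bloch

/-! ### One-dimensional cut-off functions. -/

/-- Measurable functions on the line that decay like `(1 + t²)⁻¹`. -/
def Decays (f : ℝ → ℝ) : Prop := Measurable f ∧ ∃ D, ∀ t, |f t| ≤ D * (1 + t ^ 2)⁻¹

lemma Decays.of_bounded {f : ℝ → ℝ} (hf : Measurable f) {M R : ℝ} (hM : ∀ t, |f t| ≤ M)
    (hR : ∀ t, R < |t| → f t = 0) : Decays f := by
  refine ⟨hf, M * (1 + R ^ 2), fun t => ?_⟩
  have hM0 : 0 ≤ M := (abs_nonneg _).trans (hM 0)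
  by_cases h : R < |t|
  · rw [hR t h, abs_zero]
    positivity
  · rw [← div_eq_mul_inv, le_div_iff₀ (by positivity)]
    have h1 : t ^ 2 ≤ R ^ 2 := by
      rw [← sq_abs]
      exact pow_le_pow_left₀ (abs_nonneg _) (not_lt.1 h) 2
    exact mul_le_mul (hM t) (by linarith) (by positivity) hM0

/-- The indicator function of `[0,ℓ)`. -/
def cellInd (l t : ℝ) : ℝ := (Set.Ico 0 l).indicator 1 t

/-- A smooth step. -/
def smoothStep (l t : ℝ) : ℝ := Real.smoothTransition (t / l)

/-- A smooth compactly supported function whose translates by `ℓℤ` sum to one. -/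
def cellBump (l t : ℝ) : ℝ := smoothStep l t - smoothStep l (t - l)

/-- The difference of a smooth step and a sharp step. -/
def stepDefect (l t : ℝ) : ℝ := smoothStep l t - (Set.Ici 0).indicator 1 t

section Cutoffs

variable {l : ℝ} (hl : 0 < l)
include hl

lemma smoothStep_of_nonpos {t : ℝ} (ht : t ≤ 0) : smoothStep l t = 0 :=
  Real.smoothTransition.zero_of_nonpos (div_nonpos_of_nonpos_of_nonneg ht hl.le)

lemma smoothStep_of_le {t : ℝ} (ht : l ≤ t) : smoothStep l t = 1 :=
  Real.smoothTransition.one_of_one_le (by rwa [le_div_iff₀ hl, one_mul])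

omit hl in
lemma contDiff_smoothStep : ContDiff ℝ ∞ (smoothStep l) :=
  Real.smoothTransition.contDiff.comp (contDiff_id.div_const l)

omit hl in
lemma contDiff_cellBump : ContDiff ℝ ∞ (cellBump l) :=
  contDiff_smoothStep.sub (contDiff_smoothStep.comp (contDiff_id.sub contDiff_const))

omit hl in
lemma abs_smoothStep_sub_le (a : ℝ) {b : ℝ} (hb : 0 ≤ b) (hb' : b ≤ 1) :
    |smoothStep l a - b| ≤ 1 := by
  have h1 := Real.smoothTransition.nonneg (a / l)
  have h2 := Real.smoothTransition.le_one (a / l)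
  rw [abs_le, smoothStep]
  constructor <;> linarith

lemma cellBump_eq_zero {t : ℝ} (ht : 2 * l < |t|) : cellBump l t = 0 := by
  rw [cellBump]
  rcases lt_abs.1 ht with h | h
  · rw [smoothStep_of_le hl (by linarith), smoothStep_of_le hl (by linarith), sub_self]
  · rw [smoothStep_of_nonpos hl (by linarith), smoothStep_of_nonpos hl (by linarith), sub_self]

lemma decays_cellBump : Decays (cellBump l) :=
  Decays.of_bounded contDiff_cellBump.continuous.measurable
    (fun _ => abs_smoothStep_sub_le _ (Real.smoothTransition.nonneg _)
      (Real.smoothTransition.le_one _)) fun _ => cellBump_eq_zero hl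

omit hl in
lemma decays_cellInd : Decays (cellInd l) := by
  refine Decays.of_bounded (measurable_const.indicator measurableSet_Ico) (M := 1) (R := l)
    (fun t => ?_) fun t ht => ?_
  · rw [cellInd]
    by_cases h : t ∈ Set.Ico 0 l <;> simp [h]
  · refine Set.indicator_of_notMem (fun h => ?_) _
    rw [abs_of_nonneg h.1] at ht
    exact ht.not_gt h.2

lemma decays_stepDefect : Decays (stepDefect l) := by
  refine Decays.of_bounded (contDiff_smoothStep.continuous.measurable.sub
    (measurable_const.indicator measurableSet_Ici)) (M := 1) (R := l) (fun t => ?_) fun t ht => ?_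
  · rw [stepDefect]
    by_cases h : t ∈ Set.Ici (0 : ℝ)
    · rw [Set.indicator_of_mem h]
      exact abs_smoothStep_sub_le _ zero_le_one le_rfl
    · rw [Set.indicator_of_notMem h]
      exact abs_smoothStep_sub_le _ le_rfl zero_le_one
  · rw [stepDefect]
    rcases lt_abs.1 ht with h | h
    · rw [smoothStep_of_le hl h.le, Set.indicator_of_mem (show t ∈ Set.Ici (0 : ℝ) from
        (hl.trans h).le), Pi.one_apply, sub_self]
    · rw [smoothStep_of_nonpos hl (by linarith), Set.indicator_of_notMem (fun h' => by
        have : (0 : ℝ) ≤ t := h'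
        linarith), sub_self]

/-- Smooth and sharp cut-offs of one period differ by a difference of translates of a decaying
function, which integrates to zero against periodic functions. -/
lemma stepDefect_sub (t : ℝ) :
    stepDefect l t - stepDefect l (t - l) = cellBump l t - cellInd l t := by
  have : (Set.Ici (0 : ℝ)).indicator (1 : ℝ → ℝ) t - (Set.Ici (0 : ℝ)).indicator 1 (t - l) =
      (Set.Ico 0 l).indicator 1 t := by
    by_cases h : 0 ≤ t <;> by_cases h' : l ≤ t
    · simp [h, h', not_lt.2 h']
    · simp [h, h', not_le.1 h']
    · exact absurd (hl.le.trans h') h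
    · simp [h, h']
  rw [stepDefect, stepDefect, cellBump, cellInd, ← this]
  ring

lemma decays_deriv_smoothStep : Decays (deriv (smoothStep l)) := by
  have hc : Continuous (deriv (smoothStep l)) :=
    (contDiff_smoothStep (l := l)).continuous_deriv (by simp)
  have hz : ∀ t, l < |t| → deriv (smoothStep l) t = 0 := by
    intro t ht
    rcases lt_abs.1 ht with h | h
    · have : smoothStep l =ᶠ[𝓝 t] fun _ => 1 := by
        filter_upwards [lt_mem_nhds h] with s hs using smoothStep_of_le hl (le_of_lt hs)
      rw [this.deriv_eq, deriv_const]
    · have : smoothStep l =ᶠ[𝓝 t] fun _ => 0 := by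
        filter_upwards [gt_mem_nhds (show t < 0 by linarith)] with s hs
          using smoothStep_of_nonpos hl (le_of_lt hs)
      rw [this.deriv_eq, deriv_const]
  obtain ⟨M, hM⟩ := (isCompact_Icc (a := -l) (b := l)).exists_bound_of_continuousOn hc.continuousOn
  have hM0 : 0 ≤ M := (norm_nonneg _).trans (hM 0 ⟨by linarith, hl.le⟩)
  refine Decays.of_bounded hc.measurable (M := M) (fun t => ?_) hz
  by_cases h : l < |t|
  · rw [hz t h, abs_zero]
    exact hM0
  · exact hM t (abs_le.1 (not_lt.1 h))

-- The derivative of the bump is again a difference of translates by one period, so it is invisible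
-- to periodic functions.
omit hl in
lemma hasDerivAt_cellBump (t : ℝ) :
    HasDerivAt (cellBump l) (deriv (smoothStep l) t - deriv (smoothStep l) (t - l)) t := by
  have hd : Differentiable ℝ (smoothStep l) := contDiff_smoothStep.differentiable (by simp)
  refine (hd t).hasDerivAt.sub ?_
  exact (hd (t - l)).hasDerivAt.comp_sub_const t l

end Cutoffs

/-- A smooth function which equals one near the origin. -/
def plateau (t : ℝ) : ℝ := Real.smoothTransition (2 - t ^ 2)

lemma contDiff_plateau : ContDiff ℝ ∞ plateau :=
  Real.smoothTransition.contDiff.comp (contDiff_const.sub (contDiff_id.pow 2))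

lemma plateau_zero : plateau 0 = 1 := Real.smoothTransition.one_of_one_le (by norm_num)

lemma abs_plateau_le (t : ℝ) : |plateau t| ≤ 1 := by
  rw [plateau, abs_of_nonneg (Real.smoothTransition.nonneg _)]
  exact Real.smoothTransition.le_one _

lemma plateau_eq_zero {t : ℝ} (ht : 2 < |t|) : plateau t = 0 := by
  refine Real.smoothTransition.zero_of_nonpos ?_
  rw [← sq_abs]
  nlinarith

lemma exists_abs_deriv_plateau_le : ∃ M, ∀ t, |deriv plateau t| ≤ M := by
  have hc : Continuous (deriv plateau) := contDiff_plateau.continuous_deriv (by simp)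
  obtain ⟨M, hM⟩ := (isCompact_Icc (a := -2) (b := 2)).exists_bound_of_continuousOn hc.continuousOn
  have hM0 : 0 ≤ M := (norm_nonneg _).trans (hM 0 (by norm_num))
  refine ⟨M, fun t => ?_⟩
  by_cases h : 2 < |t|
  · have : plateau =ᶠ[𝓝 t] fun _ => 0 := by
      filter_upwards [continuous_abs.continuousAt.eventually (lt_mem_nhds h)] with s hs
        using plateau_eq_zero hs
    rw [this.deriv_eq, deriv_const, abs_zero]
    exact hM0
  · exact hM t (abs_le.1 (not_lt.1 h))

/-! ### Unfolding inner products from the cell to a strip. -/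

section Pairing

variable {B : ℝ} {q : ℕ} {ϑ : E3} [hB : Fact (0 < B)] [NeZero q]

lemma exists_norm_mode_le_inv (n p : ℤ) (P : ℂ[X]) :
    ∃ C, 0 ≤ C ∧ ∀ x, ‖mode B q ϑ n p P x‖ ≤ C * (1 + x 0 ^ 2)⁻¹ := by
  obtain ⟨C, hC0, hC⟩ := exists_norm_mode_le (B := B) (q := q) (ϑ := ϑ) P 0
  refine ⟨C * (2 * (1 + (n * latticeConst B / q + wave B * ϑ 1 / freq B q) ^ 2)), by positivity,
    fun x => ?_⟩
  have h := hC n p x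
  rw [pow_zero, one_mul] at h
  refine h.trans ?_
  rw [mul_assoc C]
  refine mul_le_mul_of_nonneg_left ?_ hC0
  rw [oscPos, add_comm (x 0)]
  exact inv_one_add_sq_le _ _

/-- The mode supplies decay in `x 0` only; the factors `b` and `c` must supply it in `x 1` and `x
2`. -/
lemma integrable_pairing (H : MagL2 B q) (n p : ℤ) (P : ℂ[X]) {a b c : ℝ → ℝ} (ha : Measurable a)
    {A : ℝ} (hA : ∀ t, |a t| ≤ A) (hb : Decays b) (hc : Decays c) :
    Integrable fun x => (H : E3 →ₘ[volume] ℂ) x *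
      (conj (mode B q ϑ n p P x) * ((a (x 0) * b (x 1) * c (x 2) : ℝ) : ℂ)) := by
  obtain ⟨C, hC0, hC⟩ := exists_norm_mode_le_inv (B := B) (q := q) (ϑ := ϑ) n p P
  obtain ⟨mb, D, hD⟩ := hb
  obtain ⟨mc, E, hE⟩ := hc
  have hm : Measurable fun x : E3 => a (x 0) * b (x 1) * c (x 2) :=
    ((ha.comp (measurable_pi_apply 0)).mul (mb.comp (measurable_pi_apply 1))).mul
      (mc.comp (measurable_pi_apply 2))
  refine (MagL2.integrable_mul_of_decay H (C := C * (A * D * E)) ?_ fun x => ?_).1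
  · exact ((Complex.continuous_conj.comp
      (contDiff_mode n p P).continuous).aestronglyMeasurable).mul
      (Complex.measurable_ofReal.comp hm).aestronglyMeasurable
  · have hA0 : 0 ≤ A := (abs_nonneg _).trans (hA 0)
    rw [norm_mul, RCLike.norm_conj, Complex.norm_real, Real.norm_eq_abs, abs_mul, abs_mul]
    calc _ ≤ (C * (1 + x 0 ^ 2)⁻¹) * (A * (D * (1 + x 1 ^ 2)⁻¹) * (E * (1 + x 2 ^ 2)⁻¹)) := by
          refine mul_le_mul (hC x) ?_ (by positivity) (by positivity)
          refine mul_le_mul ?_ (hE _) (abs_nonneg _)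
            (mul_nonneg hA0 ((abs_nonneg _).trans (hD _)))
          exact mul_le_mul (hA _) (hD _) (abs_nonneg _) hA0
      _ = _ := by
          rw [decay, Fin.prod_univ_three]
          ring

/-- Products of gauge-periodic functions with complex conjugates are invariant. -/
lemma mul_conj_of_magTranslation {f f' g g' : E3 → ℂ} {v x : E3}
    (hf : magTranslation B q v f x = f' x) (hg : magTranslation B q v g x = g' x) :
    f (x + v) * conj (g (x + v)) = f' x * conj (g' x) := by
  rw [← hf, ← hg, magTranslation, magTranslation, map_mul]
  have : Complex.exp (Complex.I * ((q / 2 * (field B ⬝ᵥ crossProduct v x) : ℝ) : ℂ)) *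
      conj (Complex.exp (Complex.I * ((q / 2 * (field B ⬝ᵥ crossProduct v x) : ℝ) : ℂ))) = 1 := by
    rw [Complex.mul_conj, Complex.normSq_eq_norm_sq, mul_comm Complex.I,
      Complex.norm_exp_ofReal_mul_I]
    norm_num
  linear_combination -(f (x + v) * conj (g (x + v))) * this

lemma ae_periodic_mul_conj_mode (H : MagL2 B q) (n p : ℤ) (P : ℂ[X]) {j : Fin 3} (hj : j ≠ 0) :
    ∀ᵐ x, (H : E3 →ₘ[volume] ℂ) (x + latticeVec B j) *
      conj (mode B q ϑ n p P (x + latticeVec B j)) =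
      (H : E3 →ₘ[volume] ℂ) x * conj (mode B q ϑ n p P x) := by
  filter_upwards [H.2.2 j] with x hx
  refine mul_conj_of_magTranslation hx ?_
  fin_cases j
  · exact absurd rfl hj
  · exact magTranslation_one_mode _ _ _ _
  · exact magTranslation_two_mode _ _ _ _

/-- The product of `H` with the conjugate mode is truly periodic in `x 1`, the gauge factors
cancelling, so the two translates contribute equally. -/
lemma integral_pairing_one (H : MagL2 B q) (n p : ℤ) (P : ℂ[X]) {a θ c : ℝ → ℝ} (ha : Measurable a)
    {A : ℝ} (hA : ∀ t, |a t| ≤ A) (hθ : Decays θ) (hc : Decays c) :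
    ∫ x, (H : E3 →ₘ[volume] ℂ) x * (conj (mode B q ϑ n p P x) *
      ((a (x 0) * (θ (x 1) - θ (x 1 - latticeConst B)) * c (x 2) : ℝ) : ℂ)) = 0 := by
  have h := (integral_mul_sub_translate (B := B) (j := 1) (θ := fun t => (θ t : ℂ))
    (G := fun x => (H : E3 →ₘ[volume] ℂ) x * conj (mode B q ϑ n p P x) *
      ((a (x 0) * c (x 2) : ℝ) : ℂ)) ?_ ?_).2
  · rw [← h]
    congr 1
    ext x
    push_cast
    ring
  · filter_upwards [ae_periodic_mul_conj_mode (ϑ := ϑ) H n p P (j := 1) (by decide)] with x hx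
    rw [hx]
    simp [latticeVec]
  · refine (integrable_pairing (ϑ := ϑ) H n p P ha hA hθ hc).congr (ae_of_all _ fun x => ?_)
    push_cast
    ring

lemma integral_pairing_two (H : MagL2 B q) (n p : ℤ) (P : ℂ[X]) {a b θ : ℝ → ℝ} (ha : Measurable a)
    {A : ℝ} (hA : ∀ t, |a t| ≤ A) (hb : Decays b) (hθ : Decays θ) :
    ∫ x, (H : E3 →ₘ[volume] ℂ) x * (conj (mode B q ϑ n p P x) *
      ((a (x 0) * b (x 1) * (θ (x 2) - θ (x 2 - latticeConst B)) : ℝ) : ℂ)) = 0 := by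
  have h := (integral_mul_sub_translate (B := B) (j := 2) (θ := fun t => (θ t : ℂ))
    (G := fun x => (H : E3 →ₘ[volume] ℂ) x * conj (mode B q ϑ n p P x) *
      ((a (x 0) * b (x 1) : ℝ) : ℂ)) ?_ ?_).2
  · rw [← h]
    congr 1
    ext x
    push_cast
    ring
  · filter_upwards [ae_periodic_mul_conj_mode (ϑ := ϑ) H n p P (j := 2) (by decide)] with x hx
    rw [hx]
    simp [latticeVec]
  · refine (integrable_pairing (ϑ := ϑ) H n p P ha hA hb hθ).congr (ae_of_all _ fun x => ?_)
    push_cast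
    ring

/-- Smooth and sharp cut-offs in the periodic directions give the same pairing. -/
lemma integral_pairing_bump (H : MagL2 B q) (n p : ℤ) (P : ℂ[X]) :
    ∫ x, (H : E3 →ₘ[volume] ℂ) x * (conj (mode B q ϑ n p P x) *
      (((1 : ℝ) * cellBump (latticeConst B) (x 1) * cellBump (latticeConst B) (x 2) : ℝ) : ℂ)) =
    ∫ x, (H : E3 →ₘ[volume] ℂ) x * (conj (mode B q ϑ n p P x) *
      (((1 : ℝ) * cellInd (latticeConst B) (x 1) * cellInd (latticeConst B) (x 2) : ℝ) : ℂ)) := by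
  have hl := latticeConst_pos (B := B)
  have h1 : ∀ t : ℝ, |(fun _ => (1 : ℝ)) t| ≤ 1 := fun t => by simp
  have db := decays_cellBump hl
  have di := decays_cellInd (l := latticeConst B)
  have I := fun {b c : ℝ → ℝ} (hb : Decays b) (hc : Decays c) =>
    integrable_pairing (ϑ := ϑ) H n p P measurable_const h1 hb hc
  have a1 := integral_pairing_one (ϑ := ϑ) H n p P measurable_const h1 (decays_stepDefect hl) db
  have a2 := integral_pairing_two (ϑ := ϑ) H n p P measurable_const h1 di (decays_stepDefect hl)
  -- The bumps are exchanged for indicators one axis at a time, first in `x 1` and then in `x 2`.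
  simp only [stepDefect_sub hl] at a1 a2
  have b1 := integral_sub (I db db) (I di db)
  have b2 := integral_sub (I di db) (I di di)
  have e1 : ∀ x : E3, (H : E3 →ₘ[volume] ℂ) x * (conj (mode B q ϑ n p P x) *
      (((1 : ℝ) * (cellBump (latticeConst B) (x 1) - cellInd (latticeConst B) (x 1)) *
        cellBump (latticeConst B) (x 2) : ℝ) : ℂ)) =
      (H : E3 →ₘ[volume] ℂ) x * (conj (mode B q ϑ n p P x) * (((1 : ℝ) *
        cellBump (latticeConst B) (x 1) * cellBump (latticeConst B) (x 2) : ℝ) : ℂ)) -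
      (H : E3 →ₘ[volume] ℂ) x * (conj (mode B q ϑ n p P x) * (((1 : ℝ) *
        cellInd (latticeConst B) (x 1) * cellBump (latticeConst B) (x 2) : ℝ) : ℂ)) := by
    intro x
    push_cast
    ring
  have e2 : ∀ x : E3, (H : E3 →ₘ[volume] ℂ) x * (conj (mode B q ϑ n p P x) *
      (((1 : ℝ) * cellInd (latticeConst B) (x 1) *
        (cellBump (latticeConst B) (x 2) - cellInd (latticeConst B) (x 2)) : ℝ) : ℂ)) =
      (H : E3 →ₘ[volume] ℂ) x * (conj (mode B q ϑ n p P x) * (((1 : ℝ) *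
        cellInd (latticeConst B) (x 1) * cellBump (latticeConst B) (x 2) : ℝ) : ℂ)) -
      (H : E3 →ₘ[volume] ℂ) x * (conj (mode B q ϑ n p P x) * (((1 : ℝ) *
        cellInd (latticeConst B) (x 1) * cellInd (latticeConst B) (x 2) : ℝ) : ℂ)) := by
    intro x
    push_cast
    ring
  simp only [e1] at a1
  simp only [e2] at a2
  rw [a1] at b1
  rw [a2] at b2
  rw [sub_eq_zero.1 b1.symm, sub_eq_zero.1 b2.symm]

/-- Moving `H` by `j` cells along the first axis is the same as moving the mode index by `jq`. The
index `n` is quantified inside the induction on `j` because each step changes it. -/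
lemma ae_mul_conj_mode_shift (H : MagL2 B q) (p : ℤ) (P : ℂ[X]) (j : ℤ) :
    ∀ n : ℤ, ∀ᵐ x, (H : E3 →ₘ[volume] ℂ) (x + shift B 0 j) *
      conj (mode B q ϑ n p P (x + shift B 0 j)) =
      (H : E3 →ₘ[volume] ℂ) x * conj (mode B q ϑ (n + j * q) p P x) := by
  have step : ∀ n : ℤ, ∀ᵐ x, (H : E3 →ₘ[volume] ℂ) (x + latticeVec B 0) *
      conj (mode B q ϑ n p P (x + latticeVec B 0)) =
      (H : E3 →ₘ[volume] ℂ) x * conj (mode B q ϑ (n + q) p P x) := by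
    intro n
    filter_upwards [H.2.2 0] with x hx
    exact mul_conj_of_magTranslation hx (magTranslation_zero_mode _ _ _ _)
  have hadd : ∀ i : ℤ, shift B 0 (i + 1) = shift B 0 i + latticeVec B 0 := by
    intro i
    rw [← shift_one, shift, shift, shift, ← Pi.single_add]
    congr 1
    push_cast
    ring
  induction j using Int.induction_on with
  | zero =>
    intro n
    refine ae_of_all _ fun x => ?_
    simp [shift]
  | succ i ih =>
    intro n
    filter_upwards [ae_translate (step n) (shift B 0 i), ih (n + q)] with x h1 h2
    rw [hadd, ← add_assoc, h1, h2, show n + (q : ℤ) + (i : ℤ) * q = n + ((i : ℤ) + 1) * q by ring]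
  | pred i ih =>
    intro n
    have e : shift B 0 (-(i : ℤ)) = shift B 0 (-(i : ℤ) - 1) + latticeVec B 0 := by
      rw [← hadd]
      congr 1
      ring
    filter_upwards [ih (n - q), ae_translate (step (n - q)) (shift B 0 (-(i : ℤ) - 1))] with x h1 h2
    rw [add_assoc x, ← e, h1] at h2
    have e2 : n - q + q = n := by ring
    have e3 : n - q + -(i : ℤ) * q = n + (-(i : ℤ) - 1) * q := by ring
    rw [e2, e3] at h2
    exact h2.symm

lemma mem_cell_iff (x : E3) : x ∈ cell B ↔
    x ∈ slab B 0 ∧ x 1 ∈ Set.Ico 0 (latticeConst B) ∧ x 2 ∈ Set.Ico 0 (latticeConst B) := by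
  rw [cell_eq_slabs, Set.mem_inter_iff, Set.mem_inter_iff, and_assoc]
  rfl

lemma cellInd_of_mem {l t : ℝ} (h : t ∈ Set.Ico 0 l) : cellInd l t = 1 :=
  Set.indicator_of_mem h _

lemma cellInd_of_notMem {l t : ℝ} (h : t ∉ Set.Ico 0 l) : cellInd l t = 0 :=
  Set.indicator_of_notMem h _

lemma MagL2.inner_def (F G : MagL2 B q) : inner ℂ F G =
    ∫ x in cell B, inner ℂ ((F : E3 →ₘ[volume] ℂ) x) ((G : E3 →ₘ[volume] ℂ) x) := rfl

lemma MagL2.integrableOn_cell (H : MagL2 B q) : IntegrableOn (H : E3 →ₘ[volume] ℂ) (cell B) :=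
  (MagL2.memLp_cell H).integrable (by norm_num)

lemma MagL2.integrableOn_weight (H : MagL2 B q) (n : ℤ) :
    IntegrableOn (fun x => (1 + oscPos B q ϑ n x ^ 2) * ‖conj ((H : E3 →ₘ[volume] ℂ) x)‖)
      (cell B) := by
  have hc : Continuous fun x => 1 + oscPos B q ϑ n x ^ 2 :=
    continuous_const.add ((continuous_oscPos n).pow 2)
  obtain ⟨M, hM⟩ := (isCompact_Icc (a := (0 : E3)) (b := fun _ => latticeConst B)
    ).exists_bound_of_continuousOn hc.continuousOn
  simp only [RCLike.norm_conj]
  refine (MagL2.integrableOn_cell H).norm.bdd_mul (c := M) hc.aestronglyMeasurable ?_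
  filter_upwards [ae_restrict_mem (measurableSet_cell B)] with x hx
  exact hM x (cell_subset B hx)

lemma inner_bloch_eq_conj (H : MagL2 B q) (n p : ℤ) (P : ℂ[X]) :
    inner ℂ (bloch B q ϑ n p P) H =
      conj (∫ x in cell B, blochFun B q ϑ n p P x * conj ((H : E3 →ₘ[volume] ℂ) x)) := by
  rw [← integral_conj, MagL2.inner_def]
  refine integral_congr_ae (ae_restrict_of_ae ?_)
  filter_upwards [coeFn_bloch (B := B) (q := q) (ϑ := ϑ) n p P] with x hx
  rw [hx, RCLike.inner_apply]
  simp [mul_comm]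

/-- Unfolding of the inner product with a Bloch function. -/
lemma inner_bloch (H : MagL2 B q) (n p : ℤ) (P : ℂ[X]) :
    inner ℂ (bloch B q ϑ n p P) H = ∫ x, (H : E3 →ₘ[volume] ℂ) x * (conj (mode B q ϑ n p P x) *
      (((1 : ℝ) * cellInd (latticeConst B) (x 1) * cellInd (latticeConst B) (x 2) : ℝ) : ℂ)) := by
  have hl := latticeConst_pos (B := B)
  have di := decays_cellInd (l := latticeConst B)
  have hint := integrable_pairing (ϑ := ϑ) H n p P measurable_const
    (fun t => by simp : ∀ t : ℝ, |(fun _ => (1 : ℝ)) t| ≤ 1) di di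
  -- Two expansions are compared term by term: the strip integral cut into slabs along `x 0`, and
  -- the cell integral of the Bloch series.
  have hs := hasSum_integral_slab (B := B) 0 hint
  have hs' := hasSum_integral_mode_mul (B := B) (q := q) (ϑ := ϑ) n p P
    (Complex.continuous_conj.comp_aestronglyMeasurable (MagL2.integrableOn_cell H).1)
    (MagL2.integrableOn_weight H n)
  have e : ∀ j : ℤ, conj (∫ x in cell B, mode B q ϑ (n + j * q) p P x *
      conj ((H : E3 →ₘ[volume] ℂ) x)) = ∫ x in slab B 0,
      (H : E3 →ₘ[volume] ℂ) (x + shift B 0 j) * (conj (mode B q ϑ n p P (x + shift B 0 j)) *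
      (((1 : ℝ) * cellInd (latticeConst B) ((x + shift B 0 j) 1) *
        cellInd (latticeConst B) ((x + shift B 0 j) 2) : ℝ) : ℂ)) := by
    intro j
    rw [← integral_conj, ← integral_indicator (measurableSet_slab B 0), ← integral_indicator (measurableSet_cell B)]
    refine integral_congr_ae ?_
    filter_upwards [ae_mul_conj_mode_shift (ϑ := ϑ) H p P j n] with x hx
    by_cases h0 : x ∈ slab B 0
    · rw [Set.indicator_of_mem h0, ← mul_assoc, hx, add_shift_of_ne B (by decide),
        add_shift_of_ne B (by decide)]
      by_cases h1 : x 1 ∈ Set.Ico 0 (latticeConst B)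
      · by_cases h2 : x 2 ∈ Set.Ico 0 (latticeConst B)
        · rw [Set.indicator_of_mem ((mem_cell_iff x).2 ⟨h0, h1, h2⟩), cellInd_of_mem h1,
            cellInd_of_mem h2]
          simp [mul_comm]
        · rw [Set.indicator_of_notMem (fun h => h2 ((mem_cell_iff x).1 h).2.2), cellInd_of_notMem h2]
          simp
      · rw [Set.indicator_of_notMem (fun h => h1 ((mem_cell_iff x).1 h).2.1), cellInd_of_notMem h1]
        simp
    · rw [Set.indicator_of_notMem h0,
        Set.indicator_of_notMem (fun h => h0 ((mem_cell_iff x).1 h).1)]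
  rw [inner_bloch_eq_conj]
  have hs'' := Complex.conjCLE.toContinuousLinearMap.hasSum hs'
  refine HasSum.unique (f := fun j : ℤ => conj (∫ x in cell B, mode B q ϑ (n + j * q) p P x *
      conj ((H : E3 →ₘ[volume] ℂ) x))) hs'' ?_
  simp only [e]
  exact hs

end Pairing

/-! ### Symmetry of the momenta against Bloch functions. -/

section Symmetry

variable {B : ℝ} {q : ℕ} {ϑ : E3} [hB : Fact (0 < B)] [NeZero q]

/-- Dominated convergence, with the majorant obtained from the constant cut-off `A` in `x 0`. -/
lemma tendsto_integral_pairing (H : MagL2 B q) (n p : ℤ) (P : ℂ[X]) {a : ℕ → ℝ → ℝ} {a' b c : ℝ → ℝ}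
    (ha : ∀ N, Measurable (a N)) {A : ℝ} (hA : ∀ N t, |a N t| ≤ A)
    (hlim : ∀ t, Tendsto (fun N => a N t) atTop (𝓝 (a' t))) (hb : Decays b) (hc : Decays c) :
    Tendsto (fun N => ∫ x, (H : E3 →ₘ[volume] ℂ) x *
      (conj (mode B q ϑ n p P x) * ((a N (x 0) * b (x 1) * c (x 2) : ℝ) : ℂ))) atTop
      (𝓝 (∫ x, (H : E3 →ₘ[volume] ℂ) x *
      (conj (mode B q ϑ n p P x) * ((a' (x 0) * b (x 1) * c (x 2) : ℝ) : ℂ)))) := by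
  have hA0 : 0 ≤ A := (abs_nonneg _).trans (hA 0 0)
  have hbd := (integrable_pairing (ϑ := ϑ) H n p P (a := fun _ => A) measurable_const (A := A)
    (fun t => (abs_of_nonneg hA0).le) hb hc).norm
  refine tendsto_integral_of_dominated_convergence _ (fun N =>
    (integrable_pairing (ϑ := ϑ) H n p P (ha N) (hA N) hb hc).1) hbd (fun N => ?_) ?_
  · refine ae_of_all _ fun x => ?_
    simp only [norm_mul, Complex.norm_real, Real.norm_eq_abs, abs_of_nonneg hA0]
    gcongr
    exact hA N _
  · refine ae_of_all _ fun x => ?_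
    refine (((Complex.continuous_ofReal.tendsto _).comp
      (((hlim (x 0)).mul_const _).mul_const _)).const_mul _).const_mul _

/-- The cut-off functions that make modes into test functions. -/
def cutoff (l : ℝ) (N : ℕ) (x : E3) : ℂ :=
  ((plateau (x 0 / (N + 1)) * cellBump l (x 1) * cellBump l (x 2) : ℝ) : ℂ)

lemma contDiff_cutoff (l : ℝ) (N : ℕ) : ContDiff ℝ ∞ (cutoff l N) := by
  have h : ∀ j : Fin 3, ContDiff ℝ ∞ fun x : E3 => x j := fun j => contDiff_apply ℝ ℝ j
  exact Complex.ofRealCLM.contDiff.comp (((contDiff_plateau.comp ((h 0).div_const _)).mul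
    (contDiff_cellBump.comp (h 1))).mul (contDiff_cellBump.comp (h 2)))

lemma hasCompactSupport_cutoff {l : ℝ} (hl : 0 < l) (N : ℕ) : HasCompactSupport (cutoff l N) := by
  refine HasCompactSupport.intro (K := Set.Icc (fun _ => -(2 * l + 2 * (N + 1)))
    (fun _ => 2 * l + 2 * (N + 1))) isCompact_Icc fun x hx => ?_
  rw [cutoff]
  have hN : (0 : ℝ) < N + 1 := by positivity
  by_contra hne
  refine hx ?_
  have h0 : |x 0 / (N + 1)| ≤ 2 := not_lt.1 fun h => hne (by rw [plateau_eq_zero h]; simp)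
  have h1 : |x 1| ≤ 2 * l := not_lt.1 fun h => hne (by rw [cellBump_eq_zero hl h]; simp)
  have h2 : |x 2| ≤ 2 * l := not_lt.1 fun h => hne (by rw [cellBump_eq_zero hl h]; simp)
  rw [abs_div, abs_of_pos hN, div_le_iff₀ hN] at h0
  have key : ∀ j : Fin 3, |x j| ≤ 2 * l + 2 * (N + 1) := by
    intro j
    fin_cases j
    · exact h0.trans (by linarith)
    · exact h1.trans (by linarith)
    · exact h2.trans (by linarith)
  exact ⟨fun j => (abs_le.1 (key j)).1, fun j => (abs_le.1 (key j)).2⟩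

lemma fderiv_cutoff (l : ℝ) (N : ℕ) (x : E3) (j : Fin 3) :
    fderiv ℝ (cutoff l N) x (Pi.single j 1) =
      ((![deriv plateau (x 0 / (N + 1)) / (N + 1) * cellBump l (x 1) * cellBump l (x 2),
        plateau (x 0 / (N + 1)) * (deriv (smoothStep l) (x 1) - deriv (smoothStep l) (x 1 - l)) *
          cellBump l (x 2),
        plateau (x 0 / (N + 1)) * cellBump l (x 1) *
          (deriv (smoothStep l) (x 2) - deriv (smoothStep l) (x 2 - l))] j : ℝ) : ℂ) := by
  have hd : DifferentiableAt ℝ (cutoff l N) x :=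
    ((contDiff_cutoff l N).differentiable (by simp)) x
  rw [← hd.lineDeriv_eq_fderiv, lineDeriv]
  have hid : ∀ t : ℝ, HasDerivAt (fun s : ℝ => t + s) 1 0 := fun t => (hasDerivAt_id 0).const_add t
  refine HasDerivAt.deriv ?_
  fin_cases j
  · have e : (fun s : ℝ => cutoff l N (x + s • Pi.single 0 1)) = fun s =>
        ((plateau ((x 0 + s) / (N + 1)) * cellBump l (x 1) * cellBump l (x 2) : ℝ) : ℂ) := by
      ext s
      simp [cutoff]
    have h2 : HasDerivAt plateau (deriv plateau (x 0 / (N + 1))) ((x 0 + 0) / (N + 1)) := by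
      rw [add_zero]
      exact ((contDiff_plateau.differentiable (by simp)) _).hasDerivAt
    simp only [Fin.zero_eta]
    rw [e]
    refine ((((h2.comp (0 : ℝ) ((hid (x 0)).div_const _)).mul_const (cellBump l (x 1))).mul_const
      (cellBump l (x 2))).ofReal_comp).congr_deriv ?_
    simp [div_eq_mul_inv]
  · have e : (fun s : ℝ => cutoff l N (x + s • Pi.single 1 1)) = fun s =>
        ((plateau (x 0 / (N + 1)) * cellBump l (x 1 + s) * cellBump l (x 2) : ℝ) : ℂ) := by
      ext s
      simp [cutoff]
    have h2 : HasDerivAt (cellBump l) (deriv (smoothStep l) (x 1) - deriv (smoothStep l) (x 1 - l))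
        (x 1 + 0) := by
      rw [add_zero]
      exact hasDerivAt_cellBump _
    simp only [Fin.mk_one]
    rw [e]
    refine ((((h2.comp (0 : ℝ) (hid (x 1))).const_mul (plateau (x 0 / (N + 1)))).mul_const
      (cellBump l (x 2))).ofReal_comp).congr_deriv ?_
    simp
  · have e : (fun s : ℝ => cutoff l N (x + s • Pi.single 2 1)) = fun s =>
        ((plateau (x 0 / (N + 1)) * cellBump l (x 1) * cellBump l (x 2 + s) : ℝ) : ℂ) := by
      ext s
      simp [cutoff]
    have h2 : HasDerivAt (cellBump l) (deriv (smoothStep l) (x 2) - deriv (smoothStep l) (x 2 - l))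
        (x 2 + 0) := by
      rw [add_zero]
      exact hasDerivAt_cellBump _
    simp only [Fin.reduceFinMk]
    rw [e]
    refine (((h2.comp (0 : ℝ) (hid (x 2))).const_mul
      (plateau (x 0 / (N + 1)) * cellBump l (x 1))).ofReal_comp).congr_deriv ?_
    simp

lemma contDiff_conj_mode (n p : ℤ) (P : ℂ[X]) :
    ContDiff ℝ ∞ fun x => conj (mode B q ϑ n p P x) :=
  Complex.conjCLE.contDiff.comp (contDiff_mode n p P)

lemma isTest_conj_mode_mul_cutoff (n p : ℤ) (P : ℂ[X]) (N : ℕ) :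
    IsTest fun x => conj (mode B q ϑ n p P x) * cutoff (latticeConst B) N x :=
  ⟨(contDiff_conj_mode n p P).mul (contDiff_cutoff _ N),
    (hasCompactSupport_cutoff latticeConst_pos N).mul_left⟩

/-- Leibniz rule: conjugation turns the transposed momentum on the conjugate mode into the momentum
on the mode, and the only error term contains the derivative of the cut-off. -/
lemma momentumT_conj_mode_mul_cutoff (n p : ℤ) (P : ℂ[X]) (N : ℕ) (j : Fin 3) (x : E3) :
    momentumT B q ϑ j (fun x => conj (mode B q ϑ n p P x) * cutoff (latticeConst B) N x) x =
      conj (mode B q ϑ n p (modeMomentum B q ϑ p j P) x) * cutoff (latticeConst B) N x +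
      Complex.I * (conj (mode B q ϑ n p P x) *
        fderiv ℝ (cutoff (latticeConst B) N) x (Pi.single j 1)) := by
  have d1 : DifferentiableAt ℝ (fun x => conj (mode B q ϑ n p P x)) x :=
    ((contDiff_conj_mode n p P).differentiable (by simp)) x
  have d2 : DifferentiableAt ℝ (cutoff (latticeConst B) N) x :=
    ((contDiff_cutoff _ N).differentiable (by simp)) x
  have h1 : fderiv ℝ (fun x => conj (mode B q ϑ n p P x)) x (Pi.single j 1) =
      conj (fderiv ℝ (mode B q ϑ n p P) x (Pi.single j 1)) := by
    have := Complex.conjCLE.comp_fderiv (f := mode B q ϑ n p P) (x := x)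
    exact DFunLike.congr_fun this (Pi.single j 1)
  rw [momentumT, fderiv_fun_mul d1 d2, ← fderiv_mode]
  simp only [_root_.add_apply, _root_.smul_apply, smul_eq_mul, h1, map_add, map_mul, map_neg,
    Complex.conj_I, Complex.conj_ofReal]
  ring

lemma measurable_plateau_div (N : ℕ) : Measurable fun t : ℝ => plateau (t / (N + 1)) :=
  contDiff_plateau.continuous.measurable.comp (measurable_id.div_const _)

lemma tendsto_div_nat (t : ℝ) : Tendsto (fun N : ℕ => t / ((N : ℝ) + 1)) atTop (𝓝 0) :=
  (tendsto_const_nhds (x := t)).div_atTop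
    (tendsto_atTop_add_const_right _ _ tendsto_natCast_atTop_atTop)

/-- Along `x 0` the derivative of the plateau is `O(1/(N+1))`. Along `x 1` and `x 2` the error is
zero for every `N`, being a difference of translates. -/
lemma tendsto_integral_fderiv_cutoff (F : MagL2 B q) (n p : ℤ) (P : ℂ[X]) (j : Fin 3) :
    Tendsto (fun N => ∫ x, (F : E3 →ₘ[volume] ℂ) x * (conj (mode B q ϑ n p P x) *
      fderiv ℝ (cutoff (latticeConst B) N) x (Pi.single j 1))) atTop (𝓝 0) := by
  have hl := latticeConst_pos (B := B)
  simp only [fderiv_cutoff]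
  fin_cases j
  · obtain ⟨M, hM⟩ := exists_abs_deriv_plateau_le
    have hM0 : 0 ≤ M := (abs_nonneg _).trans (hM 0)
    have h := tendsto_integral_pairing (ϑ := ϑ) F n p P (A := M)
      (a := fun (N : ℕ) t => deriv plateau (t / (N + 1)) / (N + 1)) (a' := fun _ => 0)
      (fun N => ((contDiff_plateau.continuous_deriv (by simp)).measurable.comp
        (measurable_id.div_const _)).div_const _) (fun N t => ?_) (fun t => ?_)
      (decays_cellBump hl) (decays_cellBump hl)
    · simpa using h
    · rw [abs_div, abs_of_pos (by positivity : (0 : ℝ) < N + 1)]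
      exact (div_le_self (abs_nonneg _) (by linarith [Nat.cast_nonneg (α := ℝ) N])).trans (hM _)
    · refine squeeze_zero_norm (fun N => ?_) (tendsto_div_nat M)
      rw [Real.norm_eq_abs, abs_div, abs_of_pos (by positivity : (0 : ℝ) < N + 1)]
      exact div_le_div_of_nonneg_right (hM _) (by positivity)
  · refine tendsto_const_nhds.congr fun N => Eq.symm ?_
    exact integral_pairing_one F n p P (measurable_plateau_div N) (fun t => abs_plateau_le _)
      (decays_deriv_smoothStep hl) (decays_cellBump hl)
  · refine tendsto_const_nhds.congr fun N => Eq.symm ?_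
    exact integral_pairing_two F n p P (measurable_plateau_div N) (fun t => abs_plateau_le _)
      (decays_cellBump hl) (decays_deriv_smoothStep hl)

/-- The plateau tends to `1`, and the remaining smooth bumps may be replaced by indicators, which
give the unfolded inner product. -/
lemma tendsto_integral_cutoff (F : MagL2 B q) (n p : ℤ) (P : ℂ[X]) :
    Tendsto (fun N => ∫ x, (F : E3 →ₘ[volume] ℂ) x * (conj (mode B q ϑ n p P x) *
      cutoff (latticeConst B) N x)) atTop (𝓝 (inner ℂ (bloch B q ϑ n p P) F)) := by
  have hl := latticeConst_pos (B := B)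
  rw [inner_bloch, ← integral_pairing_bump]
  refine tendsto_integral_pairing (ϑ := ϑ) F n p P (A := 1)
    (a := fun (N : ℕ) t => plateau (t / (N + 1))) (a' := fun _ => 1)
    measurable_plateau_div (fun N t => abs_plateau_le _) (fun t => ?_)
    (decays_cellBump hl) (decays_cellBump hl)
  have h := (contDiff_plateau.continuous.tendsto 0).comp (tendsto_div_nat t)
  rwa [plateau_zero] at h

/-- The components of the momentum are symmetric on Bloch functions. -/
lemma inner_bloch_momentum {F Φ : MagL2 B q} {j : Fin 3}
    (h : IsWeakImage (momentumT B q ϑ j) F Φ) (n p : ℤ) (P : ℂ[X]) :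
    inner ℂ (bloch B q ϑ n p P) Φ = inner ℂ (bloch B q ϑ n p (modeMomentum B q ϑ p j P)) F := by
  have h1 := tendsto_integral_cutoff (ϑ := ϑ) Φ n p P
  have h2 := tendsto_integral_cutoff (ϑ := ϑ) F n p (modeMomentum B q ϑ p j P)
  have h3 := (tendsto_integral_fderiv_cutoff (ϑ := ϑ) F n p P j).const_mul Complex.I
  have h4 := h2.add h3
  rw [mul_zero, add_zero] at h4
  refine tendsto_nhds_unique (h1.congr fun N => ?_) h4
  have ht := isTest_conj_mode_mul_cutoff (B := B) (q := q) (ϑ := ϑ) n p P N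
  have ht' := isTest_conj_mode_mul_cutoff (B := B) (q := q) (ϑ := ϑ) n p
    (modeMomentum B q ϑ p j P) N
  rw [h _ ht]
  have i1 := MagL2.integrable_mul F ht'
  have i2 : Integrable fun x => (F : E3 →ₘ[volume] ℂ) x * (conj (mode B q ϑ n p P x) *
      fderiv ℝ (cutoff (latticeConst B) N) x (Pi.single j 1)) := by
    refine MagL2.integrable_mul F ⟨(contDiff_conj_mode n p P).mul ?_, ?_⟩
    · exact ((contDiff_cutoff _ N).fderiv_right (m := ∞) (by simp)).clm_apply contDiff_const
    · exact ((hasCompactSupport_cutoff latticeConst_pos N).fderiv_apply ℝ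
        (Pi.single j 1)).mul_left
  rw [← integral_const_mul, ← integral_add i1 (i2.const_mul _)]
  refine integral_congr_ae (ae_of_all _ fun x => ?_)
  simp only [momentumT_conj_mode_mul_cutoff]
  ring

end Symmetry

/-! ### Orthogonality of Bloch functions. -/

section Orthogonality

variable {B : ℝ} {q : ℕ} {ϑ : E3} [hB : Fact (0 < B)] [NeZero q]

lemma inner_bloch_modeMomentum (n n' p p' : ℤ) (P Q : ℂ[X]) (j : Fin 3) :
    inner ℂ (bloch B q ϑ n p P) (bloch B q ϑ n' p' (modeMomentum B q ϑ p' j Q)) =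
      inner ℂ (bloch B q ϑ n p (modeMomentum B q ϑ p j P)) (bloch B q ϑ n' p' Q) :=
  inner_bloch_momentum (isWeakImage_bloch n' p' Q j) n p P

/-- Bloch functions with different `p` are eigenvectors of the symmetric third momentum for
different real eigenvalues. -/
lemma inner_bloch_of_ne {p p' : ℤ} (h : p ≠ p') (n n' : ℤ) (P Q : ℂ[X]) :
    inner ℂ (bloch B q ϑ n p P) (bloch B q ϑ n' p' Q) = 0 := by
  have h1 := inner_bloch_modeMomentum (B := B) (q := q) (ϑ := ϑ) n n' p p' P Q 2
  have h2 : ∀ (p : ℤ) (P : ℂ[X]), modeMomentum B q ϑ p 2 P = ((wave B * (p + ϑ 2) : ℝ) : ℂ) • P :=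
    fun p P => rfl
  rw [h2, h2, map_smul, map_smul, inner_smul_left, inner_smul_right, Complex.conj_ofReal,
    ← sub_eq_zero, ← sub_mul, ← Complex.ofReal_sub] at h1
  refine (mul_eq_zero.1 h1).resolve_left ?_
  rw [Complex.ofReal_eq_zero, ← mul_sub, add_sub_add_right_eq_sub]
  exact mul_ne_zero wave_pos.ne' (sub_ne_zero.2 fun e => h (Int.cast_injective e).symm)

/-- The derivative and `2ωX - d/dX` are adjoint to each other. -/
lemma inner_bloch_derivative (n n' p : ℤ) (P Q : ℂ[X]) :
    inner ℂ (bloch B q ϑ n p (Polynomial.derivative P)) (bloch B q ϑ n' p Q) =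
      inner ℂ (bloch B q ϑ n p P) (bloch B q ϑ n' p
        (((2 * freq B q : ℝ) : ℂ) • (Polynomial.X * Q) - Polynomial.derivative Q)) := by
  -- On polynomials `d/dX = iΠ₀ + Π₁` and `2ωX - d/dX = -iΠ₀ + Π₁`, so the claim combines the
  -- symmetry of `Π₀` and `Π₁`.
  have h0 := inner_bloch_modeMomentum (B := B) (q := q) (ϑ := ϑ) n n' p p P Q 0
  have h1 := inner_bloch_modeMomentum (B := B) (q := q) (ϑ := ϑ) n n' p p P Q 1
  have e0 : ∀ P : ℂ[X], modeMomentum B q ϑ p 0 P = (-Complex.I) • Polynomial.derivative P +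
      (Complex.I * (freq B q : ℝ)) • (Polynomial.X * P) := fun P => rfl
  have e1 : ∀ P : ℂ[X], modeMomentum B q ϑ p 1 P = ((freq B q : ℝ) : ℂ) • (Polynomial.X * P) :=
    fun P => rfl
  rw [e0, e0] at h0
  rw [e1, e1] at h1
  simp only [map_add, map_sub, map_smul, inner_add_left, inner_add_right, inner_sub_right,
    inner_smul_left, inner_smul_right, map_neg, map_mul, Complex.conj_I, Complex.conj_ofReal]
    at h0 h1 ⊢
  push_cast
  linear_combination Complex.I * h0 - h1 + (inner ℂ (bloch B q ϑ n p (Polynomial.derivative P))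
    (bloch B q ϑ n' p Q) + inner ℂ (bloch B q ϑ n p P) (bloch B q ϑ n' p
      (Polynomial.derivative Q)) - freq B q * inner ℂ (bloch B q ϑ n p P) (bloch B q ϑ n' p
      (Polynomial.X * Q)) - freq B q * inner ℂ (bloch B q ϑ n p (Polynomial.X * P))
      (bloch B q ϑ n' p Q)) * Complex.I_mul_I

omit [NeZero q] in
lemma integral_cellInd_exp {k : ℤ} (hk : k ≠ 0) :
    ∫ t, (cellInd (latticeConst B) t : ℂ) * Complex.exp (Complex.I * (wave B * k * t : ℝ)) = 0 := by
  have hl := latticeConst_pos (B := B)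
  have hw := wave_pos (B := B)
  have e : ∀ t, (cellInd (latticeConst B) t : ℂ) * Complex.exp (Complex.I * (wave B * k * t : ℝ)) =
      (Set.Ico 0 (latticeConst B)).indicator
        (fun t => Complex.exp ((Complex.I * (wave B * k : ℝ)) * t)) t := by
    intro t
    by_cases h : t ∈ Set.Ico 0 (latticeConst B)
    · rw [Set.indicator_of_mem h, cellInd_of_mem h]
      push_cast
      ring_nf
    · rw [Set.indicator_of_notMem h, cellInd_of_notMem h]
      simp
  have hc : Complex.I * (wave B * k : ℝ) ≠ 0 := by
    refine mul_ne_zero Complex.I_ne_zero (Complex.ofReal_ne_zero.2 (mul_ne_zero hw.ne' ?_))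
    exact_mod_cast hk
  simp only [e]
  rw [integral_indicator measurableSet_Ico, integral_Ico_eq_integral_Ioc,
    ← intervalIntegral.integral_of_le hl.le, integral_exp_mul_complex hc]
  have h1 : Complex.exp (Complex.I * (wave B * k : ℝ) * (latticeConst B : ℝ)) = 1 := by
    rw [Complex.exp_eq_one_iff]
    refine ⟨k, ?_⟩
    have := congrArg Complex.ofReal (wave_mul_latticeConst (B := B))
    push_cast at this ⊢
    linear_combination (Complex.I * k) * this
  rw [h1]
  simp

/-- The coupled phase `ω x 0 x 1 / 2` is common to all modes and cancels against its conjugate; the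
integrand becomes a product of functions of single coordinates. -/
lemma integral_mode_mul_conj_mode (m n p p' : ℤ) (P Q : ℂ[X]) :
    ∫ x, mode B q ϑ m p' Q x * (conj (mode B q ϑ n p P x) *
      (((1 : ℝ) * cellInd (latticeConst B) (x 1) * cellInd (latticeConst B) (x 2) : ℝ) : ℂ)) =
    (∫ t : ℝ, mode B q ϑ m p' Q ![t, 0, 0] * conj (mode B q ϑ n p P ![t, 0, 0])) *
    (∫ t, (cellInd (latticeConst B) t : ℂ) *
      Complex.exp (Complex.I * (wave B * (m - n : ℤ) * t : ℝ))) *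
    (∫ t, (cellInd (latticeConst B) t : ℂ) *
      Complex.exp (Complex.I * (wave B * (p' - p : ℤ) * t : ℝ))) := by
  have h := integral_fintype_prod_volume_eq_prod (𝕜 := ℂ) (E := fun _ : Fin 3 => ℝ)
    ![fun t : ℝ => mode B q ϑ m p' Q ![t, 0, 0] * conj (mode B q ϑ n p P ![t, 0, 0]),
      fun t => (cellInd (latticeConst B) t : ℂ) *
        Complex.exp (Complex.I * (wave B * (m - n : ℤ) * t : ℝ)),
      fun t => (cellInd (latticeConst B) t : ℂ) *
        Complex.exp (Complex.I * (wave B * (p' - p : ℤ) * t : ℝ))]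
  rw [Fin.prod_univ_three] at h
  refine Eq.trans ?_ h
  refine integral_congr_ae (ae_of_all _ fun x => ?_)
  have key : ∀ (n p : ℤ) (P : ℂ[X]), mode B q ϑ n p P x = mode B q ϑ n p P ![x 0, 0, 0] *
      Complex.exp (Complex.I * (freq B q * x 0 * x 1 / 2 + wave B * n * x 1 +
        wave B * p * x 2 : ℝ)) := by
    intro n p P
    have e : oscPos B q ϑ n ![x 0, 0, 0] = oscPos B q ϑ n x := rfl
    rw [mode, mode, e, mul_assoc, ← Complex.exp_add]
    congr 2
    rw [modePhase, modePhase, e]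
    simp
    ring
  have key2 : Complex.exp (Complex.I * (freq B q * x 0 * x 1 / 2 + wave B * m * x 1 +
        wave B * p' * x 2 : ℝ)) * conj (Complex.exp (Complex.I * (freq B q * x 0 * x 1 / 2 +
        wave B * n * x 1 + wave B * p * x 2 : ℝ))) =
      Complex.exp (Complex.I * (wave B * (m - n : ℤ) * x 1 : ℝ)) *
      Complex.exp (Complex.I * (wave B * (p' - p : ℤ) * x 2 : ℝ)) := by
    rw [← Complex.exp_conj, ← Complex.exp_add, ← Complex.exp_add, map_mul, Complex.conj_I,
      Complex.conj_ofReal]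
    congr 1
    push_cast
    ring
  simp only [Fin.prod_univ_three]
  rw [key m p' Q, key n p P, map_mul]
  simp only [Matrix.cons_val_zero, Matrix.cons_val_one, Matrix.cons_val]
  rw [one_mul, Complex.ofReal_mul]
  linear_combination (mode B q ϑ m p' Q ![x 0, 0, 0] * conj (mode B q ϑ n p P ![x 0, 0, 0]) *
    (cellInd (latticeConst B) (x 1) : ℂ) * (cellInd (latticeConst B) (x 2) : ℂ)) * key2

lemma integrable_weight_conj_mode (n n' p : ℤ) (P : ℂ[X]) :
    Integrable fun x : E3 => (1 + oscPos B q ϑ n' x ^ 2) * ‖conj (mode B q ϑ n p P x) *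
      (((1 : ℝ) * cellInd (latticeConst B) (x 1) * cellInd (latticeConst B) (x 2) : ℝ) : ℂ)‖ := by
  obtain ⟨C, hC0, hC⟩ := exists_norm_mode_le (B := B) (q := q) (ϑ := ϑ) P 1
  have hl := latticeConst_pos (B := B)
  set s : ℝ := oscPos B q ϑ n' 0 - oscPos B q ϑ n 0 with hs
  have hos : ∀ x, oscPos B q ϑ n' x = s + oscPos B q ϑ n x := by
    intro x
    simp only [hs, oscPos, Pi.zero_apply]
    ring
  have hf : Integrable fun t : ℝ => (1 + (t + oscPos B q ϑ n 0) ^ 2)⁻¹ :=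
    integrable_inv_one_add_sq.comp_add_right _
  have hind : Integrable (cellInd (latticeConst B)) := by
    refine (integrable_indicator_iff measurableSet_Ico).2 ?_
    exact integrableOn_const (by simp)
  have hprod : Integrable fun x : E3 => (1 + oscPos B q ϑ n x ^ 2)⁻¹ *
      cellInd (latticeConst B) (x 1) * cellInd (latticeConst B) (x 2) := by
    have h := Integrable.fintype_prod (𝕜 := ℝ) (E := ℝ) (f := ![fun t : ℝ =>
      (1 + (t + oscPos B q ϑ n 0) ^ 2)⁻¹, cellInd (latticeConst B), cellInd (latticeConst B)])
      (μ := fun _ => volume) (fun i => by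
        fin_cases i
        · exact hf
        · exact hind
        · exact hind)
    refine h.congr (ae_of_all _ fun x => ?_)
    simp only [Fin.prod_univ_three]
    simp [oscPos]
  have hind0 : ∀ t, 0 ≤ cellInd (latticeConst B) t := fun t =>
    Set.indicator_nonneg (fun _ _ => zero_le_one) t
  refine (hprod.const_mul (2 * (1 + s ^ 2) * C)).mono' ?_ (ae_of_all _ fun x => ?_)
  · refine ((continuous_const.add ((continuous_oscPos n').pow 2)).aestronglyMeasurable).mul
      (AEStronglyMeasurable.norm (((contDiff_conj_mode n p P).continuous.aestronglyMeasurable).mul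
        (Measurable.aestronglyMeasurable ?_)))
    have m := (decays_cellInd (l := latticeConst B)).1
    exact Complex.measurable_ofReal.comp ((measurable_const.mul
      (m.comp (measurable_pi_apply 1))).mul (m.comp (measurable_pi_apply 2)))
  · have h1 := hC n p x
    rw [pow_one] at h1
    rw [Real.norm_of_nonneg (by positivity), norm_mul, RCLike.norm_conj, Complex.norm_real,
      Real.norm_of_nonneg (mul_nonneg (by simpa using hind0 _) (hind0 _)), hos, one_mul]
    have h2 : 1 + (s + oscPos B q ϑ n x) ^ 2 ≤ 2 * (1 + s ^ 2) * (1 + oscPos B q ϑ n x ^ 2) := by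
      nlinarith [sq_nonneg (s - oscPos B q ϑ n x), sq_nonneg (s * oscPos B q ϑ n x)]
    calc _ ≤ 2 * (1 + s ^ 2) * (1 + oscPos B q ϑ n x ^ 2) * (‖mode B q ϑ n p P x‖ *
          (cellInd (latticeConst B) (x 1) * cellInd (latticeConst B) (x 2))) :=
          mul_le_mul_of_nonneg_right h2 (mul_nonneg (norm_nonneg _)
            (mul_nonneg (hind0 _) (hind0 _)))
      _ = 2 * (1 + s ^ 2) * ((1 + oscPos B q ϑ n x ^ 2) * ‖mode B q ϑ n p P x‖) *
          (cellInd (latticeConst B) (x 1) * cellInd (latticeConst B) (x 2)) := by ring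
      _ ≤ 2 * (1 + s ^ 2) * (C * (1 + oscPos B q ϑ n x ^ 2)⁻¹) *
          (cellInd (latticeConst B) (x 1) * cellInd (latticeConst B) (x 2)) := by
          refine mul_le_mul_of_nonneg_right ?_ (mul_nonneg (hind0 _) (hind0 _))
          exact mul_le_mul_of_nonneg_left h1 (by positivity)
      _ = _ := by ring

lemma hasSum_inner_bloch (n n' p p' : ℤ) (P Q : ℂ[X]) :
    HasSum (fun j : ℤ =>
      (∫ t : ℝ, mode B q ϑ (n' + j * q) p' Q ![t, 0, 0] * conj (mode B q ϑ n p P ![t, 0, 0])) *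
      (∫ t, (cellInd (latticeConst B) t : ℂ) *
        Complex.exp (Complex.I * (wave B * (n' + j * q - n : ℤ) * t : ℝ))) *
      (∫ t, (cellInd (latticeConst B) t : ℂ) *
        Complex.exp (Complex.I * (wave B * (p' - p : ℤ) * t : ℝ))))
      (inner ℂ (bloch B q ϑ n p P) (bloch B q ϑ n' p' Q)) := by
  have hm : AEStronglyMeasurable (fun x : E3 => conj (mode B q ϑ n p P x) * (((1 : ℝ) *
      cellInd (latticeConst B) (x 1) * cellInd (latticeConst B) (x 2) : ℝ) : ℂ)) volume := by
    have m := (decays_cellInd (l := latticeConst B)).1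
    exact ((contDiff_conj_mode n p P).continuous.aestronglyMeasurable).mul
      (Complex.measurable_ofReal.comp ((measurable_const.mul
        (m.comp (measurable_pi_apply 1))).mul (m.comp (measurable_pi_apply 2)))).aestronglyMeasurable
  have h := hasSum_integral_mode_mul (B := B) (q := q) (ϑ := ϑ) n' p' Q hm
    (integrable_weight_conj_mode n n' p P)
  simp only [integral_mode_mul_conj_mode] at h
  have e : inner ℂ (bloch B q ϑ n p P) (bloch B q ϑ n' p' Q) =
      ∫ x, blochFun B q ϑ n' p' Q x * (conj (mode B q ϑ n p P x) * (((1 : ℝ) *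
      cellInd (latticeConst B) (x 1) * cellInd (latticeConst B) (x 2) : ℝ) : ℂ)) := by
    rw [inner_bloch]
    refine integral_congr_ae ?_
    filter_upwards [coeFn_bloch (B := B) (q := q) (ϑ := ϑ) n' p' Q] with x hx
    rw [hx]
  rw [e]
  exact h

/-- For classes that differ modulo `q`, every term carries a nonzero frequency in `x 1`, whose
integral over a period vanishes. -/
lemma inner_bloch_of_not_dvd {n n' : ℤ} (h : ¬ (q : ℤ) ∣ n - n') (p p' : ℤ) (P Q : ℂ[X]) :
    inner ℂ (bloch B q ϑ n p P) (bloch B q ϑ n' p' Q) = 0 := by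
  refine (hasSum_inner_bloch (B := B) (q := q) (ϑ := ϑ) n n' p p' P Q).unique ?_
  have e : ∀ j : ℤ, n' + j * q - n ≠ 0 := fun j hj => h ⟨j, by linear_combination -hj⟩
  simp only [fun j => integral_cellInd_exp (B := B) (e j), mul_zero, zero_mul]
  exact hasSum_zero

/-- Only the term `j = 0` survives, and it equals `√(π/ω) ℓ²`. -/
lemma inner_bloch_one_self_ne_zero (n p : ℤ) :
    inner ℂ (bloch B q ϑ n p 1) (bloch B q ϑ n p 1) ≠ 0 := by
  have hl := latticeConst_pos (B := B)
  have hfr := freq_pos (B := B) (q := q)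
  have hq : (q : ℤ) ≠ 0 := Nat.cast_ne_zero.2 (NeZero.ne q)
  have h := hasSum_inner_bloch (B := B) (q := q) (ϑ := ϑ) n n p p 1 1
  have h' := h.unique (hasSum_single 0 fun j hj => by
    rw [integral_cellInd_exp (show n + j * q - n ≠ 0 by
      rw [add_sub_cancel_left]; exact mul_ne_zero hj hq)]
    simp)
  rw [h']
  have hi : ∫ t, (cellInd (latticeConst B) t : ℂ) = latticeConst B := by
    rw [integral_complex_ofReal]
    simp only [cellInd]
    rw [integral_indicator measurableSet_Ico]
    simp [hl.le]
  have hg : ∀ t : ℝ, mode B q ϑ n p 1 ![t, 0, 0] * conj (mode B q ϑ n p 1 ![t, 0, 0]) =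
      ((Real.exp (-freq B q * (t + oscPos B q ϑ n 0) ^ 2) : ℝ) : ℂ) := by
    intro t
    rw [Complex.mul_conj, Complex.normSq_eq_norm_sq, norm_mode]
    have e : oscPos B q ϑ n ![t, 0, 0] = t + oscPos B q ϑ n 0 := by simp [oscPos]
    rw [e, Polynomial.eval_one, norm_one, one_mul, ← Real.exp_nat_mul]
    congr 2
    push_cast
    ring
  have hg' : ∫ t : ℝ, mode B q ϑ n p 1 ![t, 0, 0] * conj (mode B q ϑ n p 1 ![t, 0, 0]) =
      (Real.sqrt (Real.pi / freq B q) : ℝ) := by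
    simp only [hg]
    rw [integral_complex_ofReal,
      integral_add_right_eq_self (fun t => Real.exp (-freq B q * t ^ 2)), integral_gaussian]
  have hsq : Real.sqrt (Real.pi / freq B q) ≠ 0 :=
    (Real.sqrt_pos.2 (div_pos Real.pi_pos hfr)).ne'
  simp [hg', hi, hl.ne']
  exact hsq

/-! ### Hermite polynomials and the ladder. -/

/-- Rescaled Hermite polynomials. -/
def hermitePoly (B : ℝ) (q : ℕ) : ℕ → ℂ[X]
  | 0 => 1
  | k + 1 => ((2 * freq B q : ℝ) : ℂ) • (Polynomial.X * hermitePoly B q k) -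
      Polynomial.derivative (hermitePoly B q k)

omit hB [NeZero q] in
lemma derivative_hermitePoly_succ (k : ℕ) : Polynomial.derivative (hermitePoly B q (k + 1)) =
    ((2 * freq B q * (k + 1) : ℝ) : ℂ) • hermitePoly B q k := by
  induction k with
  | zero => simp [hermitePoly]
  | succ k ih =>
    have e : hermitePoly B q (k + 1) = ((2 * freq B q : ℝ) : ℂ) • (Polynomial.X * hermitePoly B q k) -
      Polynomial.derivative (hermitePoly B q k) := rfl
    have e' : hermitePoly B q (k + 2) = ((2 * freq B q : ℝ) : ℂ) •
      (Polynomial.X * hermitePoly B q (k + 1)) -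
      Polynomial.derivative (hermitePoly B q (k + 1)) := rfl
    rw [e', map_sub, Polynomial.derivative_smul, Polynomial.derivative_mul, Polynomial.derivative_X,
      one_mul, ih, Polynomial.derivative_smul, mul_smul_comm, smul_add, smul_smul]
    have e2 : Polynomial.derivative (hermitePoly B q k) = ((2 * freq B q : ℝ) : ℂ) •
      (Polynomial.X * hermitePoly B q k) - hermitePoly B q (k + 1) := by rw [e]; abel
    rw [e2, smul_sub, smul_smul]
    push_cast
    module

-- On polynomial factors, `Π₀² + Π₁²` is the Hermite operator `-d²/dX² + 2ωX d/dX + ω`; the lowering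
-- and raising relations give the eigenvalue.
omit hB [NeZero q] in
lemma momentumSq_hermitePoly (p : ℤ) (k : ℕ) :
    modeMomentum B q ϑ p 0 (modeMomentum B q ϑ p 0 (hermitePoly B q k)) +
      modeMomentum B q ϑ p 1 (modeMomentum B q ϑ p 1 (hermitePoly B q k)) =
      ((freq B q * (2 * k + 1) : ℝ) : ℂ) • hermitePoly B q k := by
  have e0 : ∀ P : ℂ[X], modeMomentum B q ϑ p 0 P = (-Complex.I) • Polynomial.derivative P +
      (Complex.I * (freq B q : ℝ)) • (Polynomial.X * P) := fun P => rfl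
  have e1 : ∀ P : ℂ[X], modeMomentum B q ϑ p 1 P = ((freq B q : ℝ) : ℂ) • (Polynomial.X * P) :=
    fun P => rfl
  have h1 : ∀ P : ℂ[X], modeMomentum B q ϑ p 0 (modeMomentum B q ϑ p 0 P) +
      modeMomentum B q ϑ p 1 (modeMomentum B q ϑ p 1 P) =
      (freq B q : ℂ) • P + ((2 * freq B q : ℝ) : ℂ) • (Polynomial.X * Polynomial.derivative P) -
        Polynomial.derivative (Polynomial.derivative P) := by
    intro P
    simp only [e0, e1, map_add, Polynomial.derivative_smul, Polynomial.derivative_mul,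
      Polynomial.derivative_X, one_mul, mul_add, mul_smul_comm, smul_add, smul_smul]
    have hI : ∀ z : ℂ, Complex.I * (z * Complex.I) = -z := fun z => by
      linear_combination z * Complex.I_mul_I
    have c1 : -Complex.I * -Complex.I = -1 := by linear_combination Complex.I_mul_I
    have c2 : -Complex.I * (Complex.I * (freq B q : ℝ)) = freq B q := by
      linear_combination (-(freq B q : ℂ)) * Complex.I_mul_I
    have c3 : Complex.I * (freq B q : ℝ) * -Complex.I = freq B q := by
      linear_combination (-(freq B q : ℂ)) * Complex.I_mul_I
    have c4 : Complex.I * (freq B q : ℝ) * (Complex.I * (freq B q : ℝ)) =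
        -((freq B q : ℂ) * freq B q) := by
      linear_combination ((freq B q : ℂ) * freq B q) * Complex.I_mul_I
    rw [c1, c2, c3, c4]
    push_cast
    module
  rw [h1]
  cases k with
  | zero => simp [hermitePoly]
  | succ k =>
    have e : hermitePoly B q (k + 1) = ((2 * freq B q : ℝ) : ℂ) • (Polynomial.X * hermitePoly B q k) -
      Polynomial.derivative (hermitePoly B q k) := rfl
    rw [derivative_hermitePoly_succ, Polynomial.derivative_smul, mul_smul_comm]
    have e2 : Polynomial.derivative (hermitePoly B q k) = ((2 * freq B q : ℝ) : ℂ) •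
      (Polynomial.X * hermitePoly B q k) - hermitePoly B q (k + 1) := by rw [e]; abel
    rw [e2]
    push_cast
    module

lemma inner_hermite_succ (n p : ℤ) (k : ℕ) (Q : ℂ[X]) :
    inner ℂ (bloch B q ϑ n p Q) (bloch B q ϑ n p (hermitePoly B q (k + 1))) =
      inner ℂ (bloch B q ϑ n p (Polynomial.derivative Q)) (bloch B q ϑ n p (hermitePoly B q k)) :=
  (inner_bloch_derivative n n p Q (hermitePoly B q k)).symm

lemma inner_hermite_succ_succ (n p : ℤ) (k l : ℕ) :
    inner ℂ (bloch B q ϑ n p (hermitePoly B q (l + 1)))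
      (bloch B q ϑ n p (hermitePoly B q (k + 1))) =
      ((2 * freq B q * (l + 1) : ℝ) : ℂ) * inner ℂ (bloch B q ϑ n p (hermitePoly B q l))
        (bloch B q ϑ n p (hermitePoly B q k)) := by
  rw [inner_hermite_succ, derivative_hermitePoly_succ, map_smul, inner_smul_left,
    Complex.conj_ofReal]

/-- Both degrees are lowered together until one of them is zero; there the raising operator is moved
to the other side, where it differentiates a constant. -/
lemma inner_hermite_of_ne (n p : ℤ) {k l : ℕ} (h : l ≠ k) :
    inner ℂ (bloch B q ϑ n p (hermitePoly B q l)) (bloch B q ϑ n p (hermitePoly B q k)) = 0 := by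
  have h0 : ∀ k, inner ℂ (bloch B q ϑ n p (hermitePoly B q 0))
      (bloch B q ϑ n p (hermitePoly B q (k + 1))) = 0 := by
    intro k
    rw [inner_hermite_succ]
    simp [hermitePoly]
  induction l generalizing k with
  | zero =>
    obtain ⟨k, rfl⟩ := Nat.exists_eq_succ_of_ne_zero h.symm
    exact h0 k
  | succ l ih =>
    cases k with
    | zero => rw [← inner_conj_symm, h0, map_zero]
    | succ k => rw [inner_hermite_succ_succ, ih fun e => h (by rw [e]), mul_zero]

lemma bloch_hermite_ne_zero (n p : ℤ) (k : ℕ) : bloch B q ϑ n p (hermitePoly B q k) ≠ 0 := by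
  have hfr := freq_pos (B := B) (q := q)
  have h : inner ℂ (bloch B q ϑ n p (hermitePoly B q k)) (bloch B q ϑ n p (hermitePoly B q k)) ≠ 0 := by
    induction k with
    | zero => exact inner_bloch_one_self_ne_zero n p
    | succ k ih =>
      rw [inner_hermite_succ_succ]
      refine mul_ne_zero (Complex.ofReal_ne_zero.2 (by positivity)) ih
  exact fun h0 => h (by rw [h0, inner_zero_left])

-- The span is stable under multiplication by `X`, because `2ωX H_k = H_{k+1} + H_k'` and `H_k'` is
-- a multiple of `H_{k-1}`.
omit hB in
lemma span_hermitePoly [Fact (0 < B)] :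
    Submodule.span ℂ (Set.range (hermitePoly B q)) = ⊤ := by
  have hfr := freq_pos (B := B) (q := q)
  set S := Submodule.span ℂ (Set.range (hermitePoly B q))
  have hm : ∀ k, hermitePoly B q k ∈ S := fun k => Submodule.subset_span ⟨k, rfl⟩
  have hd : ∀ k, Polynomial.derivative (hermitePoly B q k) ∈ S := by
    intro k
    cases k with
    | zero => simp [hermitePoly]
    | succ k =>
      rw [derivative_hermitePoly_succ]
      exact S.smul_mem _ (hm k)
  have hX : ∀ P ∈ S, Polynomial.X * P ∈ S := by
    intro P hP
    induction hP using Submodule.span_induction with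
    | mem P hP =>
      obtain ⟨k, rfl⟩ := hP
      have e : hermitePoly B q (k + 1) + Polynomial.derivative (hermitePoly B q k) =
        ((2 * freq B q : ℝ) : ℂ) • (Polynomial.X * hermitePoly B q k) := by
        rw [hermitePoly]; abel
      have := S.add_mem (hm (k + 1)) (hd k)
      rw [e] at this
      exact (S.smul_mem_iff (Complex.ofReal_ne_zero.2 (by positivity))).1 this
    | zero => simp
    | add x y _ _ hx hy => rw [mul_add]; exact S.add_mem hx hy
    | smul c x _ hx => rw [mul_smul_comm]; exact S.smul_mem c hx
  rw [eq_top_iff]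
  rintro P -
  induction P using Polynomial.induction_on' with
  | add p r hp hr => exact S.add_mem hp hr
  | monomial n c =>
    rw [← Polynomial.C_mul_X_pow_eq_monomial, ← Polynomial.smul_eq_C_mul]
    refine S.smul_mem c ?_
    induction n with
    | zero => exact hm 0
    | succ n ih =>
      rw [pow_succ']
      exact hX _ ih

end Orthogonality

/-! ### Density of the span of the Bloch functions. -/

section Completeness

variable {B : ℝ} {q : ℕ} {ϑ : E3} [hB : Fact (0 < B)] [NeZero q]

/-- The Gaussian factor of the modes, cut off to one period in the periodic directions. -/
def gaussCell (B : ℝ) (q : ℕ) (ϑ : E3) (n p : ℤ) (x : E3) : ℂ :=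
  conj (mode B q ϑ n p 1 x) *
    (((1 : ℝ) * cellInd (latticeConst B) (x 1) * cellInd (latticeConst B) (x 2) : ℝ) : ℂ)

lemma aestronglyMeasurable_gaussCell (n p : ℤ) :
    AEStronglyMeasurable (gaussCell B q ϑ n p) volume := by
  have m := (decays_cellInd (l := latticeConst B)).1
  exact ((contDiff_conj_mode n p 1).continuous.aestronglyMeasurable).mul
    (Complex.measurable_ofReal.comp ((measurable_const.mul
      (m.comp (measurable_pi_apply 1))).mul (m.comp (measurable_pi_apply 2)))).aestronglyMeasurable

/-- Half of the Gaussian exponent absorbs any exponential, by completing the square. -/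
lemma exp_mul_abs_sub_le {a r t : ℝ} (ha : 0 < a) :
    Real.exp (r * |t|) * Real.exp (-(a / 2 * t ^ 2)) ≤
      Real.exp (r ^ 2 / a) * Real.exp (-(a / 4 * t ^ 2)) := by
  rw [← Real.exp_add, ← Real.exp_add]
  refine Real.exp_le_exp.2 ?_
  have h : r * |t| ≤ r ^ 2 / a + a / 4 * t ^ 2 := by
    rw [← sq_abs t, ← sub_nonneg]
    have : r ^ 2 / a + a / 4 * |t| ^ 2 - r * |t| = (r - a / 2 * |t|) ^ 2 / a := by
      field_simp
      ring
    rw [this]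
    positivity
  linarith

/-- Supplies the majorant for expanding `exp(z y)` into its power series under the integral. -/
lemma integrable_mul_gaussCell_mul_exp (F : MagL2 B q) (n p : ℤ) (r : ℝ) :
    Integrable fun x => (F : E3 →ₘ[volume] ℂ) x *
      (gaussCell B q ϑ n p x * (Real.exp (r * |oscPos B q ϑ n x|) : ℂ)) := by
  have hfr := freq_pos (B := B) (q := q)
  have hl := latticeConst_pos (B := B)
  obtain ⟨C, hC0, hC⟩ := exists_norm_eval_mul_exp_le_inv (1 : ℂ[X])
    (show 0 < freq B q / 4 by positivity) 0
  obtain ⟨-, D, hD⟩ := decays_cellInd (l := latticeConst B)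
  set s := n * latticeConst B / q + wave B * ϑ 1 / freq B q with hs
  refine (MagL2.integrable_mul_of_decay F
    (C := Real.exp (r ^ 2 / freq B q) * C * (2 * (1 + s ^ 2)) * (D * D)) ?_ fun x => ?_).1
  · refine (aestronglyMeasurable_gaussCell n p).mul (Continuous.aestronglyMeasurable ?_)
    have := continuous_oscPos (B := B) (q := q) (ϑ := ϑ) n
    fun_prop
  · have h1 := exp_mul_abs_sub_le (r := r) (t := oscPos B q ϑ n x) hfr
    have h2 := hC (oscPos B q ϑ n x)
    rw [pow_zero, one_mul, Polynomial.eval_one, norm_one, one_mul] at h2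
    have h3 : (1 + oscPos B q ϑ n x ^ 2)⁻¹ ≤ 2 * (1 + s ^ 2) * (1 + x 0 ^ 2)⁻¹ := by
      rw [oscPos, ← hs, add_comm (x 0)]
      exact inv_one_add_sq_le _ _
    have h4 : Real.exp (r * |oscPos B q ϑ n x|) *
        Real.exp (-(freq B q / 2 * oscPos B q ϑ n x ^ 2)) ≤
        Real.exp (r ^ 2 / freq B q) * (C * (2 * (1 + s ^ 2) * (1 + x 0 ^ 2)⁻¹)) :=
      h1.trans (mul_le_mul_of_nonneg_left (h2.trans (mul_le_mul_of_nonneg_left h3 hC0))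
        (Real.exp_pos _).le)
    have h5 : |cellInd (latticeConst B) (x 1) * cellInd (latticeConst B) (x 2)| ≤
        (D * (1 + x 1 ^ 2)⁻¹) * (D * (1 + x 2 ^ 2)⁻¹) := by
      rw [abs_mul]
      exact mul_le_mul (hD _) (hD _) (abs_nonneg _) ((abs_nonneg _).trans (hD _))
    rw [gaussCell, norm_mul, norm_mul, RCLike.norm_conj, norm_mode, Polynomial.eval_one, norm_one,
      one_mul, one_mul, Complex.norm_real, Complex.norm_real, Real.norm_eq_abs,
      Real.norm_of_nonneg (Real.exp_pos _).le]
    calc _ = (Real.exp (r * |oscPos B q ϑ n x|) *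
          Real.exp (-(freq B q / 2 * oscPos B q ϑ n x ^ 2))) *
          |cellInd (latticeConst B) (x 1) * cellInd (latticeConst B) (x 2)| := by ring
      _ ≤ (Real.exp (r ^ 2 / freq B q) * (C * (2 * (1 + s ^ 2) * (1 + x 0 ^ 2)⁻¹))) *
          ((D * (1 + x 1 ^ 2)⁻¹) * (D * (1 + x 2 ^ 2)⁻¹)) :=
          mul_le_mul h4 h5 (abs_nonneg _) (by positivity)
      _ = _ := by
          rw [decay, Fin.prod_univ_three]
          ring

/-- A function whose moments against a Gaussian vanish has vanishing Laplace transform. -/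
lemma integral_gaussCell_mul_exp_eq_zero {F : MagL2 B q} {n p : ℤ}
    (h : ∀ P : ℂ[X], inner ℂ (bloch B q ϑ n p P) F = 0) (z : ℂ) :
    ∫ x, (F : E3 →ₘ[volume] ℂ) x * (gaussCell B q ϑ n p x *
      Complex.exp (z * oscPos B q ϑ n x)) = 0 := by
  have hmom : ∀ k : ℕ, ∫ x, (F : E3 →ₘ[volume] ℂ) x * (gaussCell B q ϑ n p x *
      ((z * oscPos B q ϑ n x) ^ k / (k.factorial : ℂ))) = 0 := by
    intro k
    have h1 := h (Polynomial.X ^ k)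
    rw [inner_bloch] at h1
    have e : ∀ x, (F : E3 →ₘ[volume] ℂ) x * (gaussCell B q ϑ n p x *
        ((z * oscPos B q ϑ n x) ^ k / (k.factorial : ℂ))) = (z ^ k / (k.factorial : ℂ)) *
        ((F : E3 →ₘ[volume] ℂ) x * (conj (mode B q ϑ n p (Polynomial.X ^ k) x) *
        (((1 : ℝ) * cellInd (latticeConst B) (x 1) * cellInd (latticeConst B) (x 2) : ℝ) : ℂ))) := by
      intro x
      rw [gaussCell, mode, mode, Polynomial.eval_pow, Polynomial.eval_X, Polynomial.eval_one, one_mul,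
        map_mul, map_pow, Complex.conj_ofReal, mul_pow]
      ring
    simp only [e]
    rw [integral_const_mul, h1, mul_zero]
  have hint := (integrable_mul_gaussCell_mul_exp (ϑ := ϑ) F n p ‖z‖).norm
  have hexp : ∀ r : ℝ, HasSum (fun k : ℕ => r ^ k / (k.factorial : ℝ)) (Real.exp r) := fun r => by
    have := NormedSpace.expSeries_div_hasSum_exp r
    rwa [← Real.exp_eq_exp_ℝ] at this
  have hexpc : ∀ w : ℂ, HasSum (fun k : ℕ => w ^ k / (k.factorial : ℂ)) (Complex.exp w) := fun w => by
    have := NormedSpace.expSeries_div_hasSum_exp w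
    rwa [← Complex.exp_eq_exp_ℂ] at this
  have hsum := hasSum_integral_of_dominated_convergence (μ := (volume : Measure E3))
    (F := fun (k : ℕ) x => (F : E3 →ₘ[volume] ℂ) x * (gaussCell B q ϑ n p x *
      ((z * oscPos B q ϑ n x) ^ k / (k.factorial : ℂ))))
    (f := fun x => (F : E3 →ₘ[volume] ℂ) x * (gaussCell B q ϑ n p x *
      Complex.exp (z * oscPos B q ϑ n x)))
    (fun k x => ‖(F : E3 →ₘ[volume] ℂ) x * gaussCell B q ϑ n p x‖ *
      ((‖z‖ * |oscPos B q ϑ n x|) ^ k / (k.factorial : ℝ))) (fun k => ?_) (fun k => ?_) ?_ ?_ ?_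
  · simp only [hmom] at hsum
    exact hsum.unique hasSum_zero
  · refine (F : E3 →ₘ[volume] ℂ).aestronglyMeasurable.mul
      ((aestronglyMeasurable_gaussCell n p).mul (Continuous.aestronglyMeasurable ?_))
    have := continuous_oscPos (B := B) (q := q) (ϑ := ϑ) n
    fun_prop
  · refine ae_of_all _ fun x => le_of_eq ?_
    simp only [norm_mul, norm_div, norm_pow, Complex.norm_real, Real.norm_eq_abs,
      Complex.norm_natCast]
    ring
  · exact ae_of_all _ fun x => (hexp _).summable.mul_left _
  · refine hint.congr (ae_of_all _ fun x => ?_)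
    simp only
    rw [tsum_mul_left, (hexp _).tsum_eq, ← mul_assoc, norm_mul _ ((_ : ℝ) : ℂ), Complex.norm_real,
      Real.norm_of_nonneg (Real.exp_pos _).le]
  · exact ae_of_all _ fun x => ((hexpc _).mul_left _).mul_left _

/-- The sides of the strip `ℝ × [0,ℓ)²`. -/
def stripSide (B : ℝ) : Fin 3 → Set ℝ :=
  ![Set.univ, Set.Ico 0 (latticeConst B), Set.Ico 0 (latticeConst B)]

/-- The characters that separate integrable functions on the strip. -/
def stripChar (B : ℝ) (i : Fin 3) (a : ℚ × ℤ) (t : ℝ) : ℂ :=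
  ![Complex.exp (Complex.I * (a.1 * t : ℝ)), Complex.exp (Complex.I * (wave B * a.2 * t : ℝ)),
    Complex.exp (Complex.I * (wave B * a.2 * t : ℝ))] i

-- One index type `ℚ × ℤ` serves all three coordinates: the line uses the rational component, the
-- two periodic directions the integer one.
omit [NeZero q] in
lemma separates_stripChar : Separates ((volume : Measure E3).restrict (Set.univ.pi (stripSide B)))
    (fun (a : Fin 3 → ℚ × ℤ) x => ∏ i, stripChar B i (a i) (x i)) := by
  have hl := latticeConst_pos (B := B)
  have hw : wave B = 2 * Real.pi / latticeConst B := by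
    rw [eq_div_iff hl.ne', wave_mul_latticeConst]
  have hc : Separates ((volume : Measure ℝ).restrict (Set.Ico 0 (latticeConst B)))
      (fun (a : ℚ × ℤ) t => Complex.exp (Complex.I * (wave B * a.2 * t : ℝ))) := by
    intro f hf h
    refine separates_circle hl f hf fun n => ?_
    have := h (0, n)
    simpa only [hw] using this
  rw [volume_pi, Measure.restrict_pi_pi]
  refine Separates.pi (fun i => (volume : Measure ℝ).restrict (stripSide B i)) (stripChar B) ?_ ?_ ?_
  · intro i
    fin_cases i
    · intro f hf h
      rw [show (volume : Measure ℝ).restrict (stripSide B ((fun i => i) ⟨0, by decide⟩)) = volume from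
        Measure.restrict_univ] at hf h ⊢
      exact separates_fourier f hf fun τ => h (τ, 0)
    · exact hc
    · exact hc
  · intro i a
    have h1 : ∀ r : ℝ, Measurable fun t : ℝ => Complex.exp (Complex.I * (r * t : ℝ)) := fun r =>
      Continuous.measurable (by fun_prop)
    fin_cases i
    · exact h1 a.1
    · exact h1 (wave B * a.2)
    · exact h1 (wave B * a.2)
  · intro i a t
    have h1 : ∀ r : ℝ, ‖Complex.exp (Complex.I * (r : ℂ))‖ ≤ 1 := fun r => by
      rw [mul_comm, Complex.norm_exp_ofReal_mul_I]
    fin_cases i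
    · exact h1 _
    · exact h1 _
    · exact h1 _

/-- The Bloch functions span a dense subspace. -/
lemma eq_zero_of_inner_bloch {F : MagL2 B q}
    (h : ∀ (n p : ℤ) (P : ℂ[X]), inner ℂ (bloch B q ϑ n p P) F = 0) : F = 0 := by
  have hl := latticeConst_pos (B := B)
  have hfr := freq_pos (B := B) (q := q)
  have hm : MeasurableSet (Set.univ.pi (stripSide B)) := by
    refine MeasurableSet.univ_pi fun i => ?_
    fin_cases i
    · exact MeasurableSet.univ
    · exact measurableSet_Ico
    · exact measurableSet_Ico
  set g : E3 → ℂ := fun x => (F : E3 →ₘ[volume] ℂ) x *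
    Complex.exp ((-(freq B q / 2 * x 0 ^ 2) : ℝ) + Complex.I * (-(freq B q * x 0 * x 1 / 2) : ℝ))
    with hg
  have hmem : ∀ x : E3, x ∈ Set.univ.pi (stripSide B) ↔
      x 1 ∈ Set.Ico 0 (latticeConst B) ∧ x 2 ∈ Set.Ico 0 (latticeConst B) := by
    intro x
    simp [Set.mem_pi, Fin.forall_fin_succ, stripSide]
  -- The exponent of the Laplace transform is chosen so that its real part recentres the Gaussian at
  -- `x 0 = 0`, independently of `n`, and its imaginary part removes `ϑ 0` and inserts the frequency
  -- `τ`. Completing the square leaves the constant `c`.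
  have key : ∀ (τ : ℝ) (n p : ℤ), ∃ c : ℂ, c ≠ 0 ∧ ∀ x : E3,
      (F : E3 →ₘ[volume] ℂ) x * (gaussCell B q ϑ n p x * Complex.exp
        (((freq B q * (n * latticeConst B / q + wave B * ϑ 1 / freq B q) : ℝ) + Complex.I *
          (τ - wave B * ϑ 0 : ℝ)) * oscPos B q ϑ n x)) =
      c * (Set.univ.pi (stripSide B)).indicator (fun x => g x * (Complex.exp (Complex.I *
        (τ * x 0 : ℝ)) * Complex.exp (Complex.I * (wave B * (-n : ℤ) * x 1 : ℝ)) *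
        Complex.exp (Complex.I * (wave B * (-p : ℤ) * x 2 : ℝ)))) x := by
    intro τ n p
    set s := n * latticeConst B / q + wave B * ϑ 1 / freq B q with hs
    refine ⟨Complex.exp ((freq B q / 2 * s ^ 2 : ℝ) + Complex.I * (τ * s : ℝ)),
      Complex.exp_ne_zero _, fun x => ?_⟩
    by_cases hx : x ∈ Set.univ.pi (stripSide B)
    · rw [Set.indicator_of_mem hx]
      obtain ⟨h1, h2⟩ := (hmem x).1 hx
      rw [gaussCell, cellInd_of_mem h1, cellInd_of_mem h2, mode, Polynomial.eval_one, one_mul,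
        ← Complex.exp_conj, hg]
      simp only
      have e : Complex.exp (conj (((-(freq B q / 2 * oscPos B q ϑ n x ^ 2) : ℝ) : ℂ) +
          Complex.I * (modePhase B q ϑ n p x : ℝ))) * Complex.exp
          (((freq B q * s : ℝ) + Complex.I * (τ - wave B * ϑ 0 : ℝ)) * oscPos B q ϑ n x) =
          Complex.exp ((freq B q / 2 * s ^ 2 : ℝ) + Complex.I * (τ * s : ℝ)) *
          (Complex.exp ((-(freq B q / 2 * x 0 ^ 2) : ℝ) +
            Complex.I * (-(freq B q * x 0 * x 1 / 2) : ℝ)) * (Complex.exp (Complex.I *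
          (τ * x 0 : ℝ)) * Complex.exp (Complex.I * (wave B * (-n : ℤ) * x 1 : ℝ)) *
          Complex.exp (Complex.I * (wave B * (-p : ℤ) * x 2 : ℝ)))) := by
        rw [← Complex.exp_add, ← Complex.exp_add, ← Complex.exp_add, ← Complex.exp_add,
          ← Complex.exp_add, map_add, map_mul, Complex.conj_ofReal, Complex.conj_ofReal,
          Complex.conj_I, modePhase, show oscPos B q ϑ n x = x 0 + s from rfl]
        congr 1
        push_cast
        ring
      push_cast at e ⊢
      linear_combination ((F : E3 →ₘ[volume] ℂ) x) * e
    · rw [Set.indicator_of_notMem hx, mul_zero, gaussCell]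
      by_cases h1 : x 1 ∈ Set.Ico 0 (latticeConst B)
      · rw [cellInd_of_notMem fun h2 => hx ((hmem x).2 ⟨h1, h2⟩)]
        simp
      · rw [cellInd_of_notMem h1]
        simp
  -- Up to the nonzero constant `c`, the function `g` is the integrand for `τ = n = p = 0`.
  have hgi : IntegrableOn g (Set.univ.pi (stripSide B)) := by
    obtain ⟨c, hc, hcx⟩ := key 0 0 0
    have hF := integrable_mul_gaussCell_mul_exp (ϑ := ϑ) F 0 0
      ‖((freq B q * (((0 : ℤ) : ℝ) * latticeConst B / q + wave B * ϑ 1 / freq B q) : ℝ) : ℂ) +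
        Complex.I * ((0 - wave B * ϑ 0 : ℝ) : ℂ)‖
    have h2 : Integrable fun x => (F : E3 →ₘ[volume] ℂ) x * (gaussCell B q ϑ 0 0 x * Complex.exp
        (((freq B q * (((0 : ℤ) : ℝ) * latticeConst B / q + wave B * ϑ 1 / freq B q) : ℝ) +
          Complex.I * (0 - wave B * ϑ 0 : ℝ)) * oscPos B q ϑ 0 x)) := by
      refine hF.mono ?_ (ae_of_all _ fun x => ?_)
      · refine (F : E3 →ₘ[volume] ℂ).aestronglyMeasurable.mul
          ((aestronglyMeasurable_gaussCell 0 0).mul (Continuous.aestronglyMeasurable ?_))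
        have := continuous_oscPos (B := B) (q := q) (ϑ := ϑ) 0
        fun_prop
      · rw [norm_mul, norm_mul, norm_mul, norm_mul, Complex.norm_real,
          Real.norm_of_nonneg (Real.exp_pos _).le]
        refine mul_le_mul_of_nonneg_left (mul_le_mul_of_nonneg_left ?_ (norm_nonneg _))
          (norm_nonneg _)
        rw [Complex.norm_exp]
        refine Real.exp_le_exp.2 ((Complex.re_le_norm _).trans_eq ?_)
        rw [norm_mul, Complex.norm_real, Real.norm_eq_abs]
    simp only [hcx] at h2
    have h3 := h2.const_mul c⁻¹
    simp only [inv_mul_cancel_left₀ hc] at h3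
    refine (integrable_indicator_iff hm).1 (h3.congr (ae_of_all _ fun x => ?_))
    simp
  have hz : g =ᵐ[volume.restrict (Set.univ.pi (stripSide B))] 0 := by
    refine separates_stripChar g hgi fun a => ?_
    obtain ⟨c, hc, hcx⟩ := key (a 0).1 (-(a 1).2) (-(a 2).2)
    have h1 := integral_gaussCell_mul_exp_eq_zero (h (-(a 1).2) (-(a 2).2))
      (((freq B q * ((-(a 1).2 : ℤ) * latticeConst B / q + wave B * ϑ 1 / freq B q) : ℝ) +
        Complex.I * ((a 0).1 - wave B * ϑ 0 : ℝ)))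
    simp only [hcx] at h1
    rw [integral_const_mul, integral_indicator hm] at h1
    have h2 := (mul_eq_zero.1 h1).resolve_left hc
    rw [← h2]
    refine integral_congr_ae (ae_of_all _ fun x => ?_)
    simp [Fin.prod_univ_three, stripChar]
  have hF : ∀ᵐ x, x ∈ cell B → (F : E3 →ₘ[volume] ℂ) x = 0 := by
    filter_upwards [(ae_restrict_iff' hm).1 hz] with x hx hxc
    have h1 := hx ((hmem x).2 ((mem_cell_iff x).1 hxc).2)
    exact (mul_eq_zero.1 h1).resolve_right (Complex.exp_ne_zero _)
  apply Subtype.ext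
  apply AEEqFun.ext
  filter_upwards [F.2.2.eq_zero hF, AEEqFun.coeFn_zero (α := E3) (β := ℂ) (μ := volume)] with x h1 h2
  rw [h1]
  exact h2.symm

end Completeness

/-! ### Gauge-periodic extension from the cell, and completeness of the Hilbert space. -/

variable {B : ℝ} {q : ℕ}

/-- The index of the translate of the fundamental cell which contains a point. -/
def cellIndex (B : ℝ) (x : E3) (j : Fin 3) : ℤ := ⌊x j / latticeConst B⌋

/-- The representative of a point in the fundamental cell. -/
def cellRep (B : ℝ) (x : E3) (j : Fin 3) : ℝ := x j - cellIndex B x j * latticeConst B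

/-- The gauge-periodic extension of a function on the fundamental cell. -/
def gaugeExtension (B : ℝ) (q : ℕ) (f : E3 → ℂ) (x : E3) : ℂ :=
  Complex.exp (Complex.I * ((freq B q * x 0 * x 1 / 2
    - freq B q * latticeConst B * cellIndex B x 0 * x 1
    - freq B q * cellRep B x 0 * cellRep B x 1 / 2 : ℝ) : ℂ)) * f (cellRep B x)

lemma norm_gaugeExtension (f : E3 → ℂ) (x : E3) :
    ‖gaugeExtension B q f x‖ = ‖f (cellRep B x)‖ := by
  rw [gaugeExtension, norm_mul, mul_comm Complex.I, Complex.norm_exp_ofReal_mul_I, one_mul]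

lemma measurable_cellIndex (j : Fin 3) : Measurable fun x : E3 => cellIndex B x j :=
  Int.measurable_floor.comp ((measurable_pi_apply j).div_const _)

lemma measurable_cellRep : Measurable (cellRep B) :=
  measurable_pi_lambda _ fun j => (measurable_pi_apply j).sub
    (((measurable_from_top (f := fun n : ℤ => (n : ℝ))).comp (measurable_cellIndex j)).mul_const _)

lemma measurable_gaugeExtension {f : E3 → ℂ} (hf : Measurable f) :
    Measurable (gaugeExtension B q f) := by
  have h1 : ∀ j : Fin 3, Measurable fun x : E3 => cellRep B x j := fun j =>
    (measurable_pi_apply j).comp measurable_cellRep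
  have h2 : Measurable fun x : E3 => ((cellIndex B x 0 : ℤ) : ℝ) :=
    (measurable_from_top (f := fun n : ℤ => (n : ℝ))).comp (measurable_cellIndex 0)
  have h3 : ∀ j : Fin 3, Measurable fun x : E3 => x j := measurable_pi_apply
  refine Measurable.mul (Complex.measurable_exp.comp (measurable_const.mul
    (Complex.measurable_ofReal.comp ?_))) (hf.comp measurable_cellRep)
  exact (((((h3 0).const_mul _).mul (h3 1)).div_const 2).sub ((h2.const_mul _).mul (h3 1))).sub
    ((((h1 0).const_mul _).mul (h1 1)).div_const 2)

variable [hB : Fact (0 < B)]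

lemma cellIndex_add_latticeVec (x : E3) (i j : Fin 3) :
    cellIndex B (x + latticeVec B j) i = cellIndex B x i + if i = j then 1 else 0 := by
  have hl := latticeConst_pos (B := B)
  by_cases h : i = j
  · subst h
    simp [cellIndex, latticeVec, add_div, div_self hl.ne']
  · simp [cellIndex, latticeVec, h]

lemma cellRep_add_latticeVec (x : E3) (j : Fin 3) :
    cellRep B (x + latticeVec B j) = cellRep B x := by
  ext i
  rw [cellRep, cellRep, cellIndex_add_latticeVec]
  by_cases h : i = j
  · subst h
    simp only [Pi.add_apply, latticeVec, Pi.single_eq_same, if_true, Int.cast_add, Int.cast_one]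
    ring
  · simp [latticeVec, h]

lemma cellRep_of_mem {x : E3} (hx : x ∈ cell B) : cellRep B x = x := by
  have hl := latticeConst_pos (B := B)
  ext j
  have h : cellIndex B x j = 0 := by
    rw [cellIndex, Int.floor_eq_zero_iff]
    exact ⟨div_nonneg (hx j trivial).1 hl.le, (div_lt_one hl).2 (hx j trivial).2⟩
  simp [cellRep, h]

lemma gaugeExtension_of_mem (f : E3 → ℂ) {x : E3} (hx : x ∈ cell B) :
    gaugeExtension B q f x = f x := by
  have hl := latticeConst_pos (B := B)
  have h : cellIndex B x 0 = 0 := by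
    rw [cellIndex, Int.floor_eq_zero_iff]
    exact ⟨div_nonneg (hx 0 trivial).1 hl.le, (div_lt_one hl).2 (hx 0 trivial).2⟩
  rw [gaugeExtension, cellRep_of_mem hx, h]
  simp

/-- The phase of the extension equals that of a product of lattice translations moving the point
into the cell, up to multiples of `2π`; consistency rests on `ωℓ² = 2πq`. -/
lemma isGaugePeriodic_gaugeExtension (f : E3 → ℂ) :
    IsGaugePeriodic B q (gaugeExtension B q f) := by
  have hw : freq B q * latticeConst B * latticeConst B = 2 * Real.pi * q := by
    rw [wave_mul_natCast, mul_right_comm, wave_mul_latticeConst]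
  intro j
  refine ae_of_all _ fun x => ?_
  rw [magTranslation, gaugeExtension, gaugeExtension, cellRep_add_latticeVec, ← mul_assoc,
    ← Complex.exp_add]
  congr 1
  rw [← mul_add, ← Complex.ofReal_add]
  rw [Complex.exp_eq_exp_iff_exists_int]
  rw [cellIndex_add_latticeVec]
  have key : ∃ n : ℤ, ((q : ℝ) / 2 * (field B ⬝ᵥ crossProduct (latticeVec B j) x) +
      (freq B q * (x + latticeVec B j) 0 * (x + latticeVec B j) 1 / 2
    - freq B q * latticeConst B * ((cellIndex B x 0 + if 0 = j then 1 else 0 : ℤ) : ℝ) *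
      (x + latticeVec B j) 1
    - freq B q * cellRep B x 0 * cellRep B x 1 / 2)) = (freq B q * x 0 * x 1 / 2
    - freq B q * latticeConst B * cellIndex B x 0 * x 1
    - freq B q * cellRep B x 0 * cellRep B x 1 / 2) + n * (2 * Real.pi) := by
    fin_cases j
    · refine ⟨0, ?_⟩
      simp [field, cross_apply, latticeVec, freq, dotProduct, Fin.sum_univ_three]
      ring
    -- Moving `x 1` by `ℓ` changes the term with `cellIndex B x 0` by `ωℓ² = 2πq` times that index.
    · refine ⟨-(q * cellIndex B x 0), ?_⟩
      simp [field, cross_apply, latticeVec, dotProduct, Fin.sum_univ_three]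
      rw [mul_assoc, mul_assoc]
      have : freq B q = q * B := rfl
      linear_combination (-(cellIndex B x 0 : ℝ)) * hw + (latticeConst B * x 0 / 2) * this
    · refine ⟨0, ?_⟩
      simp [field, cross_apply, latticeVec, dotProduct, Fin.sum_univ_three]
  obtain ⟨n, hn⟩ := key
  refine ⟨n, ?_⟩
  rw [hn]
  push_cast
  ring

lemma memLp_gaugeExtension {f : E3 → ℂ} (hm : Measurable f)
    (hf : MemLp f 2 (volume.restrict (cell B))) {K : Set E3} (hK : IsCompact K) :
    MemLp (gaugeExtension B q f) 2 (volume.restrict K) := by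
  have hl := latticeConst_pos (B := B)
  rw [memLp_two_iff_integrable_sq_norm (measurable_gaugeExtension hm).aestronglyMeasurable]
  simp only [norm_gaugeExtension]
  have h0 := (memLp_two_iff_integrable_sq_norm hf.1).1 hf
  have hcell : ∀ n : Fin 3 → ℤ,
      IntegrableOn (fun x => ‖f (cellRep B x)‖ ^ 2) {x | cellIndex B x = n} volume := by
    intro n
    set v : E3 := fun j => n j * latticeConst B with hv
    have h1 := ((measurePreserving_add_right (volume : Measure E3) (-v)).integrableOn_comp_preimage
      (measurableEmbedding_addRight (-v)) (f := fun x => ‖f x‖ ^ 2) (s := cell B)).2 h0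
    have e : (fun x : E3 => x + -v) ⁻¹' cell B = {x | cellIndex B x = n} := by
      ext x
      simp only [Set.mem_preimage, cell, Set.mem_pi, Set.mem_univ, true_imp_iff, Set.mem_Ico,
        Set.mem_ofPred_eq, funext_iff, cellIndex, Int.floor_eq_iff, le_div_iff₀ hl,
        div_lt_iff₀ hl, hv, Pi.add_apply, Pi.neg_apply]
      refine forall_congr' fun j => and_congr ?_ ?_ <;> constructor <;> intro h <;> linarith
    rw [e] at h1
    refine h1.congr_fun (fun x hx => ?_) ?_
    · have : cellRep B x = x + -v := by
        ext j
        rw [cellRep, show cellIndex B x = n from hx]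
        simp [hv, sub_eq_add_neg]
      simp only [Function.comp, this]
    · rw [← e]
      exact (measurable_id.add_const _) (measurableSet_cell B)
  -- A compact set lies in a box, which meets finitely many translates of the cell.
  obtain ⟨a, b, hab⟩ : ∃ a b : E3, K ⊆ Set.Icc a b := by
    obtain ⟨a, ha⟩ := hK.isBounded.bddBelow
    obtain ⟨b, hb⟩ := hK.isBounded.bddAbove
    exact ⟨a, b, fun x hx => ⟨ha hx, hb hx⟩⟩
  refine IntegrableOn.mono_set ((integrableOn_finite_biUnion
    (Set.finite_Icc (cellIndex B a) (cellIndex B b))).2 fun n _ => hcell n) fun x hx => ?_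
  simp only [Set.mem_iUnion, Set.mem_ofPred_eq, exists_prop, exists_eq_right']
  exact ⟨fun j => Int.floor_mono (div_le_div_of_nonneg_right ((hab hx).1 j) hl.le),
    fun j => Int.floor_mono (div_le_div_of_nonneg_right ((hab hx).2 j) hl.le)⟩

/-- Together with injectivity this identifies the space isometrically with `L²` of the cell, whence
completeness. -/
lemma MagL2.restrict_surjective (B : ℝ) (q : ℕ) [Fact (0 < B)] :
    Function.Surjective (MagL2.restrict B q) := by
  intro f
  have hm : Measurable f := (Lp.stronglyMeasurable f).measurable
  refine ⟨MagL2.ofFun (gaugeExtension B q f) (measurable_gaugeExtension hm).aestronglyMeasurable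
    (fun K hK => memLp_gaugeExtension hm (Lp.memLp f) hK) (isGaugePeriodic_gaugeExtension f), ?_⟩
  refine Lp.ext ?_
  refine (MemLp.coeFn_toLp (MagL2.memLp_cell _)).trans ?_
  filter_upwards [ae_restrict_of_ae (MagL2.coeFn_ofFun (B := B) (q := q) (gaugeExtension B q f)
    (measurable_gaugeExtension hm).aestronglyMeasurable
    (fun K hK => memLp_gaugeExtension hm (Lp.memLp f) hK) (isGaugePeriodic_gaugeExtension f)),
    ae_restrict_mem (measurableSet_cell B)] with x hx hx'
  rw [hx, gaugeExtension_of_mem _ hx']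

instance : CompleteSpace (MagL2 B q) := by
  have hi : Isometry (MagL2.restrict B q) :=
    AddMonoidHomClass.isometry_of_norm (MagL2.restrict B q) fun _ => rfl
  rw [completeSpace_iff_isComplete_range hi.isUniformInducing,
    (MagL2.restrict_surjective B q).range_eq]
  exact isComplete_univ

/-! ### Second-order estimates from the commutation relations. -/

section Commutation

variable {V H : Type*} [AddCommGroup V] [Module ℂ V] [NormedAddCommGroup H]
  [InnerProductSpace ℂ H] {T : V →ₗ[ℂ] H} {p : Fin 3 → V →ₗ[ℂ] V} {ω' : ℝ}

/-- The norm of the sum of squares of three momenta, two of which satisfy the canonical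
commutation relation. -/
lemma norm_sum_sq_eq (hs : ∀ j u v, inner ℂ (T (p j u)) (T v) = inner ℂ (T u) (T (p j v)))
    (h01 : ∀ u, p 1 (p 0 u) = p 0 (p 1 u) + (Complex.I * (ω' : ℂ)) • u)
    (h02 : ∀ u, p 2 (p 0 u) = p 0 (p 2 u)) (h12 : ∀ u, p 2 (p 1 u) = p 1 (p 2 u)) (u : V) :
    ‖T (∑ j, p j (p j u))‖ ^ 2 = ‖T (p 0 (p 0 u))‖ ^ 2 + ‖T (p 1 (p 1 u))‖ ^ 2 +
      ‖T (p 2 (p 2 u))‖ ^ 2 + 2 * ‖T (p 0 (p 1 u))‖ ^ 2 + 2 * ‖T (p 0 (p 2 u))‖ ^ 2 +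
      2 * ‖T (p 1 (p 2 u))‖ ^ 2 - 2 * ω' ^ 2 * ‖T u‖ ^ 2 := by
  have e02 : inner ℂ (T (p 0 (p 0 u))) (T (p 2 (p 2 u))) = ((‖T (p 0 (p 2 u))‖ ^ 2 : ℝ) : ℂ) := by
    rw [← hs 2, h02, hs 0, h02, inner_self_eq_norm_sq_to_K]
    norm_cast
  have e12 : inner ℂ (T (p 1 (p 1 u))) (T (p 2 (p 2 u))) = ((‖T (p 1 (p 2 u))‖ ^ 2 : ℝ) : ℂ) := by
    rw [← hs 2, h12, hs 1, h12, inner_self_eq_norm_sq_to_K]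
    norm_cast
  have eu : inner ℂ (T u) (T u) = ((‖T u‖ ^ 2 : ℝ) : ℂ) := by
    rw [inner_self_eq_norm_sq_to_K]
    norm_cast
  have ev : inner ℂ (T (p 0 (p 1 u))) (T (p 0 (p 1 u))) = ((‖T (p 0 (p 1 u))‖ ^ 2 : ℝ) : ℂ) := by
    rw [inner_self_eq_norm_sq_to_K]
    norm_cast
  have hc : inner ℂ (T (p 1 u)) (T (p 0 u)) = inner ℂ (T (p 0 u)) (T (p 1 u)) +
      Complex.I * (ω' : ℂ) * ((‖T u‖ ^ 2 : ℝ) : ℂ) := by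
    rw [hs 1, h01, map_add, map_smul, inner_add_right, inner_smul_right, eu, hs 0]
  -- Exchanging the two arguments conjugates the inner product, and the commutator computes the
  -- difference; so its imaginary part is determined.
  have him : (inner ℂ (T (p 0 u)) (T (p 1 u))).im = -(ω' / 2 * ‖T u‖ ^ 2) := by
    have h1 := congrArg Complex.im hc
    have h2 : (inner ℂ (T (p 1 u)) (T (p 0 u))).im = -(inner ℂ (T (p 0 u)) (T (p 1 u))).im := by
      rw [← inner_conj_symm, Complex.conj_im]
    simp only [Complex.add_im, Complex.mul_im, Complex.mul_re, Complex.I_re, Complex.I_im,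
      Complex.ofReal_re, Complex.ofReal_im] at h1
    linarith
  have e01 : inner ℂ (T (p 0 (p 0 u))) (T (p 1 (p 1 u))) = ((‖T (p 0 (p 1 u))‖ ^ 2 : ℝ) : ℂ) -
      2 * (Complex.I * ω') * inner ℂ (T (p 0 u)) (T (p 1 u)) := by
    rw [← hs 1, h01, map_add, map_smul, inner_add_left, inner_smul_left, hs 0, h01, map_add,
      map_smul, inner_add_left, inner_smul_left, ev, ← hs 0, map_mul, Complex.conj_I,
      Complex.conj_ofReal]
    ring
  have r01 : (inner ℂ (T (p 0 (p 0 u))) (T (p 1 (p 1 u)))).re =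
      ‖T (p 0 (p 1 u))‖ ^ 2 - ω' ^ 2 * ‖T u‖ ^ 2 := by
    rw [e01]
    simp only [Complex.sub_re, Complex.mul_re, Complex.mul_im, Complex.I_re, Complex.I_im,
      Complex.ofReal_re, Complex.ofReal_im, him, Complex.re_ofNat, Complex.im_ofNat]
    ring
  rw [Fin.sum_univ_three, map_add, map_add, @norm_add_sq ℂ, @norm_add_sq ℂ, inner_add_left, e02,
    e12]
  simp only [map_add, RCLike.re_eq_complex_re, r01, Complex.ofReal_re]
  ring

/-- Interpolation: `‖Π u‖² = ⟨u, Π² u⟩ ≤ ‖u‖ ‖Π² u‖`. -/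
lemma norm_momentum_le (hs : ∀ j u v, inner ℂ (T (p j u)) (T v) = inner ℂ (T u) (T (p j v)))
    (u : V) (j : Fin 3) : ‖T (p j u)‖ ≤ ‖T u‖ + ‖T (p j (p j u))‖ := by
  have h : ‖T (p j u)‖ ^ 2 ≤ ‖T u‖ * ‖T (p j (p j u))‖ := by
    have h1 : inner ℂ (T (p j u)) (T (p j u)) = ((‖T (p j u)‖ ^ 2 : ℝ) : ℂ) := by
      rw [inner_self_eq_norm_sq_to_K]
      norm_cast
    have h2 := norm_inner_le_norm (𝕜 := ℂ) (T u) (T (p j (p j u)))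
    rwa [← hs, h1, Complex.norm_real, Real.norm_of_nonneg (sq_nonneg _)] at h2
  refine (sq_le_sq₀ (norm_nonneg _) (by positivity)).1 ?_
  nlinarith [mul_nonneg (norm_nonneg (T u)) (norm_nonneg (T (p j (p j u)))), sq_nonneg ‖T u‖, sq_nonneg ‖T (p j (p j u))‖]

/-- The norm identity bounds each second-order term, up to the single negative term `2ω²‖u‖²`, by
`‖Π² u‖²`. Control of the Hamiltonian thus controls the full second-order Sobolev norm. -/
lemma norm_momentum_momentum_le
    (hs : ∀ j u v, inner ℂ (T (p j u)) (T v) = inner ℂ (T u) (T (p j v)))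
    (h01 : ∀ u, p 1 (p 0 u) = p 0 (p 1 u) + (Complex.I * (ω' : ℂ)) • u)
    (h02 : ∀ u, p 2 (p 0 u) = p 0 (p 2 u)) (h12 : ∀ u, p 2 (p 1 u) = p 1 (p 2 u)) (hω : 0 ≤ ω')
    (u : V) {i j : Fin 3} (hij : i ≤ j) :
    ‖T (p i (p j u))‖ ≤ ‖T (∑ j, p j (p j u))‖ + 2 * ω' * ‖T u‖ := by
  have h := norm_sum_sq_eq hs h01 h02 h12 u
  have h0 : ‖T (p i (p j u))‖ ^ 2 ≤ ‖T (∑ j, p j (p j u))‖ ^ 2 + 2 * ω' ^ 2 * ‖T u‖ ^ 2 := by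
    fin_cases i <;> fin_cases j <;> first | (exact absurd hij (by decide)) | skip
    all_goals
      simp only [Fin.zero_eta, Fin.mk_one, Fin.reduceFinMk]
      nlinarith [sq_nonneg ‖T (p 0 (p 0 u))‖, sq_nonneg ‖T (p 1 (p 1 u))‖,
        sq_nonneg ‖T (p 2 (p 2 u))‖, sq_nonneg ‖T (p 0 (p 1 u))‖, sq_nonneg ‖T (p 0 (p 2 u))‖,
        sq_nonneg ‖T (p 1 (p 2 u))‖]
  refine (sq_le_sq₀ (norm_nonneg _) (by positivity)).1 (h0.trans ?_)
  have h3 : 0 ≤ ω' * ‖T u‖ := by positivity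
  nlinarith [mul_nonneg h3 (norm_nonneg (T (∑ j, p j (p j u)))), sq_nonneg (ω' * ‖T u‖)]

end Commutation

lemma cauchySeq_of_norm_sub_le {ι H₁ H₂ H₃ : Type*} [Nonempty ι] [SemilatticeSup ι]
    [SeminormedAddCommGroup H₁] [SeminormedAddCommGroup H₂] [SeminormedAddCommGroup H₃]
    {x : ι → H₁} {y : ι → H₂} {z : ι → H₃} {C : ℝ} (hx : CauchySeq x) (hy : CauchySeq y)
    (h : ∀ s t, ‖z s - z t‖ ≤ C * (‖x s - x t‖ + ‖y s - y t‖)) : CauchySeq z := by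
  rw [Metric.cauchySeq_iff] at *
  intro ε hε
  have hC : 0 < |C| + 1 := by positivity
  obtain ⟨a, ha⟩ := hx (ε / (2 * (|C| + 1))) (by positivity)
  obtain ⟨b, hb⟩ := hy (ε / (2 * (|C| + 1))) (by positivity)
  refine ⟨a ⊔ b, fun m hm n hn => ?_⟩
  have h1 := ha m (le_sup_left.trans hm) n (le_sup_left.trans hn)
  have h2 := hb m (le_sup_right.trans hm) n (le_sup_right.trans hn)
  rw [dist_eq_norm] at *
  refine (h m n).trans_lt ?_
  have h3 : C * (‖x m - x n‖ + ‖y m - y n‖) ≤ (|C| + 1) * (‖x m - x n‖ + ‖y m - y n‖) :=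
    mul_le_mul_of_nonneg_right ((le_abs_self C).trans (by linarith)) (by positivity)
  refine h3.trans_lt ?_
  have h4 : ‖x m - x n‖ + ‖y m - y n‖ < ε / (|C| + 1) := by
    have : ε / (|C| + 1) = ε / (2 * (|C| + 1)) + ε / (2 * (|C| + 1)) := by field_simp; ring
    linarith
  rwa [lt_div_iff₀ hC, mul_comm] at h4

variable {B : ℝ} {q : ℕ} {ϑ : E3}

/-! ### Calculus of weak images, and the domain in terms of momenta. -/

section WeakImages

lemma IsTest.exists_norm_le_decay {φ : E3 → ℂ} (h : IsTest φ) :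
    ∃ C : ℝ, ∀ x, ‖φ x‖ ≤ C * decay x := by
  have hc : Continuous fun x : E3 => φ x * ((decay x)⁻¹ : ℝ) := by
    refine h.1.continuous.mul (Complex.continuous_ofReal.comp (Continuous.inv₀ ?_ fun x =>
      (decay_pos x).ne'))
    refine continuous_finsetProd _ fun j _ => Continuous.inv₀ (by fun_prop) fun x => by positivity
  obtain ⟨C, hC⟩ := (h.2.mul_right (f' := fun x : E3 => (((decay x)⁻¹ : ℝ) : ℂ))).exists_bound_of_continuous hc
  refine ⟨C, fun x => ?_⟩
  have := hC x
  rw [Pi.mul_apply, norm_mul, Complex.norm_real, Real.norm_of_nonneg (inv_nonneg.2 (decay_pos x).le),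
    ← div_eq_mul_inv, div_le_iff₀ (decay_pos x)] at this
  exact this

/-- Integration of gauge-periodic functions against a test function. -/
def testPairing (B : ℝ) (q : ℕ) [Fact (0 < B)] {φ : E3 → ℂ} (h : IsTest φ) :
    MagL2 B q →L[ℂ] ℂ :=
  LinearMap.mkContinuous
    { toFun := fun F => ∫ x, (F : E3 →ₘ[volume] ℂ) x * φ x
      map_add' := fun F G => integral_add_mul F G h
      map_smul' := fun c F => integral_smul_mul c F φ }
    (h.exists_norm_le_decay.choose * pairingConst B) fun F => by
      rw [mul_assoc]
      exact (MagL2.integrable_mul_of_decay F h.1.continuous.aestronglyMeasurable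
        h.exists_norm_le_decay.choose_spec).2

/-- Weak differential operators are closed: both sides of the defining identity are continuous in
the Hilbert norm, since test functions are dominated by `decay`. -/
lemma IsWeakImage.of_tendsto [Fact (0 < B)] {PT : (E3 → ℂ) → E3 → ℂ}
    (hP : ∀ φ, IsTest φ → IsTest (PT φ)) {ι : Type*} {l : Filter ι} [NeBot l]
    {u v : ι → MagL2 B q} {u₀ v₀ : MagL2 B q} (hu : Tendsto u l (𝓝 u₀)) (hv : Tendsto v l (𝓝 v₀))
    (h : ∀ i, IsWeakImage PT (u i) (v i)) : IsWeakImage PT u₀ v₀ := by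
  intro φ hφ
  have h1 := ((testPairing B q hφ).continuous.tendsto v₀).comp hv
  have h2 := ((testPairing B q (hP φ hφ)).continuous.tendsto u₀).comp hu
  refine tendsto_nhds_unique h1 (h2.congr fun i => ?_)
  exact (h i φ hφ).symm

lemma IsWeakImage.comp {P Q : (E3 → ℂ) → E3 → ℂ} (hP : ∀ φ, IsTest φ → IsTest (P φ))
    {u v w : E3 → ℂ} (h : IsWeakImage Q u v) (h' : IsWeakImage P v w) :
    IsWeakImage (fun φ => Q (P φ)) u w := fun φ hφ =>
  (h' φ hφ).trans (h (P φ) (hP φ hφ))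

lemma IsWeakImage.id (u : E3 → ℂ) : IsWeakImage (fun φ => φ) u u := fun _ _ => rfl

lemma isWeakImage_sum {ι : Type*} (s : Finset ι) {P : ι → (E3 → ℂ) → E3 → ℂ}
    (hP : ∀ i φ, IsTest φ → IsTest (P i φ)) {u : MagL2 B q} {v : ι → MagL2 B q}
    (h : ∀ i, IsWeakImage (P i) u (v i)) :
    IsWeakImage (fun φ x => ∑ i ∈ s, P i φ x) u (∑ i ∈ s, v i : MagL2 B q) := by
  intro φ hφ
  have e : ∫ x, ((∑ i ∈ s, v i : MagL2 B q) : E3 →ₘ[volume] ℂ) x * φ x =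
      ∑ i ∈ s, ∫ x, (v i : E3 →ₘ[volume] ℂ) x * φ x := by
    let f : MagL2 B q →ₗ[ℂ] ℂ :=
      { toFun := fun F => ∫ x, (F : E3 →ₘ[volume] ℂ) x * φ x
        map_add' := fun F G => integral_add_mul F G hφ
        map_smul' := fun c F => integral_smul_mul c F φ }
    exact map_sum f v s
  rw [e, Finset.sum_congr rfl fun i _ => h i φ hφ,
    ← integral_finsetSum _ fun i _ => MagL2.integrable_mul u (hP i φ hφ)]
  simp only [Finset.mul_sum]

/-- Changing the fiber parameter shifts the momentum by a constant. -/
lemma IsWeakImage.shift {ϑ : E3} {j : Fin 3} {u v : MagL2 B q}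
    (h : IsWeakImage (momentumT B q ϑ j) u v) (ϑ' : E3) :
    IsWeakImage (momentumT B q ϑ' j) u
      (v + ((Real.sqrt (2 * Real.pi * B) * (ϑ' j - ϑ j) : ℝ) : ℂ) • u : MagL2 B q) := by
  intro φ hφ
  rw [integral_add_mul _ _ hφ, integral_smul_mul, h φ hφ, ← integral_const_mul,
    ← integral_add (MagL2.integrable_mul u (hφ.momentumT ϑ j))
      ((MagL2.integrable_mul u hφ).const_mul _)]
  congr 1
  ext x
  simp only [momentumT]
  push_cast
  ring

lemma momentumPowT_single (j : Fin 3) (φ : E3 → ℂ) :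
    momentumPowT B q (Pi.single j 1) φ = momentumT B q 0 j φ := by
  fin_cases j <;> rfl

/-- Transposition reverses the order: `Π_i Π_j` with `i ≤ j` acts on the test function first by
index `i`. Only these orderings occur among the multi-indices. -/
lemma momentumPowT_single_add_single {i j : Fin 3} (h : i ≤ j) (φ : E3 → ℂ) :
    momentumPowT B q (Pi.single i 1 + Pi.single j 1) φ =
      momentumT B q 0 j (momentumT B q 0 i φ) := by
  fin_cases i <;> fin_cases j <;> first | (exact absurd h (by decide)) | rfl

/-- The multi-indices of order at most two. -/
lemma multiindex_cases {ν : Fin 3 → ℕ} (h : ∑ j, ν j ≤ 2) :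
    ν = 0 ∨ (∃ j, ν = Pi.single j 1) ∨ ∃ i j, i ≤ j ∧ ν = Pi.single i 1 + Pi.single j 1 := by
  rw [Fin.sum_univ_three] at h
  have e : ∀ μ : Fin 3 → ℕ, ν = μ ↔ ν 0 = μ 0 ∧ ν 1 = μ 1 ∧ ν 2 = μ 2 := fun μ => by
    simp [funext_iff, Fin.forall_fin_succ]
  simp only [e, Fin.exists_fin_succ, Pi.single_apply, Pi.add_apply]
  simp
  omega

/-- Membership in the magnetic Sobolev space, and the value of the Hamiltonian, from momenta. -/
lemma exists_mem_magSobolev {u : MagL2 B q} {F : Fin 3 → MagL2 B q}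
    {G : Fin 3 → Fin 3 → MagL2 B q} (hF : ∀ j, IsWeakImage (momentumT B q ϑ j) u (F j))
    (hG : ∀ i j, i ≤ j → IsWeakImage (momentumT B q ϑ i) (F j) (G i j)) :
    ∃ h : u ∈ (landauHamiltonian B q ϑ).domain,
      landauHamiltonian B q ϑ ⟨u, h⟩ = ∑ j, G j j := by
  have hF' := fun j => (hF j).shift 0
  have hG' : ∀ i j, i ≤ j → ∃ w : MagL2 B q, IsWeakImage (momentumT B q 0 i)
      (F j + ((Real.sqrt (2 * Real.pi * B) * ((0 : E3) j - ϑ j) : ℝ) : ℂ) • u : MagL2 B q) w :=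
    fun i j hij => ⟨_, isWeakImage_add (fun φ h => h.momentumT 0 i) ((hG i j hij).shift 0)
      (isWeakImage_smul _ (hF' i))⟩
  have hu : u ∈ magSobolev B q 2 := by
    intro ν hν
    obtain rfl | ⟨j, rfl⟩ | ⟨i, j, hij, rfl⟩ := multiindex_cases hν
    · exact ⟨u, IsWeakImage.id u⟩
    · rw [funext (momentumPowT_single (B := B) (q := q) j)]
      exact ⟨_, hF' j⟩
    · obtain ⟨w, hw⟩ := hG' i j hij
      refine ⟨w, ?_⟩
      rw [funext (momentumPowT_single_add_single (B := B) (q := q) hij)]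
      exact (hF' j).comp (fun φ h => h.momentumT 0 i) hw
  refine ⟨hu, isWeakImage_unique (exists_momentumSq ϑ ⟨u, hu⟩).choose_spec ?_⟩
  exact isWeakImage_sum Finset.univ (fun j φ h => (h.momentumT ϑ j).momentumT ϑ j)
    fun j => (hF j).comp (fun φ h => h.momentumT ϑ j) (hG j j le_rfl)

/-- The Hamiltonian acts on its domain as the sum of squares of momenta. -/
lemma exists_momenta (u : (landauHamiltonian B q ϑ).domain) :
    ∃ F G : Fin 3 → MagL2 B q, (∀ j, IsWeakImage (momentumT B q ϑ j) (u : MagL2 B q) (F j)) ∧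
      (∀ j, IsWeakImage (momentumT B q ϑ j) (F j) (G j)) ∧
      landauHamiltonian B q ϑ u = ∑ j, G j := by
  have key : ∀ j : Fin 3, ∃ F G : MagL2 B q, IsWeakImage (momentumT B q ϑ j) (u : MagL2 B q) F ∧
      IsWeakImage (momentumT B q ϑ j) F G := by
    intro j
    obtain ⟨F, hF⟩ := u.2 (Pi.single j 1) (by simp)
    obtain ⟨G, hG⟩ := u.2 (Pi.single j 1 + Pi.single j 1) (by simp [Finset.sum_add_distrib])
    rw [funext (momentumPowT_single (B := B) (q := q) j)] at hF
    rw [funext (momentumPowT_single_add_single (B := B) (q := q) le_rfl)] at hG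
    have hG' : IsWeakImage (momentumT B q 0 j) F G := fun φ hφ =>
      (hG φ hφ).trans (hF _ (hφ.momentumT 0 j)).symm
    exact ⟨_, _, hF.shift ϑ, isWeakImage_add (fun φ h => h.momentumT ϑ j) (hG'.shift ϑ)
      (isWeakImage_smul _ (hF.shift ϑ))⟩
  choose F G hF hG using key
  refine ⟨F, G, hF, hG, isWeakImage_unique (exists_momentumSq ϑ u).choose_spec ?_⟩
  exact isWeakImage_sum Finset.univ (fun j φ h => (h.momentumT ϑ j).momentumT ϑ j)
    fun j => (hF j).comp (fun φ h => h.momentumT ϑ j) (hG j)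

end WeakImages

/-! ### Finite wave packets, closedness of the Hamiltonian and the Landau states. -/

variable {B : ℝ} {q : ℕ} {ϑ : E3}

/-- The action of the momenta on formal sums of modes. -/
def packetMomentum (B : ℝ) (q : ℕ) (ϑ : E3) (j : Fin 3) :
    (ℤ × ℤ →₀ ℂ[X]) →ₗ[ℂ] (ℤ × ℤ →₀ ℂ[X]) :=
  Finsupp.lsum ℂ fun a => Finsupp.lsingle a ∘ₗ modeMomentum B q ϑ a.2 j

lemma packetMomentum_single (j : Fin 3) (a : ℤ × ℤ) (P : ℂ[X]) :
    packetMomentum B q ϑ j (Finsupp.single a P) =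
      Finsupp.single a (modeMomentum B q ϑ a.2 j P) := by
  simp [packetMomentum]

/-- On formal sums of modes the canonical commutation relation is a polynomial identity, free of
domain questions. -/
lemma packetMomentum_one_zero (u : ℤ × ℤ →₀ ℂ[X]) :
    packetMomentum B q ϑ 1 (packetMomentum B q ϑ 0 u) =
      packetMomentum B q ϑ 0 (packetMomentum B q ϑ 1 u) + (Complex.I * (freq B q : ℂ)) • u := by
  induction u using Finsupp.induction_linear with
  | zero => simp
  | add f g hf hg =>
    simp only [map_add, hf, hg, smul_add]
    abel
  | single a P =>
    simp only [packetMomentum_single, Finsupp.smul_single, ← Finsupp.single_add]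
    congr 1
    simp [modeMomentum, Polynomial.smul_eq_C_mul]
    ring

lemma packetMomentum_two (j : Fin 3) (u : ℤ × ℤ →₀ ℂ[X]) :
    packetMomentum B q ϑ 2 (packetMomentum B q ϑ j u) =
      packetMomentum B q ϑ j (packetMomentum B q ϑ 2 u) := by
  induction u using Finsupp.induction_linear with
  | zero => simp
  | add f g hf hg => simp only [map_add, hf, hg]
  | single a P =>
    simp only [packetMomentum_single]
    congr 1
    have e : ∀ P : ℂ[X], modeMomentum B q ϑ a.2 2 P = ((wave B * (a.2 + ϑ 2) : ℝ) : ℂ) • P :=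
      fun P => rfl
    rw [e, e, map_smul]

variable [hB : Fact (0 < B)] [NeZero q]

/-- The gauge-periodic function of a formal sum of modes. -/
def packet (B : ℝ) (q : ℕ) (ϑ : E3) [Fact (0 < B)] [NeZero q] :
    (ℤ × ℤ →₀ ℂ[X]) →ₗ[ℂ] MagL2 B q :=
  Finsupp.lsum ℂ fun a => bloch B q ϑ a.1 a.2

lemma packet_single (a : ℤ × ℤ) (P : ℂ[X]) :
    packet B q ϑ (Finsupp.single a P) = bloch B q ϑ a.1 a.2 P := by
  simp [packet]

lemma isWeakImage_packet (j : Fin 3) (u : ℤ × ℤ →₀ ℂ[X]) :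
    IsWeakImage (momentumT B q ϑ j) (packet B q ϑ u) (packet B q ϑ (packetMomentum B q ϑ j u)) := by
  induction u using Finsupp.induction_linear with
  | zero =>
    have h := isWeakImage_smul 0 (isWeakImage_bloch (B := B) (q := q) (ϑ := ϑ) 0 0 0 j)
    simpa using h
  | add f g hf hg =>
    simp only [map_add]
    exact isWeakImage_add (fun φ h => h.momentumT ϑ j) hf hg
  | single a P =>
    rw [packetMomentum_single, packet_single, packet_single]
    exact isWeakImage_bloch _ _ _ _

lemma inner_packet_momentum {F Φ : MagL2 B q} {j : Fin 3}
    (h : IsWeakImage (momentumT B q ϑ j) F Φ) (u : ℤ × ℤ →₀ ℂ[X]) :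
    inner ℂ (packet B q ϑ u) Φ = inner ℂ (packet B q ϑ (packetMomentum B q ϑ j u)) F := by
  induction u using Finsupp.induction_linear with
  | zero => simp
  | add f g hf hg => simp only [map_add, inner_add_left, hf, hg]
  | single a P =>
    rw [packetMomentum_single, packet_single, packet_single]
    exact inner_bloch_momentum h _ _ _

/-- The Hamiltonian is symmetric with respect to wave packets. -/
lemma inner_packet_landauHamiltonian (u : ℤ × ℤ →₀ ℂ[X])
    (v : (landauHamiltonian B q ϑ).domain) :
    inner ℂ (packet B q ϑ u) (landauHamiltonian B q ϑ v) =
      inner ℂ (packet B q ϑ (∑ j, packetMomentum B q ϑ j (packetMomentum B q ϑ j u)))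
        (v : MagL2 B q) := by
  obtain ⟨F, G, hF, hG, h⟩ := exists_momenta v
  rw [h, inner_sum, map_sum, sum_inner]
  exact Finset.sum_congr rfl fun j _ => by
    rw [inner_packet_momentum (hG j), inner_packet_momentum (hF j)]

/-- The graph of the Hamiltonian contains the limits of its values on wave packets. -/
lemma exists_landauHamiltonian_eq {ι : Type*} [Nonempty ι] [SemilatticeSup ι]
    {U : ι → (ℤ × ℤ →₀ ℂ[X])} {u w : MagL2 B q}
    (hu : Tendsto (fun s => packet B q ϑ (U s)) atTop (𝓝 u))
    (hw : Tendsto (fun s => packet B q ϑ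
      (∑ j, packetMomentum B q ϑ j (packetMomentum B q ϑ j (U s)))) atTop (𝓝 w)) :
    ∃ h : u ∈ (landauHamiltonian B q ϑ).domain, landauHamiltonian B q ϑ ⟨u, h⟩ = w := by
  have hfr := freq_pos (B := B) (q := q)
  have hs : ∀ j u v, inner ℂ (packet B q ϑ (packetMomentum B q ϑ j u)) (packet B q ϑ v) =
      inner ℂ (packet B q ϑ u) (packet B q ϑ (packetMomentum B q ϑ j v)) := fun j u v =>
    (inner_packet_momentum (isWeakImage_packet j v) u).symm
  have hb := fun (i j : Fin 3) (hij : i ≤ j) u => norm_momentum_momentum_le hs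
    packetMomentum_one_zero (packetMomentum_two 0) (packetMomentum_two 1) hfr.le u hij
  -- The estimates, applied to differences, turn convergence in the graph norm into convergence of
  -- every ordered second-order term.
  have h2 : ∀ i j : Fin 3, i ≤ j → CauchySeq fun s =>
      packet B q ϑ (packetMomentum B q ϑ i (packetMomentum B q ϑ j (U s))) := by
    intro i j hij
    refine cauchySeq_of_norm_sub_le (C := 1 + 2 * freq B q) hw.cauchySeq hu.cauchySeq fun s t => ?_
    have h := hb i j hij (U s - U t)
    simp only [map_sub, Finset.sum_sub_distrib] at h ⊢
    refine h.trans ?_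
    nlinarith [norm_nonneg (packet B q ϑ (U s) - packet B q ϑ (U t)), mul_nonneg hfr.le
      (norm_nonneg (packet B q ϑ (∑ j, packetMomentum B q ϑ j (packetMomentum B q ϑ j (U s))) -
        packet B q ϑ (∑ j, packetMomentum B q ϑ j (packetMomentum B q ϑ j (U t)))))]
  have h1 : ∀ j : Fin 3, CauchySeq fun s => packet B q ϑ (packetMomentum B q ϑ j (U s)) := by
    intro j
    refine cauchySeq_of_norm_sub_le (C := 1) hu.cauchySeq (h2 j j le_rfl) fun s t => ?_
    have h := norm_momentum_le hs (U s - U t) j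
    simpa only [map_sub, one_mul] using h
  choose F hF using fun j => cauchySeq_tendsto_of_complete (h1 j)
  choose G hG using fun (i j : Fin 3) (hij : i ≤ j) => cauchySeq_tendsto_of_complete (h2 i j hij)
  obtain ⟨h, h'⟩ := exists_mem_magSobolev (B := B) (q := q) (ϑ := ϑ) (u := u) (F := F)
    -- Entries with `i > j` are never consulted, so `0` is a filler.
    (G := fun i j => if hij : i ≤ j then G i j hij else 0)
    (fun j => IsWeakImage.of_tendsto (fun φ h => h.momentumT ϑ j) hu (hF j)
      fun s => isWeakImage_packet j (U s)) (fun i j hij => by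
        rw [dif_pos hij]
        exact IsWeakImage.of_tendsto (fun φ h => h.momentumT ϑ i) (hF j) (hG i j hij)
          fun s => isWeakImage_packet i _)
  refine ⟨h, h'.trans (tendsto_nhds_unique ?_ hw)⟩
  simp only [map_sum]
  refine tendsto_finsetSum _ fun j _ => ?_
  rw [dif_pos le_rfl]
  exact hG j j le_rfl

/-- The normalized Landau states, as formal sums of modes. -/
def landauPacket (B : ℝ) (q : ℕ) (ϑ : E3) [Fact (0 < B)] [NeZero q] (i : ℕ × ℤ × Fin q) :
    ℤ × ℤ →₀ ℂ[X] :=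
  Finsupp.single ((i.2.2 : ℕ), i.2.1)
    (((‖bloch B q ϑ (i.2.2 : ℕ) i.2.1 (hermitePoly B q i.1)‖⁻¹ : ℝ) : ℂ) • hermitePoly B q i.1)

/-- The normalized Landau states. -/
def landauState (B : ℝ) (q : ℕ) (ϑ : E3) [Fact (0 < B)] [NeZero q] (i : ℕ × ℤ × Fin q) :
    MagL2 B q := packet B q ϑ (landauPacket B q ϑ i)

lemma landauState_eq (i : ℕ × ℤ × Fin q) : landauState B q ϑ i =
    ((‖bloch B q ϑ (i.2.2 : ℕ) i.2.1 (hermitePoly B q i.1)‖⁻¹ : ℝ) : ℂ) •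
      bloch B q ϑ (i.2.2 : ℕ) i.2.1 (hermitePoly B q i.1) := by
  rw [landauState, landauPacket, packet_single, map_smul]

/-- The Hermite operator contributes `ω(2k+1)`, and the third momentum the square of `√(2πB)(p + ϑ
2)`. -/
lemma momentumSq_landauPacket (i : ℕ × ℤ × Fin q) :
    ∑ j, packetMomentum B q ϑ j (packetMomentum B q ϑ j (landauPacket B q ϑ i)) =
      (landauEnergy B q ϑ i.1 i.2.1 : ℂ) • landauPacket B q ϑ i := by
  have e : ∀ (p : ℤ) (P : ℂ[X]), modeMomentum B q ϑ p 2 P = ((wave B * (p + ϑ 2) : ℝ) : ℂ) • P :=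
    fun p P => rfl
  simp only [landauPacket, packetMomentum_single, Fin.sum_univ_three, ← Finsupp.single_add,
    Finsupp.smul_single]
  congr 1
  simp only [map_smul]
  rw [← smul_add, momentumSq_hermitePoly, e, e, ← smul_add, smul_smul, ← add_smul, smul_comm]
  congr 2
  rw [landauEnergy, ← wave_sq, freq]
  push_cast
  ring

/-- Different labels are separated by `p`, by the residue class, or by the Hermite degree; indices
in `Fin q` are congruent modulo `q` only if equal. -/
lemma orthonormal_landauState : Orthonormal ℂ (landauState B q ϑ) := by
  refine ⟨fun i => ?_, fun i i' hii' => ?_⟩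
  · rw [landauState_eq, norm_smul, Complex.norm_real, norm_inv, norm_norm,
      inv_mul_cancel₀ (norm_ne_zero_iff.2 (bloch_hermite_ne_zero _ _ _))]
  · obtain ⟨k, p, m⟩ := i
    obtain ⟨k', p', m'⟩ := i'
    rw [landauState_eq, landauState_eq, inner_smul_left, inner_smul_right]
    suffices h : inner ℂ (bloch B q ϑ (m : ℕ) p (hermitePoly B q k))
        (bloch B q ϑ (m' : ℕ) p' (hermitePoly B q k')) = 0 by simp [h]
    by_cases hp : p = p'
    · subst hp
      by_cases hm : m = m'
      · subst hm
        exact inner_hermite_of_ne _ _ fun hk => hii' (by rw [hk])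
      · refine inner_bloch_of_not_dvd (fun hd => hm (Fin.ext ?_)) _ _ _ _
        have h1 := m.isLt
        have h2 := m'.isLt
        have h3 := Int.eq_zero_of_abs_lt_dvd hd (abs_lt.2 ⟨by omega, by omega⟩)
        omega
    · exact inner_bloch_of_ne hp _ _ _ _

/-- Every Bloch function reduces to Landau states: `n` modulo `q`, and the polynomial to its Hermite
expansion. -/
lemma eq_zero_of_inner_landauState {F : MagL2 B q}
    (h : ∀ i, inner ℂ (landauState B q ϑ i) F = 0) : F = 0 := by
  refine eq_zero_of_inner_bloch (ϑ := ϑ) fun n p P => ?_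
  have hq : 0 < (q : ℤ) := by exact_mod_cast Nat.pos_of_ne_zero (NeZero.ne q)
  obtain ⟨m, hm⟩ : ∃ m : Fin q, ((m : ℕ) : ℤ) = n % q := by
    refine ⟨⟨(n % q).toNat, ?_⟩, ?_⟩
    · have := Int.emod_lt_of_pos n hq
      have := Int.emod_nonneg n hq.ne'
      omega
    · exact Int.toNat_of_nonneg (Int.emod_nonneg n hq.ne')
  rw [← bloch_emod, ← hm]
  have hP : P ∈ Submodule.span ℂ (Set.range (hermitePoly B q)) := by
    rw [span_hermitePoly]
    trivial
  induction hP using Submodule.span_induction with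
  | mem P hP =>
    obtain ⟨k, rfl⟩ := hP
    have h1 := h (k, p, m)
    rw [landauState_eq, inner_smul_left] at h1
    refine (mul_eq_zero.1 h1).resolve_left ?_
    rw [Complex.conj_ofReal]
    refine Complex.ofReal_ne_zero.2 ?_
    exact inv_ne_zero (norm_ne_zero_iff.2 (bloch_hermite_ne_zero _ _ _))
  | zero => simp
  | add P Q _ _ hP hQ => rw [map_add, inner_add_left, hP, hQ, add_zero]
  | smul c P _ hP => rw [map_smul, inner_smul_left, hP, mul_zero]

/-! ### Spectral theory of maximal diagonal operators. -/

section Diagonal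

variable {ι H : Type*} [NormedAddCommGroup H] [InnerProductSpace ℂ H]

lemma exists_coeff_eq (b : HilbertBasis ι ℂ H) {M : ℝ} (hM : 0 ≤ M) (c : ι → ℂ) (f : H)
    (h : ∀ i, ‖c i‖ ≤ M * ‖b.repr f i‖) : ∃ g : H, (∀ i, b.repr g i = c i) ∧ ‖g‖ ≤ M * ‖f‖ := by
  have h1 : ∀ i, ‖c i‖ ≤ ‖((M : ℂ) • b.repr f) i‖ := fun i => by
    rw [lp.coeFn_smul, Pi.smul_apply, norm_smul, Complex.norm_real, Real.norm_of_nonneg hM]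
    exact h i
  have h2 : Memℓp c 2 := (lp.memℓp ((M : ℂ) • b.repr f)).mono' h1
  refine ⟨b.repr.symm ⟨c, h2⟩, fun i => by rw [LinearIsometryEquiv.apply_symm_apply], ?_⟩
  rw [LinearIsometryEquiv.norm_map]
  refine (lp.norm_mono two_ne_zero (y := (M : ℂ) • b.repr f) h1).trans ?_
  rw [norm_smul, Complex.norm_real, Real.norm_of_nonneg hM, LinearIsometryEquiv.norm_map]

lemma eq_of_coeff_eq (b : HilbertBasis ι ℂ H) {f g : H} (h : ∀ i, b.repr f i = b.repr g i) :
    f = g :=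
  b.repr.injective (lp.ext (funext h))

/-- Bounded diagonal operators. -/
lemma exists_diagonal (b : HilbertBasis ι ℂ H) {M : ℝ} (hM : 0 ≤ M) (d : ι → ℂ)
    (hd : ∀ i, ‖d i‖ ≤ M) : ∃ R : H →L[ℂ] H, ∀ f i, b.repr (R f) i = d i * b.repr f i := by
  have h : ∀ f : H, ∃ g : H, (∀ i, b.repr g i = d i * b.repr f i) ∧ ‖g‖ ≤ M * ‖f‖ := fun f =>
    exists_coeff_eq b hM _ f fun i => by
      rw [norm_mul]
      exact mul_le_mul_of_nonneg_right (hd i) (norm_nonneg _)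
  choose R hR hR' using h
  refine ⟨LinearMap.mkContinuous
    { toFun := R
      map_add' := fun f g => eq_of_coeff_eq b fun i => ?_
      map_smul' := fun c f => eq_of_coeff_eq b fun i => ?_ } M hR', fun f i => hR f i⟩
  · simp only [map_add, lp.coeFn_add, Pi.add_apply, hR, mul_add]
  · simp only [map_smul, lp.coeFn_smul, Pi.smul_apply, hR, RingHom.id_apply, smul_eq_mul]
    ring

variable {A : H →ₗ.[ℂ] H} {b : HilbertBasis ι ℂ H} {E : ι → ℝ}
  (hA : ∀ u w : H, (∀ i, b.repr w i = E i * b.repr u i) → ∃ h : u ∈ A.domain, A ⟨u, h⟩ = w)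
  (hA' : ∀ (v : A.domain) i, b.repr (A v) i = E i * b.repr (v : H) i)
include hA hA'

omit hA' in
lemma exists_eigenvector (i : ι) : ∃ h : b i ∈ A.domain, A ⟨b i, h⟩ = (E i : ℂ) • b i := by
  classical
  refine hA _ _ fun j => ?_
  rw [map_smul, lp.coeFn_smul, Pi.smul_apply, smul_eq_mul, b.repr_self, lp.single_apply]
  by_cases h : i = j
  · subst h
    rfl
  · rw [Pi.single_eq_of_ne' h, mul_zero, mul_zero]

/-- Off the set of eigenvalues the resolvent is the diagonal operator with entries `(E i - z)⁻¹`.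
Maximality of the domain, `hA`, puts its range into the domain of `A`. -/
lemma spectrumOf_eq (hE : ∀ C, {i | E i ≤ C}.Finite) :
    spectrumOf A = Set.range fun i => (E i : ℂ) := by
  ext z
  rw [spectrumOf, Set.mem_compl_iff, not_iff_comm]
  constructor
  · intro hz
    have hne : ∀ i, (E i : ℂ) - z ≠ 0 := fun i h => hz ⟨i, sub_eq_zero.1 h⟩
    obtain ⟨M, hM0, hM⟩ : ∃ M : ℝ, 0 ≤ M ∧ ∀ i, ‖((E i : ℂ) - z)⁻¹‖ ≤ M := by
      -- Outside this finite set `|E i - z| ≥ 1`, so the entries there are bounded by `1`.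
      obtain ⟨M, hM⟩ := ((hE (‖z‖ + 1)).image fun i => ‖((E i : ℂ) - z)⁻¹‖).bddAbove
      refine ⟨max M 1, by positivity, fun i => ?_⟩
      by_cases h : E i ≤ ‖z‖ + 1
      · exact (hM ⟨i, h, rfl⟩).trans (le_max_left _ _)
      · refine le_trans ?_ (le_max_right _ _)
        rw [norm_inv]
        refine inv_le_one_of_one_le₀ ?_
        have h1 := norm_sub_norm_le (E i : ℂ) z
        rw [Complex.norm_real] at h1
        have h2 := Real.le_norm_self (E i)
        push Not at h
        linarith
    obtain ⟨R, hR⟩ := exists_diagonal b hM0 (fun i => ((E i : ℂ) - z)⁻¹) hM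
    refine ⟨R, fun f => ?_, fun u => eq_of_coeff_eq b fun i => ?_⟩
    · obtain ⟨h, h'⟩ := hA (R f) (f + z • R f) fun i => by
        simp only [map_add, map_smul, lp.coeFn_add, lp.coeFn_smul, Pi.add_apply, Pi.smul_apply, hR,
          smul_eq_mul]
        have := hne i
        field_simp
        ring
      exact ⟨h, by rw [h', add_sub_cancel_right]⟩
    · rw [hR, map_sub, map_smul, lp.coeFn_sub, lp.coeFn_smul, Pi.sub_apply, Pi.smul_apply, hA',
        smul_eq_mul, ← sub_mul, inv_mul_cancel_left₀ (hne i)]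
  · rintro ⟨R, -, hR⟩ ⟨i, rfl⟩
    obtain ⟨h, h'⟩ := exists_eigenvector hA i
    have h1 := hR ⟨b i, h⟩
    rw [h', sub_self, map_zero] at h1
    have h2 := b.orthonormal.1 i
    change 0 = b i at h1
    rw [← h1, norm_zero] at h2
    exact zero_ne_one h2

omit hA hA' in
lemma exists_ball_inter_eq (hE : ∀ C, {i | E i ≤ C}.Finite) (i : ι) : ∃ ε > 0,
    (Set.range fun i => (E i : ℂ)) ∩ Metric.ball (E i : ℂ) ε = {(E i : ℂ)} := by
  -- The values other than `E i` of labels with energy at most `E i + 1`: a finite, hence closed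
  -- set. Any further value of the family is at distance more than `1`.
  set T : Set ℂ := (fun i => (E i : ℂ)) '' {j | E j ≤ E i + 1} \ {(E i : ℂ)} with hT
  have hc : IsClosed T := (((hE (E i + 1)).image _).sdiff).isClosed
  obtain ⟨ε, hε, h⟩ := Metric.isOpen_iff.1 hc.isOpen_compl (E i : ℂ) (by simp [hT])
  refine ⟨min ε 1, by positivity, Set.eq_singleton_iff_unique_mem.2
    ⟨⟨⟨i, rfl⟩, Metric.mem_ball_self (by positivity)⟩, ?_⟩⟩
  rintro - ⟨⟨j, rfl⟩, hj⟩
  by_contra hne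
  refine h (Metric.ball_subset_ball (min_le_left _ _) hj) ⟨⟨j, ?_, rfl⟩, hne⟩
  have h1 := Metric.ball_subset_ball (min_le_right _ _) hj
  rw [Metric.mem_ball, Complex.dist_of_im_eq (by simp), Complex.ofReal_re, Complex.ofReal_re,
    Real.dist_eq] at h1
  have h2 := (abs_lt.1 h1).2
  change E j ≤ E i + 1
  linarith

/-- By comparison of coefficients an eigenvector is supported on the labels with `E i = e`, so the
eigenspace is the span of those basis vectors. -/
lemma finrank_eigenspaceOf (hE : ∀ C, {i | E i ≤ C}.Finite) (e : ℝ) :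
    FiniteDimensional ℂ (eigenspaceOf A (e : ℂ)) ∧
      Module.finrank ℂ (eigenspaceOf A (e : ℂ)) = {i | E i = e}.ncard := by
  classical
  have hfin : {i | E i = e}.Finite := (hE e).subset fun i hi => le_of_eq hi
  have : Fintype {i | E i = e} := hfin.fintype
  let Φ : eigenspaceOf A (e : ℂ) →ₗ[ℂ] H := A.domain.subtype ∘ₗ (eigenspaceOf A (e : ℂ)).subtype
  have hΦ : Function.Injective Φ := fun u v h => Subtype.ext (Subtype.ext h)
  have hmem : ∀ u : A.domain, u ∈ eigenspaceOf A (e : ℂ) ↔ A u = (e : ℂ) • (u : H) := fun u => by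
    rw [eigenspaceOf, LinearMap.mem_ker, LinearMap.sub_apply, sub_eq_zero]
    rfl
  have hrange : LinearMap.range Φ =
      Submodule.span ℂ (Set.range fun i : {i | E i = e} => b (i : ι)) := by
    apply le_antisymm
    · rintro - ⟨u, rfl⟩
      have hu := (hmem u).1 u.2
      have h0 : ∀ i, E i ≠ e → b.repr (Φ u) i = 0 := by
        intro i hi
        have h1 := hA' u i
        rw [hu, map_smul, lp.coeFn_smul, Pi.smul_apply, smul_eq_mul] at h1
        have h2 : ((e : ℂ) - E i) * b.repr (Φ u) i = 0 := by
          rw [sub_mul]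
          exact sub_eq_zero.2 h1
        refine (mul_eq_zero.1 h2).resolve_left (sub_ne_zero.2 fun h => hi ?_)
        exact_mod_cast h.symm
      have h1 : HasSum (fun i => b.repr (Φ u) i • b i)
          (∑ i ∈ hfin.toFinset, b.repr (Φ u) i • b i) :=
        hasSum_sum_of_ne_finset_zero fun i hi => by
          rw [h0 i (by simpa using hi), zero_smul]
      rw [(b.hasSum_repr (Φ u)).unique h1]
      exact Submodule.sum_mem _ fun i hi => Submodule.smul_mem _ _
        (Submodule.subset_span ⟨⟨i, by simpa using hi⟩, rfl⟩)
    · rw [Submodule.span_le]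
      rintro - ⟨⟨i, hi⟩, rfl⟩
      obtain ⟨h, h'⟩ := exists_eigenvector hA i
      rw [show E i = e from hi] at h'
      exact ⟨⟨⟨b i, h⟩, (hmem _).2 h'⟩, rfl⟩
  have heq := LinearEquiv.ofInjective Φ hΦ
  rw [hrange] at heq
  have hfd : FiniteDimensional ℂ
      (Submodule.span ℂ (Set.range fun i : {i | E i = e} => b (i : ι))) :=
    FiniteDimensional.span_of_finite ℂ (Set.finite_range _)
  refine ⟨heq.symm.finiteDimensional, ?_⟩
  rw [heq.finrank_eq, Set.ncard_eq_toFinset_card', Set.toFinset_card]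
  exact finrank_span_eq_card (b.orthonormal.linearIndependent.comp _ Subtype.val_injective)

end Diagonal

/-! ### Counting labels and coincidences of energies. -/

section Energies

variable {B : ℝ} [hB : Fact (0 < B)] {q : ℕ} [NeZero q] {ϑ : E3}

lemma finite_landauEnergy_le (C : ℝ) :
    {i : ℕ × ℤ | landauEnergy B q ϑ i.1 i.2 ≤ C}.Finite := by
  have hfr := freq_pos (B := B) (q := q)
  have hw : 0 < 2 * Real.pi * B := by
    have := hB.out
    positivity
  -- The added `1` passes from a bound on `(p + ϑ 2)²` to one on `|p + ϑ 2|`, through `|s| ≤ s² +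
  -- 1`.
  set D := C / (2 * Real.pi * B) + 1 with hD
  refine ((Set.finite_Icc 0 ⌈C / freq B q⌉₊).prod
    (Set.finite_Icc (⌊-D - ϑ 2⌋ : ℤ) ⌈D - ϑ 2⌉)).subset ?_
  rintro ⟨k, p⟩ h
  have h' : freq B q * (2 * k + 1) + 2 * Real.pi * B * (p + ϑ 2) ^ 2 ≤ C := h
  have hk : (0 : ℝ) ≤ k := Nat.cast_nonneg k
  have h1 : freq B q * k ≤ C := by
    nlinarith [mul_nonneg hw.le (sq_nonneg ((p : ℝ) + ϑ 2)), mul_nonneg hfr.le hk]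
  have h2 : (p + ϑ 2) ^ 2 ≤ D - 1 := by
    rw [hD, add_sub_cancel_right, le_div_iff₀ hw]
    nlinarith [mul_nonneg hfr.le hk]
  have h3 : |p + ϑ 2| ≤ D := by
    rw [← sq_abs] at h2
    nlinarith [sq_nonneg (|(p : ℝ) + ϑ 2| - 1), abs_nonneg ((p : ℝ) + ϑ 2)]
  rw [abs_le] at h3
  refine ⟨⟨Nat.zero_le _, ?_⟩, ?_, ?_⟩
  · have : (k : ℝ) ≤ ⌈C / freq B q⌉₊ :=
      (by rwa [le_div_iff₀ hfr, mul_comm] : (k : ℝ) ≤ C / freq B q).trans (Nat.le_ceil _)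
    exact_mod_cast this
  · have : ((⌊-D - ϑ 2⌋ : ℤ) : ℝ) ≤ p := (Int.floor_le _).trans (by linarith)
    exact_mod_cast this
  · have : (p : ℝ) ≤ (⌈D - ϑ 2⌉ : ℤ) := le_trans (by linarith) (Int.le_ceil _)
    exact_mod_cast this

omit [NeZero q] in
lemma finite_setOf_label {s : Set (ℕ × ℤ)} (h : s.Finite) :
    {i : ℕ × ℤ × Fin q | (i.1, i.2.1) ∈ s}.Finite :=
  Set.Finite.of_injOn (f := fun i : ℕ × ℤ × Fin q => ((i.1, i.2.1), i.2.2)) (t := s ×ˢ Set.univ)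
    (fun _ hi => ⟨hi, trivial⟩) (fun ⟨_, _, _⟩ _ ⟨_, _, _⟩ _ hij => by simpa [and_assoc] using hij)
    (h.prod Set.finite_univ)

omit [NeZero q] in
lemma ncard_setOf_label (s : Set (ℕ × ℤ)) :
    {i : ℕ × ℤ × Fin q | (i.1, i.2.1) ∈ s}.ncard = q * s.ncard := by
  have e : {i : ℕ × ℤ × Fin q | (i.1, i.2.1) ∈ s} =
      (Equiv.prodAssoc ℕ ℤ (Fin q)) '' (s ×ˢ Set.univ) := by
    ext ⟨k, p, m⟩
    simp
  rw [e, Set.ncard_image_of_injective _ (Equiv.injective _), Set.ncard_prod, Set.ncard_univ,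
    Nat.card_fin, mul_comm]

/-- For two distinct labels, equality of energies is an affine equation in `t`, as the squares
cancel. Its slope is nonzero if `p ≠ p'`, and it has no solution if `p = p'`; there are countably
many pairs of labels. -/
lemma countable_not_injective_landauEnergy :
    {t : ℝ | ¬ Function.Injective fun i : ℕ × ℤ =>
      landauEnergy B q (Function.update ϑ 2 t) i.1 i.2}.Countable := by
  have hfr := freq_pos (B := B) (q := q)
  have hw : 0 < 2 * Real.pi * B := by
    have := hB.out
    positivity
  have hE : ∀ t (k : ℕ) (p : ℤ), landauEnergy B q (Function.update ϑ 2 t) k p =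
      freq B q * (2 * k + 1) + 2 * Real.pi * B * (p + t) ^ 2 := fun t k p => by
    rw [landauEnergy, Function.update_self, freq]
  refine Set.Countable.mono (s₂ := ⋃ a : (ℕ × ℤ) × (ℕ × ℤ), {t : ℝ | a.1 ≠ a.2 ∧
    landauEnergy B q (Function.update ϑ 2 t) a.1.1 a.1.2 =
      landauEnergy B q (Function.update ϑ 2 t) a.2.1 a.2.2}) ?_ (Set.countable_iUnion fun a => ?_)
  · intro t ht
    rw [Set.mem_ofPred_eq, Function.not_injective_iff] at ht
    obtain ⟨i, j, h, hne⟩ := ht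
    exact Set.mem_iUnion.2 ⟨(i, j), hne, h⟩
  · obtain ⟨⟨k, p⟩, k', p'⟩ := a
    refine Set.Subsingleton.countable ?_
    rintro t ⟨hne, ht⟩ t' ⟨-, ht'⟩
    simp only [hE] at ht ht'
    by_cases hp : p = p'
    · subst hp
      exfalso
      have h1 : (k : ℝ) = k' := by
        have h2 : freq B q * (2 * ((k : ℝ) - k')) = 0 := by linarith
        have h3 := (mul_eq_zero.1 h2).resolve_left hfr.ne'
        linarith
      exact hne (by rw [Nat.cast_injective h1])
    · have h1 : 2 * Real.pi * B * (2 * ((p : ℝ) - p')) * (t - t') = 0 := by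
        linear_combination ht - ht'
      have h2 : (p : ℝ) - p' ≠ 0 := sub_ne_zero.2 fun h => hp (by exact_mod_cast h)
      exact sub_eq_zero.1 ((mul_eq_zero.1 h1).resolve_left
        (mul_ne_zero hw.ne' (mul_ne_zero two_ne_zero h2)))

end Energies

/-! ### The Hamiltonian in the basis of Landau states. -/

section Basis

variable {B : ℝ} [hB : Fact (0 < B)] {q : ℕ} [NeZero q] {ϑ : E3}

/-- The Hilbert basis of Landau states. -/
def landauBasis (B : ℝ) (q : ℕ) (ϑ : E3) [Fact (0 < B)] [NeZero q] :
    HilbertBasis (ℕ × ℤ × Fin q) ℂ (MagL2 B q) :=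
  HilbertBasis.mkOfOrthogonalEqBot orthonormal_landauState (by
    rw [Submodule.eq_bot_iff]
    exact fun F hF => eq_zero_of_inner_landauState (ϑ := ϑ) fun i =>
      (Submodule.mem_orthogonal _ _).1 hF _ (Submodule.subset_span ⟨i, rfl⟩))

lemma coe_landauBasis : ⇑(landauBasis B q ϑ) = landauState B q ϑ :=
  HilbertBasis.coe_mkOfOrthogonalEqBot _ _

/-- Symmetry against wave packets moves `Π²` onto the Landau state, where it is multiplication by
the energy. -/
lemma landauBasis_repr_landauHamiltonian (v : (landauHamiltonian B q ϑ).domain)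
    (i : ℕ × ℤ × Fin q) : (landauBasis B q ϑ).repr (landauHamiltonian B q ϑ v) i =
      landauEnergy B q ϑ i.1 i.2.1 * (landauBasis B q ϑ).repr (v : MagL2 B q) i := by
  rw [HilbertBasis.repr_apply_apply, HilbertBasis.repr_apply_apply, coe_landauBasis, landauState,
    inner_packet_landauHamiltonian, momentumSq_landauPacket, map_smul, inner_smul_left,
    Complex.conj_ofReal]

/-- Maximality of the domain. The partial sums of the expansion of `u` are wave packets whose images
are the partial sums for `w`, so both converge and closedness applies. -/
lemma exists_landauHamiltonian_eq_of_repr {u w : MagL2 B q}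
    (h : ∀ i, (landauBasis B q ϑ).repr w i =
      landauEnergy B q ϑ i.1 i.2.1 * (landauBasis B q ϑ).repr u i) :
    ∃ h : u ∈ (landauHamiltonian B q ϑ).domain, landauHamiltonian B q ϑ ⟨u, h⟩ = w := by
  refine exists_landauHamiltonian_eq (U := fun s : Finset (ℕ × ℤ × Fin q) =>
    ∑ i ∈ s, (landauBasis B q ϑ).repr u i • landauPacket B q ϑ i) ?_ ?_
  · have h1 : HasSum _ _ := (landauBasis B q ϑ).hasSum_repr u
    refine Tendsto.congr (fun s => ?_) h1
    simp only [map_sum, map_smul, coe_landauBasis, landauState]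
  · have h1 : HasSum _ _ := (landauBasis B q ϑ).hasSum_repr w
    refine Tendsto.congr (fun s => ?_) h1
    simp only [map_sum, map_smul, coe_landauBasis, landauState, h]
    rw [Finset.sum_comm]
    refine Finset.sum_congr rfl fun i _ => ?_
    rw [← Finset.smul_sum, ← map_sum, momentumSq_landauPacket, map_smul, smul_smul, mul_comm]

end Basis

end PeriodicLandau

end

/-! ### Assembly of the theorem. -/

open PeriodicLandau in
theorem mainTheorem8 (B : ℝ) [Fact (0 < B)] (q : ℕ) (hq : 1 ≤ q) (ϑ : Fin 3 → ℝ)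
    (hϑ : ∀ j, ϑ j ∈ Set.Ico (0 : ℝ) 1) :
    -- the spectrum consists of the numbers `E(k,p)`
    spectrumOf (landauHamiltonian B q ϑ) =
        Set.range (fun i : ℕ × ℤ => (landauEnergy B q ϑ i.1 i.2 : ℂ)) ∧
    -- each of which is an isolated point of the spectrum
    (∀ (k : ℕ) (p : ℤ), ∃ ε > 0,
      spectrumOf (landauHamiltonian B q ϑ) ∩ Metric.ball (landauEnergy B q ϑ k p : ℂ) ε =
        {(landauEnergy B q ϑ k p : ℂ)}) ∧
    -- and an eigenvalue of finite multiplicity, each label `(k,p)` contributing exactly `q`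
    (∀ (k : ℕ) (p : ℤ),
      {i : ℕ × ℤ | landauEnergy B q ϑ i.1 i.2 = landauEnergy B q ϑ k p}.Finite ∧
      FiniteDimensional ℂ (eigenspaceOf (landauHamiltonian B q ϑ) (landauEnergy B q ϑ k p)) ∧
      Module.finrank ℂ (eigenspaceOf (landauHamiltonian B q ϑ) (landauEnergy B q ϑ k p)) =
        q * {i : ℕ × ℤ | landauEnergy B q ϑ i.1 i.2 = landauEnergy B q ϑ k p}.ncard) ∧
    -- in particular, the multiplicity is `q` if no other label has the same energy
    (∀ (k : ℕ) (p : ℤ),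
      (∀ (k' : ℕ) (p' : ℤ), landauEnergy B q ϑ k' p' = landauEnergy B q ϑ k p →
        k' = k ∧ p' = p) →
      Module.finrank ℂ (eigenspaceOf (landauHamiltonian B q ϑ) (landauEnergy B q ϑ k p)) = q) ∧
    -- which is the case for all labels, unless `ϑ₃` belongs to a countable set of exceptions
    {t : ℝ | ¬ Function.Injective fun i : ℕ × ℤ =>
      landauEnergy B q (Function.update ϑ 2 t) i.1 i.2}.Countable ∧
    -- pure point spectrum: an orthonormal basis of eigenfunctions, `q` for each label
    ∃ ψ : ℕ × ℤ × Fin q → (landauHamiltonian B q ϑ).domain,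
      Orthonormal ℂ (fun i => (ψ i : MagL2 B q)) ∧
      (Submodule.span ℂ (Set.range fun i => (ψ i : MagL2 B q))).topologicalClosure = ⊤ ∧
      ∀ i, landauHamiltonian B q ϑ (ψ i) =
        (landauEnergy B q ϑ i.1 i.2.1 : ℂ) • (ψ i : MagL2 B q) := by
  have : NeZero q := ⟨by lia⟩
  have hA : ∀ u w : MagL2 B q, (∀ i, (landauBasis B q ϑ).repr w i =
      landauEnergy B q ϑ i.1 i.2.1 * (landauBasis B q ϑ).repr u i) →
      ∃ h : u ∈ (landauHamiltonian B q ϑ).domain, landauHamiltonian B q ϑ ⟨u, h⟩ = w :=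
    fun _ _ h => exists_landauHamiltonian_eq_of_repr h
  have hA' := landauBasis_repr_landauHamiltonian (B := B) (q := q) (ϑ := ϑ)
  have hE : ∀ C, {i : ℕ × ℤ × Fin q | landauEnergy B q ϑ i.1 i.2.1 ≤ C}.Finite := fun C =>
    finite_setOf_label (finite_landauEnergy_le (B := B) (q := q) (ϑ := ϑ) C)
  have hrange : (Set.range fun i : ℕ × ℤ × Fin q => (landauEnergy B q ϑ i.1 i.2.1 : ℂ)) =
      Set.range fun i : ℕ × ℤ => (landauEnergy B q ϑ i.1 i.2 : ℂ) := by
    ext z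
    constructor
    · rintro ⟨i, rfl⟩
      exact ⟨(i.1, i.2.1), rfl⟩
    · rintro ⟨i, rfl⟩
      -- The element `0 : Fin q` exists because `q ≥ 1`: every label carries at least one state.
      exact ⟨(i.1, i.2, 0), rfl⟩
  have hspec := (spectrumOf_eq hA hA' hE).trans hrange
  have hmult : ∀ (k : ℕ) (p : ℤ),
      {i : ℕ × ℤ | landauEnergy B q ϑ i.1 i.2 = landauEnergy B q ϑ k p}.Finite ∧
      FiniteDimensional ℂ (eigenspaceOf (landauHamiltonian B q ϑ) (landauEnergy B q ϑ k p)) ∧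
      Module.finrank ℂ (eigenspaceOf (landauHamiltonian B q ϑ) (landauEnergy B q ϑ k p)) =
        q * {i : ℕ × ℤ | landauEnergy B q ϑ i.1 i.2 = landauEnergy B q ϑ k p}.ncard := by
    intro k p
    obtain ⟨h1, h2⟩ := finrank_eigenspaceOf hA hA' hE (landauEnergy B q ϑ k p)
    exact ⟨(finite_landauEnergy_le _).subset fun i hi => le_of_eq hi, h1, h2.trans
      (ncard_setOf_label {i | landauEnergy B q ϑ i.1 i.2 = landauEnergy B q ϑ k p})⟩
  refine ⟨hspec, fun k p => ?_, hmult, fun k p h => ?_, countable_not_injective_landauEnergy, ?_⟩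
  · rw [hspec, ← hrange]
    exact exists_ball_inter_eq hE (k, p, 0)
  · have e : {i : ℕ × ℤ | landauEnergy B q ϑ i.1 i.2 = landauEnergy B q ϑ k p} = {(k, p)} :=
      Set.eq_singleton_iff_unique_mem.2 ⟨rfl, fun i hi => Prod.ext (h _ _ hi).1 (h _ _ hi).2⟩
    rw [(hmult k p).2.2, e, Set.ncard_singleton, mul_one]
  · choose h h' using exists_eigenvector hA
    exact ⟨fun i => ⟨_, h i⟩, (landauBasis B q ϑ).orthonormal, (landauBasis B q ϑ).dense_span, h'⟩
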